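/- Let $m,n\ge 0$ be integers and let $V=\bigoplus_{i=1}^{m+n}\mathbb C(q)\,a_i$ be the $m|n$-dimensional superspace over $\mathbb C(q)$ with parity $\hat i=0$ for $i\le m$ and $\hat i=1$ for $i>m$. The Hecke algebra $H_3(q)$, with generators $g_1,g_2$ and relations $g_1g_2g_1=g_2g_1g_2$, $g_i^2=1+(q-q^{-1})g_i$, acts on $V^{\otimes 3}$ by letting $g_1,g_2$ act as $\hat R$ on the first two, respectively the last two, factors, where $$\hat R(a_i\otimes a_j)=\begin{cases}(-1)^{\hat i\hat j}\,a_j\otimes a_i+(q-q^{-1})\,a_i\otimes a_j & i<j,\\ (-1)^{\hat i}q^{(-1)^{\hat i}}\,a_i\otimes a_i & i=j,\\ (-1)^{\hat i\hat j}\,a_j\otimes a_i & i>j.\end{cases}$$ This action commutes with that of the quantum superalgebra $U_q(\mathfrak{gl}_{m|n})$ (Chevalley generators $e_i,f_i,q^{\pm\epsilon_j^*}$, with the usual quadratic, cubic and quartic Serre relations), which acts on $V$ by the vector representation and on tensor powers through the coproduct $e_i\mapsto e_i\otimes k_i^{-1}+\sigma^{p(i)}\otimes e_i$, $f_i\mapsto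 f_i\otimes 1+\sigma^{p(i)}k_i\otimes f_i$, $q^{h}\mapsto q^h\otimes q^h$, with $\sigma$ the parity operator, $p(i)$ the parity of $e_i$, and $k_i=q^{(-1)^{\hat i}\epsilon_i^*-(-1)^{\widehat{i+1}}\epsilon_{i+1}^*}$. Consequently the $q$-Schur functor $M\mapsto M\otimes_{H_3(q)}V^{\otimes 3}$ sends right $H_3(q)$-modules to $U_q(\mathfrak{gl}_{m|n})$-modules. Let $V^{(2,1)}$ be the image of the irreducible right $H_3(q)$-module labelled by the partition $(2,1)$, realized as the Specht module $(1+q g_1)\,g_2\,(1-q^{-1}g_1)\,H_3(q)$. With $[3]=q^2+1+q^{-2}$ put $$e(q)=\frac1{[3]}\Big(1-\tfrac12\,(g_1g_2+g_1+g_2+g_2g_1)+g_1g_2g_1\Big)+\frac{q-q^{-1}}{2[3]}\,(g_1-g_2g_1-g_1g_2+g_2),$$ and let $I_3(V)=e(q)H_3(q)\otimes_{H_3(q)}V^{\otimes 3}$. Then: 1. $I_3(V)\cong V^{(2,1)}$ as $U_q(\mathfrak{gl}_{m|n})$-modules. 2. If $m+n\ge 2$, then $I_3(V)$ is an irreducible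 $U_q(\mathfrak{gl}_{m|n})$-module. 3. The canonical $U_q(\mathfrak{gl}_{m|n})$-linear map $I_3(V)\to V^{\otimes 3}$, $x\otimes w\mapsto xw$, is injective. Under it, $I_3(V)$ has a $\mathbb C(q)$-basis that is sent to the family $\Gamma^{xy}_z$ indexed by the $(m,n)$-semistandard tableaux of shape $(2,1)$ with first row $x,y$ and second row $z$ (that is, $x<y$, or $x=y$ with $\hat x=0$; and $x<z$, or $x=z$ with $\hat x=1$). Here, for homogeneous $u,v$ in the tensor algebra $T(V)$, $[\![u,v]\!]_t=uv-(-1)^{\hat u\hat v}\,t\,vu$ and $[\![u,v]\!]=[\![u,v]\!]_1$, and $$\begin{array}{lll} \Gamma^{i_1i_3}_{i_2}=[\![a_{i_2},[\![a_{i_3},a_{i_1}]\!]]\!]_{q^{-2}}-(-1)^{\hat i_2(\hat i_1+\hat i_3)}q^{-1}[\![a_{i_3},[\![a_{i_1},a_{i_2}]\!]]\!] & i_1<i_2<i_3,\\ \Gamma^{i_1i_2}_{i_3}=[\![[\![a_{i_3},a_{i_1}]\!],a_{i_2}]\!]_{q^{-2}}-(-1)^{\hat i_2(\hat i_1+\hat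 i_3)}q^{-1}[\![[\![a_{i_2},a_{i_3}]\!],a_{i_1}]\!] & i_1<i_2<i_3,\\ \Gamma^{i_1i_2}_{i_2}=[\![[\![a_{i_1},a_{i_2}]\!],a_{i_2}]\!]_{q^{-1}} & i_1<i_2,\ \hat i_2=1,\\ \Gamma^{i_1i_2}_{i_2}=[\![a_{i_2},[\![a_{i_1},a_{i_2}]\!]]\!]_{q^{-1}} & i_1<i_2,\ \hat i_2=0,\\ \Gamma^{i_2i_3}_{i_2}=[\![a_{i_2},[\![a_{i_2},a_{i_3}]\!]]\!]_{q^{-1}} & i_2<i_3,\ \hat i_2=1,\\ \Gamma^{i_2i_2}_{i_3}=[\![[\![a_{i_2},a_{i_3}]\!],a_{i_2}]\!]_{q^{-1}} & i_2<i_3,\ \hat i_2=0. \end{array}$$ -/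

import Mathlib

set_option linter.unusedSimpArgs false
set_option linter.unusedSectionVars false

open scoped TensorProduct

noncomputable section

namespace Parastat

/-! ### Ground field, signed alphabet -/

/-- The ground field `ℂ(q)`. -/
def Kq : Type := RatFunc ℂ

instance : Field Kq := inferInstanceAs (Field (RatFunc ℂ))

/-- The indeterminate `q`. -/
def q : Kq := (RatFunc.X : RatFunc ℂ)

theorem q_ne_zero : q ≠ 0 := RatFunc.X_ne_zero

/-- Parity of the letter `i`: the first `m` letters are even, the last `n` are odd. -/
def par {m n : ℕ} (i : Fin (m + n)) : ℕ := if i.val < m then 0 else 1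

/-- `q ^ ((-1) ^ parity i)`. -/
def dq {m n : ℕ} (i : Fin (m + n)) : Kq := if i.val < m then q else q⁻¹

/-- `i` as the `i`-th letter; the simple root is `αᵢ = εᵢ - εᵢ₊₁`. -/
def lo {m n : ℕ} (i : Fin (m + n - 1)) : Fin (m + n) := ⟨i.val, by omega⟩

/-- The letter following `lo i`. -/
def hi {m n : ℕ} (i : Fin (m + n - 1)) : Fin (m + n) := ⟨i.val + 1, by omega⟩

/-- Parity of the simple root vector `eᵢ`: it is odd only when it joins the last even letter to
the first odd one. -/
def rpar {m n : ℕ} (i : Fin (m + n - 1)) : ℕ := if i.val + 1 = m then 1 else 0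

/-- `q ^ ⟨εⱼ*, αᵢ⟩`. -/
def wt {m n : ℕ} (j : Fin (m + n)) (i : Fin (m + n - 1)) : Kq :=
  if j = lo i then q else if j = hi i then q⁻¹ else 1

/-! ### The quantum superalgebra `U_q(gl(m|n))` by generators and relations -/

/-- Generators of `U_q(gl(m|n))`; `K j` stands for `q ^ (εⱼ*)`. -/
inductive UqGen (m n : ℕ) : Type
  | e (i : Fin (m + n - 1)) : UqGen m n
  | f (i : Fin (m + n - 1)) : UqGen m n
  | K (j : Fin (m + n)) : UqGen m n
  | Kinv (j : Fin (m + n)) : UqGen m n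

/-- The Cartan element `kᵢ = K_{lo i} ^ (±1) * K_{hi i} ^ (∓1)`, the exponents being
`(-1) ^ parity` and `-(-1) ^ parity`. Exchanging `K` and `Kinv` gives its inverse. -/
def cartan {m n : ℕ} {A : Type*} [Ring A] (K Kinv : Fin (m + n) → A) (i : Fin (m + n - 1)) : A :=
  (if par (lo i) = 0 then K (lo i) else Kinv (lo i)) *
    (if par (hi i) = 0 then Kinv (hi i) else K (hi i))

/-- Left side of the cubic Serre relation, with the scalar `c = q + q⁻¹`. -/
def serre3 {F A : Type*} [Field F] [Ring A] [Algebra F A] (c : F) (x y : A) : A :=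
  x * x * y - c • (x * y * x) + y * x * x

/-- Left side of the quartic Serre relation, `y` being the odd root vector and `c = q + q⁻¹`. -/
def serre4 {F A : Type*} [Field F] [Ring A] [Algebra F A] (c : F) (x y z : A) : A :=
  y * x * y * z + y * z * y * x + x * y * z * y + z * y * x * y - c • (y * x * z * y)

/-- The free algebra on the generators. -/
abbrev UqFree (m n : ℕ) : Type := FreeAlgebra Kq (UqGen m n)

/-- The generator `x` in the free algebra. -/
def gen {m n : ℕ} (x : UqGen m n) : UqFree m n := FreeAlgebra.ι Kq x

open UqGen in
/-- The defining relations of the quantum superalgebra `U_q(gl(m|n))`. -/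
inductive UqRel (m n : ℕ) : UqFree m n → UqFree m n → Prop
  | K_Kinv (j) : UqRel m n (gen (K j) * gen (Kinv j)) 1
  | Kinv_K (j) : UqRel m n (gen (Kinv j) * gen (K j)) 1
  | K_K (j l) : UqRel m n (gen (K j) * gen (K l)) (gen (K l) * gen (K j))
  | K_e (j i) : UqRel m n (gen (K j) * gen (e i)) (wt j i • (gen (e i) * gen (K j)))
  | K_f (j i) : UqRel m n (gen (K j) * gen (f i)) ((wt j i)⁻¹ • (gen (f i) * gen (K j)))
  | e_f (i j) : UqRel m n
      (gen (e i) * gen (f j) - (-1 : Kq) ^ (rpar i * rpar j) • (gen (f j) * gen (e i)))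
      (if i = j then (dq (lo i) - (dq (lo i))⁻¹)⁻¹ •
          (cartan (fun l => gen (K l)) (fun l => gen (Kinv l)) i -
            cartan (fun l => gen (Kinv l)) (fun l => gen (K l)) i)
        else 0)
  | e_e (i j) (h : i.val + 1 < j.val) : UqRel m n (gen (e i) * gen (e j)) (gen (e j) * gen (e i))
  | f_f (i j) (h : i.val + 1 < j.val) : UqRel m n (gen (f i) * gen (f j)) (gen (f j) * gen (f i))
  | e_sq (i) (h : rpar i = 1) : UqRel m n (gen (e i) * gen (e i)) 0
  | f_sq (i) (h : rpar i = 1) : UqRel m n (gen (f i) * gen (f i)) 0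
  | e_serre (i j) (h : rpar i = 0) (hij : i.val + 1 = j.val ∨ j.val + 1 = i.val) :
      UqRel m n (serre3 (q + q⁻¹) (gen (e i)) (gen (e j))) 0
  | f_serre (i j) (h : rpar i = 0) (hij : i.val + 1 = j.val ∨ j.val + 1 = i.val) :
      UqRel m n (serre3 (q + q⁻¹) (gen (f i)) (gen (f j))) 0
  | e_quartic (i j l) (h : rpar j = 1) (hij : i.val + 1 = j.val) (hjl : j.val + 1 = l.val) :
      UqRel m n (serre4 (q + q⁻¹) (gen (e i)) (gen (e j)) (gen (e l))) 0
  | f_quartic (i j l) (h : rpar j = 1) (hij : i.val + 1 = j.val) (hjl : j.val + 1 = l.val) :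
      UqRel m n (serre4 (q + q⁻¹) (gen (f i)) (gen (f j)) (gen (f l))) 0

/-- The quantum superalgebra `U_q(gl(m|n))` over `ℂ(q)`, as an associative algebra. -/
def Uq (m n : ℕ) : Type := RingQuot (UqRel m n)

instance (m n : ℕ) : Ring (Uq m n) := inferInstanceAs (Ring (RingQuot (UqRel m n)))

instance (m n : ℕ) : Algebra Kq (Uq m n) := inferInstanceAs (Algebra Kq (RingQuot (UqRel m n)))

/-- The class of a generator in `U_q(gl(m|n))`. -/
def ug {m n : ℕ} (x : UqGen m n) : Uq m n := RingQuot.mkAlgHom Kq (UqRel m n) (gen x)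

/-- The same relations, for elements of an arbitrary algebra (used only to construct
representations). -/
structure UqRels (m n : ℕ) {A : Type*} [Ring A] [Algebra Kq A]
    (e f : Fin (m + n - 1) → A) (K Kinv : Fin (m + n) → A) : Prop where
  K_Kinv : ∀ j, K j * Kinv j = 1
  Kinv_K : ∀ j, Kinv j * K j = 1
  K_K : ∀ j l, K j * K l = K l * K j
  K_e : ∀ j i, K j * e i = wt j i • (e i * K j)
  K_f : ∀ j i, K j * f i = (wt j i)⁻¹ • (f i * K j)
  e_f : ∀ i j, e i * f j - (-1 : Kq) ^ (rpar i * rpar j) • (f j * e i) =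
    if i = j then (dq (lo i) - (dq (lo i))⁻¹)⁻¹ • (cartan K Kinv i - cartan Kinv K i) else 0
  e_e : ∀ i j, i.val + 1 < j.val → e i * e j = e j * e i
  f_f : ∀ i j, i.val + 1 < j.val → f i * f j = f j * f i
  e_sq : ∀ i, rpar i = 1 → e i * e i = 0
  f_sq : ∀ i, rpar i = 1 → f i * f i = 0
  e_serre : ∀ i j, rpar i = 0 → (i.val + 1 = j.val ∨ j.val + 1 = i.val) → serre3 (q + q⁻¹) (e i) (e j) = 0
  f_serre : ∀ i j, rpar i = 0 → (i.val + 1 = j.val ∨ j.val + 1 = i.val) → serre3 (q + q⁻¹) (f i) (f j) = 0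
  e_quartic : ∀ i j l, rpar j = 1 → i.val + 1 = j.val → j.val + 1 = l.val →
    serre4 (q + q⁻¹) (e i) (e j) (e l) = 0
  f_quartic : ∀ i j l, rpar j = 1 → i.val + 1 = j.val → j.val + 1 = l.val →
    serre4 (q + q⁻¹) (f i) (f j) (f l) = 0

/-- A family satisfying the relations defines a homomorphism. -/
theorem UqRels.rel {m n : ℕ} {A : Type*} [Ring A] [Algebra Kq A] {g : UqGen m n → A}
    (h : UqRels m n (fun i => g (.e i)) (fun i => g (.f i)) (fun j => g (.K j))
      (fun j => g (.Kinv j))) ⦃x y : UqFree m n⦄ (hr : UqRel m n x y) :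
    FreeAlgebra.lift Kq g x = FreeAlgebra.lift Kq g y := by
  cases hr with
  | K_Kinv j => simpa [gen] using h.K_Kinv j
  | Kinv_K j => simpa [gen] using h.Kinv_K j
  | K_K j l => simpa [gen] using h.K_K j l
  | K_e j i => simpa [gen] using h.K_e j i
  | K_f j i => simpa [gen] using h.K_f j i
  | e_f i j =>
    have := h.e_f i j
    simp only [gen, map_sub, map_mul, map_smul, FreeAlgebra.lift_ι_apply, cartan] at this ⊢
    rw [this]
    split_ifs <;> simp
  | e_e i j hh => simpa [gen] using h.e_e i j hh
  | f_f i j hh => simpa [gen] using h.f_f i j hh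
  | e_sq i hh => simpa [gen] using h.e_sq i hh
  | f_sq i hh => simpa [gen] using h.f_sq i hh
  | e_serre i j hh hij => simpa [gen, serre3] using h.e_serre i j hh hij
  | f_serre i j hh hij => simpa [gen, serre3] using h.f_serre i j hh hij
  | e_quartic i j l hh hij hjl => simpa [gen, serre4] using h.e_quartic i j l hh hij hjl
  | f_quartic i j l hh hij hjl => simpa [gen, serre4] using h.f_quartic i j l hh hij hjl

/-- The homomorphism out of `U_q(gl(m|n))` given by the images of the generators. -/
def Uq.lift {m n : ℕ} {A : Type*} [Ring A] [Algebra Kq A] (g : UqGen m n → A)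
    (h : UqRels m n (fun i => g (.e i)) (fun i => g (.f i)) (fun j => g (.K j))
      (fun j => g (.Kinv j))) : Uq m n →ₐ[Kq] A :=
  RingQuot.liftAlgHom Kq ⟨FreeAlgebra.lift Kq g, fun _ _ hr => h.rel hr⟩

theorem Uq.lift_ug {m n : ℕ} {A : Type*} [Ring A] [Algebra Kq A] (g : UqGen m n → A)
    (h : UqRels m n (fun i => g (.e i)) (fun i => g (.f i)) (fun j => g (.K j))
      (fun j => g (.Kinv j))) (x : UqGen m n) : Uq.lift g h (ug x) = g x := by
  simp only [Uq.lift, ug, gen]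
  exact (RingQuot.liftAlgHom_mkAlgHom_apply Kq _ _ _).trans (FreeAlgebra.lift_ι_apply _ _)

theorem Uq.rels {m n : ℕ} {A : Type*} [Ring A] [Algebra Kq A] (φ : Uq m n →ₐ[Kq] A) :
    UqRels m n (fun i => φ (ug (.e i))) (fun i => φ (ug (.f i))) (fun j => φ (ug (.K j)))
      (fun j => φ (ug (.Kinv j))) := by
  have key : ∀ x y : UqFree m n, UqRel m n x y →
      φ (RingQuot.mkAlgHom Kq (UqRel m n) x) = φ (RingQuot.mkAlgHom Kq (UqRel m n) y) :=
    fun x y h => congrArg φ (RingQuot.mkAlgHom_rel Kq h)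
  have hφ : ∀ x : UqFree m n, φ (RingQuot.mkAlgHom Kq (UqRel m n) x) =
      FreeAlgebra.lift Kq (fun y => φ (ug y)) x := by
    intro x
    have : (φ.comp (RingQuot.mkAlgHom Kq (UqRel m n) : UqFree m n →ₐ[Kq] Uq m n)) =
        FreeAlgebra.lift Kq (fun y => φ (ug y)) := by
      apply FreeAlgebra.hom_ext
      funext y
      simp only [Function.comp_apply, FreeAlgebra.lift_ι_apply]
      rfl
    exact congrArg (fun ψ => ψ x) this
  simp only [hφ] at key
  have l : ∀ y : UqGen m n, FreeAlgebra.lift Kq (fun y => φ (ug y)) (gen y) = φ (ug y) :=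
    fun y => FreeAlgebra.lift_ι_apply _ _
  constructor
  · intro j; simpa [l] using key _ _ (.K_Kinv j)
  · intro j; simpa [l] using key _ _ (.Kinv_K j)
  · intro j i; simpa [l] using key _ _ (.K_K j i)
  · intro j i; simpa [l] using key _ _ (.K_e j i)
  · intro j i; simpa [l] using key _ _ (.K_f j i)
  · intro i j
    have := key _ _ (.e_f i j)
    simp only [map_sub, map_mul, map_smul, l] at this
    rw [this]
    simp only [cartan]
    split_ifs <;> simp [l]
  · intro i j h; simpa [l] using key _ _ (.e_e i j h)
  · intro i j h; simpa [l] using key _ _ (.f_f i j h)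
  · intro i h; simpa [l] using key _ _ (.e_sq i h)
  · intro i h; simpa [l] using key _ _ (.f_sq i h)
  · intro i j h hij; simpa [l, serre3] using key _ _ (.e_serre i j h hij)
  · intro i j h hij; simpa [l, serre3] using key _ _ (.f_serre i j h hij)
  · intro i j k h hij hjk; simpa [l, serre4] using key _ _ (.e_quartic i j k h hij hjk)
  · intro i j k h hij hjk; simpa [l, serre4] using key _ _ (.f_quartic i j k h hij hjk)

/-! ### Tensor products of the relations -/

section TensorRelations

variable {F A : Type*} [Field F] [Ring A] [Algebra F A]

theorem serre3_add (t : F) (ht : t ≠ 0) (x₁ x₂ y₁ y₂ : A)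
    (hxx : x₁ * x₂ = (t ^ 2)⁻¹ • (x₂ * x₁)) (hxy : x₁ * y₂ = t • (y₂ * x₁))
    (hyx : y₁ * x₂ = t • (x₂ * y₁)) (h₁ : serre3 (t + t⁻¹) x₁ y₁ = 0) (h₂ : serre3 (t + t⁻¹) x₂ y₂ = 0) :
    serre3 (t + t⁻¹) (x₁ + x₂) (y₁ + y₂) = 0 := by
  have hxx' : ∀ z, x₁ * (x₂ * z) = (t ^ 2)⁻¹ • (x₂ * (x₁ * z)) := fun z => by
    rw [← mul_assoc, hxx, smul_mul_assoc, mul_assoc]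
  have hxy' : ∀ z, x₁ * (y₂ * z) = t • (y₂ * (x₁ * z)) := fun z => by
    rw [← mul_assoc, hxy, smul_mul_assoc, mul_assoc]
  have hyx' : ∀ z, y₁ * (x₂ * z) = t • (x₂ * (y₁ * z)) := fun z => by
    rw [← mul_assoc, hyx, smul_mul_assoc, mul_assoc]
  have : serre3 (t + t⁻¹) (x₁ + x₂) (y₁ + y₂) = serre3 (t + t⁻¹) x₁ y₁ + serre3 (t + t⁻¹) x₂ y₂ := by
    simp only [serre3, mul_add, add_mul, mul_assoc, hxx, hxx', hxy, hxy', hyx, hyx',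
      mul_smul_comm, smul_mul_assoc, smul_smul, smul_add]
    match_scalars <;> field_simp <;> ring
  rw [this, h₁, h₂, add_zero]

theorem serre4_add (q : F) (q0 : q ≠ 0) (x₁ x₂ y₁ y₂ z₁ z₂ : A)
    (hxx : x₁ * x₂ = (q ^ 2)⁻¹ • (x₂ * x₁)) (hxy : x₁ * y₂ = q • (y₂ * x₁))
    (hxz : x₁ * z₂ = z₂ * x₁) (hyx : y₁ * x₂ = q • (x₂ * y₁)) (hyy : y₁ * y₂ = -(y₂ * y₁))
    (hyz : y₁ * z₂ = q⁻¹ • (z₂ * y₁)) (hzx : z₁ * x₂ = x₂ * z₁)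
    (hzy : z₁ * y₂ = q⁻¹ • (y₂ * z₁)) (hzz : z₁ * z₂ = q ^ 2 • (z₂ * z₁))
    (c₁ : x₁ * z₁ = z₁ * x₁) (c₂ : x₂ * z₂ = z₂ * x₂)
    (s₁ : y₁ * y₁ = 0) (s₂ : y₂ * y₂ = 0)
    (h₁ : serre4 (q + q⁻¹) x₁ y₁ z₁ = 0) (h₂ : serre4 (q + q⁻¹) x₂ y₂ z₂ = 0) :
    serre4 (q + q⁻¹) (x₁ + x₂) (y₁ + y₂) (z₁ + z₂) = 0 := by
  have a₁ : ∀ w, x₁ * (x₂ * w) = (q ^ 2)⁻¹ • (x₂ * (x₁ * w)) := fun w => by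
    rw [← mul_assoc, hxx, smul_mul_assoc, mul_assoc]
  have a₂ : ∀ w, x₁ * (y₂ * w) = q • (y₂ * (x₁ * w)) := fun w => by
    rw [← mul_assoc, hxy, smul_mul_assoc, mul_assoc]
  have a₃ : ∀ w, x₁ * (z₂ * w) = z₂ * (x₁ * w) := fun w => by
    rw [← mul_assoc, hxz, mul_assoc]
  have a₄ : ∀ w, y₁ * (x₂ * w) = q • (x₂ * (y₁ * w)) := fun w => by
    rw [← mul_assoc, hyx, smul_mul_assoc, mul_assoc]
  have a₅ : ∀ w, y₁ * (y₂ * w) = -(y₂ * (y₁ * w)) := fun w => by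
    rw [← mul_assoc, hyy, neg_mul, mul_assoc]
  have a₆ : ∀ w, y₁ * (z₂ * w) = q⁻¹ • (z₂ * (y₁ * w)) := fun w => by
    rw [← mul_assoc, hyz, smul_mul_assoc, mul_assoc]
  have a₇ : ∀ w, z₁ * (x₂ * w) = x₂ * (z₁ * w) := fun w => by
    rw [← mul_assoc, hzx, mul_assoc]
  have a₈ : ∀ w, z₁ * (y₂ * w) = q⁻¹ • (y₂ * (z₁ * w)) := fun w => by
    rw [← mul_assoc, hzy, smul_mul_assoc, mul_assoc]
  have a₉ : ∀ w, z₁ * (z₂ * w) = q ^ 2 • (z₂ * (z₁ * w)) := fun w => by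
    rw [← mul_assoc, hzz, smul_mul_assoc, mul_assoc]
  have b₁ : ∀ w, x₁ * (z₁ * w) = z₁ * (x₁ * w) := fun w => by
    rw [← mul_assoc, c₁, mul_assoc]
  have b₂ : ∀ w, x₂ * (z₂ * w) = z₂ * (x₂ * w) := fun w => by
    rw [← mul_assoc, c₂, mul_assoc]
  have d₁ : ∀ w, y₁ * (y₁ * w) = 0 := fun w => by rw [← mul_assoc, s₁, zero_mul]
  have d₂ : ∀ w, y₂ * (y₂ * w) = 0 := fun w => by rw [← mul_assoc, s₂, zero_mul]
  have : serre4 (q + q⁻¹) (x₁ + x₂) (y₁ + y₂) (z₁ + z₂) = serre4 (q + q⁻¹) x₁ y₁ z₁ + serre4 (q + q⁻¹) x₂ y₂ z₂ := by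
    simp only [serre4, mul_add, add_mul, mul_assoc, hxx, hxy, hxz, hyx, hyy, hyz, hzx, hzy, hzz,
      a₁, a₂, a₃, a₄, a₅, a₆, a₇, a₈, a₉, b₁, b₂, c₁, c₂, d₁, d₂, s₁, s₂, mul_zero, zero_mul, smul_zero,
      mul_neg, neg_mul, smul_neg, mul_smul_comm, smul_mul_assoc, smul_smul, smul_add]
    match_scalars <;> field_simp <;> ring
  rw [this, h₁, h₂, add_zero]

end TensorRelations

/-! ### Commutation with the Cartan elements -/

/-- The scalar `q ^ (αᵢ, αⱼ)` in `kᵢ eⱼ = q ^ (αᵢ, αⱼ) eⱼ kᵢ`. -/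
def cwt {m n : ℕ} (i j : Fin (m + n - 1)) : Kq :=
  (if par (lo i) = 0 then wt (lo i) j else (wt (lo i) j)⁻¹) *
    (if par (hi i) = 0 then (wt (hi i) j)⁻¹ else wt (hi i) j)

theorem wt_ne_zero {m n : ℕ} (j : Fin (m + n)) (i : Fin (m + n - 1)) : wt j i ≠ 0 := by
  have := q_ne_zero
  unfold wt
  split_ifs <;> simp [this]

theorem cwt_ne_zero {m n : ℕ} (i j : Fin (m + n - 1)) : cwt i j ≠ 0 := by
  unfold cwt
  split_ifs <;> simp [wt_ne_zero]

theorem dq_ne_zero {m n : ℕ} (j : Fin (m + n)) : dq j ≠ 0 := by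
  have := q_ne_zero
  unfold dq
  split_ifs <;> simp [this]

theorem wt_eq {m n : ℕ} (j : Fin (m + n)) (i : Fin (m + n - 1)) :
    wt j i = if j.val = i.val then q else if j.val = i.val + 1 then q⁻¹ else 1 := by
  simp [wt, lo, hi, Fin.ext_iff]

theorem wt_lo {m n : ℕ} (a i : Fin (m + n - 1)) :
    wt (lo a) i = if a.val = i.val then q else if a.val = i.val + 1 then q⁻¹ else 1 := wt_eq _ _

theorem wt_hi {m n : ℕ} (a i : Fin (m + n - 1)) :
    wt (hi a) i = if a.val + 1 = i.val then q else if a.val + 1 = i.val + 1 then q⁻¹ else 1 :=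
  wt_eq _ _

theorem par_eq_zero {m n : ℕ} (i : Fin (m + n)) : par i = 0 ↔ i.val < m := by
  simp [par]

theorem cwt_eq {m n : ℕ} (i j : Fin (m + n - 1)) :
    cwt i j = (if i.val < m then wt (lo i) j else (wt (lo i) j)⁻¹) *
      (if i.val + 1 < m then (wt (hi i) j)⁻¹ else wt (hi i) j) := by
  simp [cwt, par_eq_zero, lo, hi]

theorem cwt_odd {m n : ℕ} (i : Fin (m + n - 1)) (h : rpar i = 1) : cwt i i = 1 := by
  have h' : i.val + 1 = m := by unfold rpar at h; split_ifs at h; assumption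
  have h1 : i.val < m := by omega
  rw [cwt_eq, if_pos h1, if_neg (by omega), wt_lo, wt_hi, if_pos rfl,
    if_neg (by omega), if_pos rfl, mul_inv_cancel₀ q_ne_zero]

theorem cwt_even {m n : ℕ} (i : Fin (m + n - 1)) (h : rpar i = 0) : cwt i i = dq (lo i) ^ 2 := by
  have h' : i.val + 1 ≠ m := fun h' => by simp [rpar, h'] at h
  have e₁ : wt (lo i) i = q := by rw [wt_lo, if_pos rfl]
  have e₂ : wt (hi i) i = q⁻¹ := by rw [wt_hi, if_neg (by omega), if_pos rfl]
  rw [cwt_eq, e₁, e₂, inv_inv]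
  unfold dq
  by_cases h1 : i.val < m
  · rw [if_pos h1, if_pos (by omega), if_pos (show (lo i).val < m from h1), sq]
  · rw [if_neg h1, if_neg (by omega), if_neg (show ¬ (lo i).val < m from h1), sq]

theorem cwt_succ {m n : ℕ} (i j : Fin (m + n - 1)) (h : i.val + 1 = j.val) :
    cwt i j = (dq (lo j))⁻¹ ∧ cwt j i = (dq (lo j))⁻¹ := by
  have e₁ : wt (lo i) j = 1 := by
    rw [wt_lo, if_neg (show ¬ i.val = j.val by omega), if_neg (show ¬ i.val = j.val + 1 by omega)]
  have e₂ : wt (hi i) j = q := by rw [wt_hi, if_pos (show i.val + 1 = j.val by omega)]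
  have e₃ : wt (lo j) i = q⁻¹ := by
    rw [wt_lo, if_neg (show ¬ j.val = i.val by omega), if_pos (show j.val = i.val + 1 by omega)]
  have e₄ : wt (hi j) i = 1 := by
    rw [wt_hi, if_neg (show ¬ j.val + 1 = i.val by omega),
      if_neg (show ¬ j.val + 1 = i.val + 1 by omega)]
  rw [cwt_eq, cwt_eq, e₁, e₂, e₃, e₄]
  unfold dq
  by_cases h1 : j.val < m
  · rw [if_pos (show (lo j).val < m from h1), if_pos h1, if_pos (show i.val + 1 < m by omega)]
    simp
  · rw [if_neg (show ¬ (lo j).val < m from h1), if_neg h1, if_neg (show ¬ i.val + 1 < m by omega)]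
    simp

theorem cwt_far {m n : ℕ} (i j : Fin (m + n - 1)) (h : i.val + 1 < j.val) :
    cwt i j = 1 ∧ cwt j i = 1 := by
  have e₁ : wt (lo i) j = 1 := by
    rw [wt_lo, if_neg (show ¬ i.val = j.val by omega), if_neg (show ¬ i.val = j.val + 1 by omega)]
  have e₂ : wt (hi i) j = 1 := by
    rw [wt_hi, if_neg (show ¬ i.val + 1 = j.val by omega),
      if_neg (show ¬ i.val + 1 = j.val + 1 by omega)]
  have e₃ : wt (lo j) i = 1 := by
    rw [wt_lo, if_neg (show ¬ j.val = i.val by omega), if_neg (show ¬ j.val = i.val + 1 by omega)]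
  have e₄ : wt (hi j) i = 1 := by
    rw [wt_hi, if_neg (show ¬ j.val + 1 = i.val by omega),
      if_neg (show ¬ j.val + 1 = i.val + 1 by omega)]
  rw [cwt_eq, cwt_eq, e₁, e₂, e₃, e₄]
  simp

theorem cwt_symm {m n : ℕ} (i j : Fin (m + n - 1)) : cwt i j = cwt j i := by
  rcases lt_trichotomy i.val j.val with h | h | h
  · rcases Nat.lt_or_ge (i.val + 1) j.val with h' | h'
    · rw [(cwt_far i j h').1, (cwt_far i j h').2]
    · have := cwt_succ i j (by omega); rw [this.1, this.2]
  · rw [Fin.ext h]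
  · rcases Nat.lt_or_ge (j.val + 1) i.val with h' | h'
    · rw [(cwt_far j i h').1, (cwt_far j i h').2]
    · have := cwt_succ j i (by omega); rw [this.1, this.2]

theorem inv_comm_of {F A : Type*} [Field F] [Ring A] [Algebra F A] {k l x : A} {c : F}
    (hc : c ≠ 0) (h₁ : k * l = 1) (h₂ : l * k = 1) (h : k * x = c • (x * k)) :
    l * x = c⁻¹ • (x * l) := by
  have : l * (k * x) * l = c • (l * (x * k) * l) := by
    rw [h, mul_smul_comm, smul_mul_assoc]
  rw [← mul_assoc l k x, h₂, one_mul, mul_assoc l (x * k) l, mul_assoc x k l, h₁, mul_one] at this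
  rw [this, smul_smul, inv_mul_cancel₀ hc, one_smul]

section Cartan

variable {m n : ℕ} {A : Type*} [Ring A] [Algebra Kq A]
  {e f : Fin (m + n - 1) → A} {K Kinv : Fin (m + n) → A}

theorem mul_comm_of {k l x : A} {c d : Kq} (h₁ : k * x = c • (x * k)) (h₂ : l * x = d • (x * l)) :
    k * l * x = (c * d) • (x * (k * l)) := by
  rw [mul_assoc, h₂, mul_smul_comm, ← mul_assoc, h₁, smul_mul_assoc, mul_assoc, smul_smul,
    mul_comm d c]

theorem UqRels.Kinv_e (h : UqRels m n e f K Kinv) (j i) :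
    Kinv j * e i = (wt j i)⁻¹ • (e i * Kinv j) :=
  inv_comm_of (wt_ne_zero j i) (h.K_Kinv j) (h.Kinv_K j) (h.K_e j i)

theorem UqRels.Kinv_f (h : UqRels m n e f K Kinv) (j i) :
    Kinv j * f i = wt j i • (f i * Kinv j) := by
  have := inv_comm_of (inv_ne_zero (wt_ne_zero j i)) (h.K_Kinv j) (h.Kinv_K j) (h.K_f j i)
  rwa [inv_inv] at this

theorem UqRels.Kinv_K' (h : UqRels m n e f K Kinv) (j l) : Kinv j * K l = K l * Kinv j := by
  have := inv_comm_of (c := (1 : Kq)) one_ne_zero (h.K_Kinv j) (h.Kinv_K j)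
    (x := K l) (by rw [one_smul, h.K_K])
  simpa using this

theorem UqRels.Kinv_Kinv (h : UqRels m n e f K Kinv) (j l) :
    Kinv j * Kinv l = Kinv l * Kinv j := by
  have := inv_comm_of (c := (1 : Kq)) one_ne_zero (h.K_Kinv j) (h.Kinv_K j)
    (x := Kinv l) (by rw [one_smul, h.Kinv_K'])
  simpa using this

theorem UqRels.cartan_e (h : UqRels m n e f K Kinv) (i j) :
    cartan K Kinv i * e j = cwt i j • (e j * cartan K Kinv i) := by
  unfold cartan cwt
  split_ifs <;> exact mul_comm_of (by first | exact h.K_e _ _ | exact h.Kinv_e _ _)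
    (by first | exact h.K_e _ _ | exact h.Kinv_e _ _)

theorem UqRels.cartan_f (h : UqRels m n e f K Kinv) (i j) :
    cartan K Kinv i * f j = (cwt i j)⁻¹ • (f j * cartan K Kinv i) := by
  have h₁ : ∀ l, K l * f j = (wt l j)⁻¹ • (f j * K l) := fun l => h.K_f l j
  have h₂ : ∀ l, Kinv l * f j = ((wt l j)⁻¹)⁻¹ • (f j * Kinv l) := fun l => by
    rw [inv_inv, h.Kinv_f]
  unfold cartan cwt
  rw [mul_inv]
  split_ifs
  · exact mul_comm_of (h₁ _) (h₂ _)
  · exact mul_comm_of (h₁ _) (h₁ _)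
  · exact mul_comm_of (h₂ _) (h₂ _)
  · exact mul_comm_of (h₂ _) (h₁ _)

theorem UqRels.cartan_mul (h : UqRels m n e f K Kinv) (i) :
    cartan K Kinv i * cartan Kinv K i = 1 := by
  unfold cartan
  split_ifs
  · rw [h.Kinv_K' (hi i) (lo i) |>.symm, mul_assoc, ← mul_assoc _ (Kinv (lo i)), h.K_Kinv,
      one_mul, h.Kinv_K]
  · rw [h.K_K, mul_assoc, ← mul_assoc _ (Kinv (lo i)), h.K_Kinv, one_mul, h.K_Kinv]
  · rw [h.Kinv_Kinv, mul_assoc, ← mul_assoc _ (K (lo i)), h.Kinv_K, one_mul, h.Kinv_K]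
  · rw [h.Kinv_K', mul_assoc, ← mul_assoc _ (K (lo i)), h.Kinv_K, one_mul, h.K_Kinv]

theorem UqRels.symm (h : UqRels m n e f K Kinv) (i) :
    cartan Kinv K i * cartan K Kinv i = 1 := by
  unfold cartan
  split_ifs
  · rw [h.Kinv_K', mul_assoc, ← mul_assoc _ (K (lo i)), h.Kinv_K, one_mul, h.K_Kinv]
  · rw [h.Kinv_Kinv, mul_assoc, ← mul_assoc _ (K (lo i)), h.Kinv_K, one_mul, h.Kinv_K]
  · rw [h.K_K, mul_assoc, ← mul_assoc _ (Kinv (lo i)), h.K_Kinv, one_mul, h.K_Kinv]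
  · rw [h.Kinv_K' (hi i) (lo i) |>.symm, mul_assoc, ← mul_assoc _ (Kinv (lo i)), h.K_Kinv,
      one_mul, h.Kinv_K]

theorem UqRels.cinv_e (h : UqRels m n e f K Kinv) (i j) :
    cartan Kinv K i * e j = (cwt i j)⁻¹ • (e j * cartan Kinv K i) :=
  inv_comm_of (cwt_ne_zero i j) (h.cartan_mul i) (h.symm i) (h.cartan_e i j)

theorem UqRels.cinv_f (h : UqRels m n e f K Kinv) (i j) :
    cartan Kinv K i * f j = cwt i j • (f j * cartan Kinv K i) := by
  have := inv_comm_of (inv_ne_zero (cwt_ne_zero i j)) (h.cartan_mul i) (h.symm i)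
    (h.cartan_f i j)
  rwa [inv_inv] at this

/-- An element commuting with every `K j` and `Kinv j` commutes with the Cartan elements. -/
theorem comm_cartan {K Kinv : Fin (m + n) → A} {x : A} (h₁ : ∀ j, x * K j = K j * x)
    (h₂ : ∀ j, x * Kinv j = Kinv j * x) (i) : x * cartan K Kinv i = cartan K Kinv i * x := by
  have key : ∀ a b : A, x * a = a * x → x * b = b * x → x * (a * b) = a * b * x :=
    fun a b ha hb => by rw [← mul_assoc, ha, mul_assoc, hb, mul_assoc]
  unfold cartan
  split_ifs <;> exact key _ _ (by first | exact h₁ _ | exact h₂ _)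
    (by first | exact h₁ _ | exact h₂ _)

theorem UqRels.K_cartan (h : UqRels m n e f K Kinv) (j i) :
    K j * cartan K Kinv i = cartan K Kinv i * K j :=
  comm_cartan (fun l => h.K_K j l) (fun l => (h.Kinv_K' l j).symm) i

theorem UqRels.K_cinv (h : UqRels m n e f K Kinv) (j i) :
    K j * cartan Kinv K i = cartan Kinv K i * K j :=
  comm_cartan (fun l => (h.Kinv_K' l j).symm) (fun l => h.K_K j l) i

theorem UqRels.cartan_comm (h : UqRels m n e f K Kinv) (i j) :
    cartan K Kinv i * cartan K Kinv j = cartan K Kinv j * cartan K Kinv i :=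
  comm_cartan (fun l => (h.K_cartan l i).symm) (fun l => (comm_cartan (fun a => h.Kinv_K' l a)
    (fun a => h.Kinv_Kinv l a) i).symm) j

theorem UqRels.cinv_comm (h : UqRels m n e f K Kinv) (i j) :
    cartan Kinv K i * cartan Kinv K j = cartan Kinv K j * cartan Kinv K i :=
  comm_cartan (fun l => (comm_cartan (fun a => h.Kinv_Kinv l a) (fun a => h.Kinv_K' l a)
    i).symm) (fun l => (h.K_cinv l i).symm) j

end Cartan

/-! ### Graded representations and their tensor products -/

/-- A `ℤ/2`-graded representation of `U_q(gl(m|n))` on `M`: an action together with the parity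
operator `σ` (`1` on even vectors, `-1` on odd vectors), with which `eᵢ`, `fᵢ` have parity
`rpar i` and `K j` is even. -/
structure SuperRep (m n : ℕ) (M : Type*) [AddCommGroup M] [Module Kq M] where
  /-- The action. -/
  ρ : Uq m n →ₐ[Kq] Module.End Kq M
  /-- The parity operator. -/
  σ : Module.End Kq M
  σ_sq : σ * σ = 1
  σ_e : ∀ i, σ * ρ (ug (.e i)) = (-1 : Kq) ^ rpar i • (ρ (ug (.e i)) * σ)
  σ_f : ∀ i, σ * ρ (ug (.f i)) = (-1 : Kq) ^ rpar i • (ρ (ug (.f i)) * σ)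
  σ_K : ∀ j, σ * ρ (ug (.K j)) = ρ (ug (.K j)) * σ

section Tensor

variable {m n : ℕ} {M N : Type*} [AddCommGroup M] [Module Kq M] [AddCommGroup N] [Module Kq N]

namespace SuperRep

/-- The operator of `eᵢ`. -/
abbrev e (R : SuperRep m n M) (i : Fin (m + n - 1)) : Module.End Kq M := R.ρ (ug (.e i))

/-- The operator of `fᵢ`. -/
abbrev f (R : SuperRep m n M) (i : Fin (m + n - 1)) : Module.End Kq M := R.ρ (ug (.f i))

/-- The operator of `K j`. -/
abbrev K (R : SuperRep m n M) (j : Fin (m + n)) : Module.End Kq M := R.ρ (ug (.K j))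

/-- The operator of the inverse of `K j`. -/
abbrev Kinv (R : SuperRep m n M) (j : Fin (m + n)) : Module.End Kq M := R.ρ (ug (.Kinv j))

/-- The operator of `kᵢ`. -/
abbrev k (R : SuperRep m n M) (i : Fin (m + n - 1)) : Module.End Kq M := cartan R.K R.Kinv i

/-- The operator of the inverse of `kᵢ`. -/
abbrev kinv (R : SuperRep m n M) (i : Fin (m + n - 1)) : Module.End Kq M := cartan R.Kinv R.K i

/-- The operator `σ ^ rpar i`. -/
abbrev s (R : SuperRep m n M) (i : Fin (m + n - 1)) : Module.End Kq M := R.σ ^ rpar i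

theorem rels (R : SuperRep m n M) : UqRels m n R.e R.f R.K R.Kinv := Uq.rels R.ρ

/-- Images of the generators under the coproduct
`Δ eᵢ = eᵢ ⊗ kᵢ⁻¹ + σ ^ p(i) ⊗ eᵢ`, `Δ fᵢ = fᵢ ⊗ 1 + σ ^ p(i) kᵢ ⊗ fᵢ`, `Δ K j = K j ⊗ K j`;
the powers of `σ` are the signs of the rule `(a ⊗ b)(v ⊗ w) = ± av ⊗ bw`. -/
def tensorGen (R : SuperRep m n M) (S : SuperRep m n N) :
    UqGen m n → Module.End Kq (M ⊗[Kq] N)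
  | .e i => TensorProduct.map (R.e i) (S.kinv i) + TensorProduct.map (R.s i) (S.e i)
  | .f i => TensorProduct.map (R.f i) 1 + TensorProduct.map (R.s i * R.k i) (S.f i)
  | .K j => TensorProduct.map (R.K j) (S.K j)
  | .Kinv j => TensorProduct.map (R.Kinv j) (S.Kinv j)

theorem pp (a c : Module.End Kq M) (b d : Module.End Kq N) :
    TensorProduct.map a b * TensorProduct.map c d = TensorProduct.map (a * c) (b * d) :=
  (TensorProduct.map_mul a c b d).symm

theorem map_neg_left' (a : Module.End Kq M) (b : Module.End Kq N) :
    TensorProduct.map (-a) b = -TensorProduct.map a b :=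
  TensorProduct.ext' fun x y => by simp [TensorProduct.neg_tmul]

theorem negOne_smul (T : Module.End Kq (M ⊗[Kq] N)) : (-1 : Kq) • T = -T :=
  LinearMap.ext fun x => neg_one_smul Kq (T x)

theorem map_sub_left' (a c : Module.End Kq M) (b : Module.End Kq N) :
    TensorProduct.map (a - c) b = TensorProduct.map a b - TensorProduct.map c b :=
  TensorProduct.ext' fun x y => by simp [TensorProduct.sub_tmul]

theorem map_sub_right' (a : Module.End Kq M) (b d : Module.End Kq N) :
    TensorProduct.map a (b - d) = TensorProduct.map a b - TensorProduct.map a d :=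
  TensorProduct.ext' fun x y => by simp [TensorProduct.tmul_sub]

theorem σ_Kinv (R : SuperRep m n M) (j) : R.σ * R.Kinv j = R.Kinv j * R.σ := by
  have := inv_comm_of (c := (1 : Kq)) one_ne_zero (R.rels.K_Kinv j) (R.rels.Kinv_K j)
    (x := R.σ) (by rw [one_smul]; exact (R.σ_K j).symm)
  simpa using this.symm

theorem σ_k (R : SuperRep m n M) (i) : R.σ * R.k i = R.k i * R.σ :=
  comm_cartan R.σ_K R.σ_Kinv i

theorem s_comm (R : SuperRep m n M) {x : Module.End Kq M} (h : R.σ * x = x * R.σ) (i) :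
    R.s i * x = x * R.s i := (Commute.pow_left h _)

theorem s_sq (R : SuperRep m n M) (i) : R.s i * R.s i = 1 := by
  rw [← pow_add, ← two_mul, pow_mul, pow_two, R.σ_sq, one_pow]

theorem s_skew (R : SuperRep m n M) {x : Module.End Kq M} {p : ℕ}
    (h : R.σ * x = (-1 : Kq) ^ p • (x * R.σ)) (j) :
    R.s j * x = (-1 : Kq) ^ (rpar j * p) • (x * R.s j) := by
  unfold s
  generalize rpar j = r
  induction r with
  | zero => simp
  | succ r ih =>
    rw [pow_succ, mul_assoc, h, mul_smul_comm, ← mul_assoc, ih, smul_mul_assoc, smul_smul,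
      mul_assoc, ← pow_add]
    congr 2
    ring

theorem rpar_le {i : Fin (m + n - 1)} : rpar i = 0 ∨ rpar i = 1 := by
  unfold rpar; split_ifs <;> simp

theorem rpar_mul {i j : Fin (m + n - 1)} (h : i ≠ j) : rpar i * rpar j = 0 := by
  unfold rpar
  split_ifs with h₁ h₂
  · exact absurd (Fin.ext (by omega)) h
  all_goals rfl

theorem sign_sq (p : ℕ) : (-1 : Kq) ^ p * (-1 : Kq) ^ p = 1 := by
  rw [← mul_pow]; simp

/-- `eᵢ ⊗ kᵢ⁻¹` and `σ ^ p(j) ⊗ eⱼ` commute up to a scalar. -/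
theorem e_AB (R : SuperRep m n M) (S : SuperRep m n N) (i j) :
    TensorProduct.map (R.e i) (S.kinv i) * TensorProduct.map (R.s j) (S.e j) =
      ((-1 : Kq) ^ (rpar j * rpar i) * (cwt i j)⁻¹) •
        (TensorProduct.map (R.s j) (S.e j) * TensorProduct.map (R.e i) (S.kinv i)) := by
  rw [pp, pp, S.rels.cinv_e, R.s_skew (R.σ_e i), TensorProduct.map_smul_left,
    TensorProduct.map_smul_right, smul_smul, mul_right_comm, sign_sq, one_mul]

/-- `σ ^ p(i) kᵢ ⊗ fᵢ` and `fⱼ ⊗ 1` commute up to a scalar. -/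
theorem f_AB (R : SuperRep m n M) (S : SuperRep m n N) (i j) :
    TensorProduct.map (R.s i * R.k i) (S.f i) * TensorProduct.map (R.f j) 1 =
      ((-1 : Kq) ^ (rpar i * rpar j) * (cwt i j)⁻¹) •
        (TensorProduct.map (R.f j) 1 * TensorProduct.map (R.s i * R.k i) (S.f i)) := by
  rw [pp, pp, mul_assoc, R.rels.cartan_f, mul_smul_comm, ← mul_assoc, R.s_skew (R.σ_f j),
    smul_mul_assoc, smul_smul, TensorProduct.map_smul_left, mul_one, one_mul, mul_assoc,
    mul_comm ((cwt i j)⁻¹)]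

theorem kk_comm (R : SuperRep m n M) (i j) :
    (R.s i * R.k i) * (R.s j * R.k j) = (R.s j * R.k j) * (R.s i * R.k i) := by
  have h₁ : R.k i * R.s j = R.s j * R.k i := (R.s_comm (R.σ_k i) j).symm
  have h₂ : R.k j * R.s i = R.s i * R.k j := (R.s_comm (R.σ_k j) i).symm
  have h₃ : R.s i * R.s j = R.s j * R.s i := R.s_comm (by rw [← pow_succ', pow_succ]) i
  rw [mul_assoc, ← mul_assoc (R.k i), h₁, mul_assoc (R.s j), R.rels.cartan_comm, ← mul_assoc,
    h₃, mul_assoc, mul_assoc, ← mul_assoc (R.k j), h₂, mul_assoc]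

theorem cartan_map (R : SuperRep m n M) (S : SuperRep m n N) (i) :
    cartan (fun j => TensorProduct.map (R.K j) (S.K j))
      (fun j => TensorProduct.map (R.Kinv j) (S.Kinv j)) i =
      TensorProduct.map (R.k i) (S.k i) := by
  unfold k cartan
  split_ifs <;> rw [pp]

theorem cinv_map (R : SuperRep m n M) (S : SuperRep m n N) (i) :
    cartan (fun j => TensorProduct.map (R.Kinv j) (S.Kinv j))
      (fun j => TensorProduct.map (R.K j) (S.K j)) i =
      TensorProduct.map (R.kinv i) (S.kinv i) := by
  unfold kinv cartan
  split_ifs <;> rw [pp]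

theorem tensor_e_f (R : SuperRep m n M) (S : SuperRep m n N) (i j) :
    tensorGen R S (.e i) * tensorGen R S (.f j) -
      (-1 : Kq) ^ (rpar i * rpar j) • (tensorGen R S (.f j) * tensorGen R S (.e i)) =
    TensorProduct.map (R.e i * R.f j - (-1 : Kq) ^ (rpar i * rpar j) • (R.f j * R.e i))
        (S.kinv i) +
      TensorProduct.map (R.s i * (R.s j * R.k j))
        (S.e i * S.f j - (-1 : Kq) ^ (rpar i * rpar j) • (S.f j * S.e i)) := by
  have h₁ : TensorProduct.map (R.e i) (S.kinv i) * TensorProduct.map (R.s j * R.k j) (S.f j) =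
      (-1 : Kq) ^ (rpar i * rpar j) •
        (TensorProduct.map (R.s j * R.k j) (S.f j) * TensorProduct.map (R.e i) (S.kinv i)) := by
    rw [pp, pp, S.rels.cinv_f, mul_assoc (R.s j), R.rels.cartan_e, mul_smul_comm,
      ← mul_assoc (R.s j), R.s_skew (R.σ_e i), smul_mul_assoc, smul_smul, mul_assoc,
      TensorProduct.map_smul_left, TensorProduct.map_smul_right, smul_smul, cwt_symm j i,
      mul_comm (rpar j), mul_left_comm, sign_sq, mul_one]
  have h₂ : TensorProduct.map (R.s i) (S.e i) * TensorProduct.map (R.f j) 1 =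
      (-1 : Kq) ^ (rpar i * rpar j) •
        (TensorProduct.map (R.f j) 1 * TensorProduct.map (R.s i) (S.e i)) := by
    rw [pp, pp, R.s_skew (R.σ_f j), TensorProduct.map_smul_left, mul_one, one_mul]
  have h₃ : R.s j * R.k j * R.s i = R.s i * (R.s j * R.k j) := by
    rw [mul_assoc, ← R.s_comm (R.σ_k j) i, ← mul_assoc, ← mul_assoc]
    congr 1
    exact R.s_comm (by rw [← pow_succ', pow_succ]) j
  simp only [tensorGen, mul_add, add_mul, h₁, h₂, smul_add]
  simp only [pp, h₃, map_sub_left', map_sub_right', TensorProduct.map_smul_left,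
    TensorProduct.map_smul_right, mul_one, one_mul]
  abel

theorem serre3_map (a c : Module.End Kq M) (b d : Module.End Kq N) (hbd : b * d = d * b)
    (h : serre3 (q + q⁻¹) a c = 0) :
    serre3 (q + q⁻¹) (TensorProduct.map a b) (TensorProduct.map c d) = 0 := by
  have : serre3 (q + q⁻¹) (TensorProduct.map a b) (TensorProduct.map c d) =
      TensorProduct.map (serre3 (q + q⁻¹) a c) (b * b * d) := by
    simp only [serre3, pp, TensorProduct.map_add_left, map_sub_left', TensorProduct.map_smul_left]
    rw [show b * d * b = b * b * d by rw [mul_assoc, ← hbd, mul_assoc],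
      show d * b * b = b * b * d by rw [← hbd, mul_assoc, ← hbd, mul_assoc]]
  rw [this, h, TensorProduct.map_zero_left]

theorem serre3_map' (a c : Module.End Kq M) (b d : Module.End Kq N) (hac : a * c = c * a)
    (h : serre3 (q + q⁻¹) b d = 0) :
    serre3 (q + q⁻¹) (TensorProduct.map a b) (TensorProduct.map c d) = 0 := by
  have : serre3 (q + q⁻¹) (TensorProduct.map a b) (TensorProduct.map c d) =
      TensorProduct.map (a * a * c) (serre3 (q + q⁻¹) b d) := by
    simp only [serre3, pp, TensorProduct.map_add_right, map_sub_right',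
      TensorProduct.map_smul_right]
    rw [show a * c * a = a * a * c by rw [mul_assoc, ← hac, mul_assoc],
      show c * a * a = a * a * c by rw [← hac, mul_assoc, ← hac, mul_assoc]]
  rw [this, h, TensorProduct.map_zero_right]

theorem perm4 {A : Type*} [Ring A] {x y z : A} (hxy : x * y = y * x) (hyz : y * z = z * y)
    (hxz : x * z = z * x) : y * x * y * z = y * x * z * y ∧ y * z * y * x = y * x * z * y ∧
      x * y * z * y = y * x * z * y ∧ z * y * x * y = y * x * z * y := by
  refine ⟨?_, ?_, ?_, ?_⟩
  · rw [mul_assoc (y * x), hyz, ← mul_assoc]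
  · rw [mul_assoc (y * z), ← hxy, mul_assoc y z, ← mul_assoc z x, ← hxz, mul_assoc x z y,
      ← mul_assoc, ← mul_assoc, ← hxy, hxy]
  · rw [hxy]
  · rw [← hyz, mul_assoc y z x, ← hxz, ← mul_assoc]

theorem serre4_map (a₁ a₂ a₃ : Module.End Kq M) (b₁ b₂ b₃ : Module.End Kq N)
    (h₁₂ : b₁ * b₂ = b₂ * b₁) (h₂₃ : b₂ * b₃ = b₃ * b₂) (h₁₃ : b₁ * b₃ = b₃ * b₁)
    (h : serre4 (q + q⁻¹) a₁ a₂ a₃ = 0) :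
    serre4 (q + q⁻¹) (TensorProduct.map a₁ b₁) (TensorProduct.map a₂ b₂)
      (TensorProduct.map a₃ b₃) = 0 := by
  obtain ⟨e₁, e₂, e₃, e₄⟩ := perm4 h₁₂ h₂₃ h₁₃
  have : serre4 (q + q⁻¹) (TensorProduct.map a₁ b₁) (TensorProduct.map a₂ b₂)
      (TensorProduct.map a₃ b₃) =
      TensorProduct.map (serre4 (q + q⁻¹) a₁ a₂ a₃) (b₂ * b₁ * b₃ * b₂) := by
    simp only [serre4, pp, TensorProduct.map_add_left, map_sub_left',
      TensorProduct.map_smul_left, e₁, e₂, e₃, e₄]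
  rw [this, h, TensorProduct.map_zero_left]

theorem serre4_map' (a₁ a₂ a₃ : Module.End Kq M) (b₁ b₂ b₃ : Module.End Kq N)
    (h₁₂ : a₁ * a₂ = a₂ * a₁) (h₂₃ : a₂ * a₃ = a₃ * a₂) (h₁₃ : a₁ * a₃ = a₃ * a₁)
    (h : serre4 (q + q⁻¹) b₁ b₂ b₃ = 0) :
    serre4 (q + q⁻¹) (TensorProduct.map a₁ b₁) (TensorProduct.map a₂ b₂)
      (TensorProduct.map a₃ b₃) = 0 := by
  obtain ⟨e₁, e₂, e₃, e₄⟩ := perm4 h₁₂ h₂₃ h₁₃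
  have : serre4 (q + q⁻¹) (TensorProduct.map a₁ b₁) (TensorProduct.map a₂ b₂)
      (TensorProduct.map a₃ b₃) =
      TensorProduct.map (a₂ * a₁ * a₃ * a₂) (serre4 (q + q⁻¹) b₁ b₂ b₃) := by
    simp only [serre4, pp, TensorProduct.map_add_right, map_sub_right',
      TensorProduct.map_smul_right, e₁, e₂, e₃, e₄]
  rw [this, h, TensorProduct.map_zero_right]

theorem q_add_eq (j : Fin (m + n)) : q + q⁻¹ = dq j + (dq j)⁻¹ := by
  unfold dq
  split_ifs
  · rfl
  · rw [inv_inv, add_comm]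

theorem rpar_one {i : Fin (m + n - 1)} (h : rpar i = 1) : i.val + 1 = m := by
  by_contra h'
  simp [rpar, h'] at h

theorem rpar_zero {i : Fin (m + n - 1)} (h : i.val + 1 ≠ m) : rpar i = 0 := by
  simp [rpar, h]

/-- The scalars `q ^ (-(αᵢ, αⱼ))` for the cubic relation. -/
theorem serre_scalars (i j : Fin (m + n - 1)) (hi₀ : rpar i = 0)
    (hij : i.val + 1 = j.val ∨ j.val + 1 = i.val) :
    ∃ t : Kq, t ≠ 0 ∧ q + q⁻¹ = t + t⁻¹ ∧ (cwt i i)⁻¹ = (t ^ 2)⁻¹ ∧ (cwt i j)⁻¹ = t ∧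
      (cwt j i)⁻¹ = t := by
  refine ⟨dq (lo i), dq_ne_zero _, q_add_eq _, by rw [cwt_even i hi₀], ?_⟩
  rcases hij with h | h
  · have hd : dq (lo j) = dq (lo i) := by
      have : i.val + 1 ≠ m := fun h' => by simp [rpar, h'] at hi₀
      unfold dq lo
      simp only
      by_cases h1 : i.val < m
      · rw [if_pos h1, if_pos (by omega)]
      · rw [if_neg h1, if_neg (by omega)]
    rw [(cwt_succ i j h).1, (cwt_succ i j h).2, inv_inv, hd]
    exact ⟨rfl, rfl⟩
  · rw [(cwt_succ j i h).1, (cwt_succ j i h).2, inv_inv]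
    exact ⟨rfl, rfl⟩

/-- The operators of the tensor product satisfy the relations. -/
theorem tensor_rels (R : SuperRep m n M) (S : SuperRep m n N) :
    UqRels m n (fun i => tensorGen R S (.e i)) (fun i => tensorGen R S (.f i))
      (fun j => tensorGen R S (.K j)) (fun j => tensorGen R S (.Kinv j)) where
  K_Kinv j := by
    simp only [tensorGen, pp, R.rels.K_Kinv, S.rels.K_Kinv]
    exact TensorProduct.map_one
  Kinv_K j := by
    simp only [tensorGen, pp, R.rels.Kinv_K, S.rels.Kinv_K]
    exact TensorProduct.map_one
  K_K j l := by simp only [tensorGen, pp, R.rels.K_K j l, S.rels.K_K j l]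
  K_e j i := by
    simp only [tensorGen, mul_add, add_mul, pp, smul_add, R.rels.K_e, S.rels.K_e,
      S.rels.K_cinv j i, ← R.s_comm (R.σ_K j) i, TensorProduct.map_smul_left,
      TensorProduct.map_smul_right]
  K_f j i := by
    have : R.K j * (R.s i * R.k i) = R.s i * R.k i * R.K j := by
      rw [← mul_assoc, ← R.s_comm (R.σ_K j) i, mul_assoc, R.rels.K_cartan, mul_assoc]
    simp only [tensorGen, mul_add, add_mul, pp, smul_add, R.rels.K_f, S.rels.K_f, this,
      TensorProduct.map_smul_left, TensorProduct.map_smul_right, mul_one, one_mul]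
  e_f i j := by
    rw [tensor_e_f, R.rels.e_f, S.rels.e_f]
    by_cases h : i = j
    · subst h
      have e₁ := cartan_map R S i
      have e₂ := cinv_map R S i
      simp only [if_true, tensorGen, e₁, e₂]
      rw [← mul_assoc, R.s_sq, one_mul, TensorProduct.map_smul_left,
        TensorProduct.map_smul_right, ← smul_add, map_sub_left', map_sub_right']
      congr 1
      abel
    · simp only [if_neg h, TensorProduct.map_zero_left, TensorProduct.map_zero_right, add_zero]
  e_e i j h := by
    have hne : rpar i * rpar j = 0 := rpar_mul (fun h' => by rw [h'] at h; omega)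
    have h₁ := e_AB R S i j
    have h₂ := e_AB R S j i
    rw [(cwt_far i j h).1, mul_comm (rpar j), hne, pow_zero, inv_one, one_mul, one_smul] at h₁
    rw [(cwt_far i j h).2, hne, pow_zero, inv_one, one_mul, one_smul] at h₂
    have h₃ : R.s i * R.s j = R.s j * R.s i := R.s_comm (by rw [← pow_succ', pow_succ]) i
    simp only [tensorGen, mul_add, add_mul, h₁, h₂]
    simp only [pp, R.rels.e_e i j h, S.rels.e_e i j h, S.rels.cinv_comm i j, h₃]
    abel
  f_f i j h := by
    have hne : rpar i * rpar j = 0 := rpar_mul (fun h' => by rw [h'] at h; omega)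
    have h₁ := f_AB R S i j
    have h₂ := f_AB R S j i
    rw [(cwt_far i j h).1, hne, pow_zero, inv_one, one_mul, one_smul] at h₁
    rw [(cwt_far i j h).2, mul_comm (rpar j), hne, pow_zero, inv_one, one_mul, one_smul] at h₂
    simp only [tensorGen, mul_add, add_mul, h₁, h₂]
    simp only [pp, R.rels.f_f i j h, S.rels.f_f i j h, kk_comm R i j]
    abel
  e_sq i h := by
    have h₁ := e_AB R S i i
    rw [h, cwt_odd i h, one_mul, pow_one, inv_one, mul_one, negOne_smul] at h₁
    simp only [tensorGen, mul_add, add_mul, h₁]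
    simp [pp, R.rels.e_sq i h, S.rels.e_sq i h]
  f_sq i h := by
    have h₁ := f_AB R S i i
    rw [h, cwt_odd i h, one_mul, pow_one, inv_one, mul_one, negOne_smul] at h₁
    simp only [tensorGen, mul_add, add_mul, h₁]
    simp [pp, R.rels.f_sq i h, S.rels.f_sq i h]
  e_serre i j h hij := by
    obtain ⟨t, ht, hq, c₁, c₂, c₃⟩ := serre_scalars i j h hij
    have s₁ : ∀ l : Fin (m + n - 1), (-1 : Kq) ^ (rpar l * rpar i) = 1 := fun l => by rw [h, mul_zero, pow_zero]
    have s₂ : ∀ l : Fin (m + n - 1), (-1 : Kq) ^ (rpar i * rpar l) = 1 := fun l => by rw [h, zero_mul, pow_zero]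
    rw [hq]
    refine serre3_add t ht _ _ _ _ ?_ ?_ ?_ ?_ ?_
    · rw [e_AB, s₁, one_mul, c₁]
    · rw [e_AB, s₁, one_mul, c₂]
    · rw [e_AB, s₂, one_mul, c₃]
    · rw [← hq]
      exact serre3_map _ _ _ _ (S.rels.cinv_comm i j) (R.rels.e_serre i j h hij)
    · rw [← hq]
      exact serre3_map' _ _ _ _ (R.s_comm (by rw [← pow_succ', pow_succ]) i)
        (S.rels.e_serre i j h hij)
  f_serre i j h hij := by
    obtain ⟨t, ht, hq, c₁, c₂, c₃⟩ := serre_scalars i j h hij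
    have s₁ : ∀ l : Fin (m + n - 1), (-1 : Kq) ^ (rpar l * rpar i) = 1 := fun l => by rw [h, mul_zero, pow_zero]
    have s₂ : ∀ l : Fin (m + n - 1), (-1 : Kq) ^ (rpar i * rpar l) = 1 := fun l => by rw [h, zero_mul, pow_zero]
    have comm : ∀ l, tensorGen R S (.f l) =
        TensorProduct.map (R.s l * R.k l) (S.f l) + TensorProduct.map (R.f l) 1 :=
      fun l => add_comm _ _
    simp only [comm]
    rw [hq]
    refine serre3_add t ht _ _ _ _ ?_ ?_ ?_ ?_ ?_
    · rw [f_AB, s₁, one_mul, c₁]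
    · rw [f_AB, s₂, one_mul, c₂]
    · rw [f_AB, s₁, one_mul, c₃]
    · rw [← hq]
      exact serre3_map' _ _ _ _ (kk_comm R i j) (S.rels.f_serre i j h hij)
    · rw [← hq]
      exact serre3_map _ _ _ _ rfl (R.rels.f_serre i j h hij)
  e_quartic i j l h hij hjl := by
    have hj := rpar_one h
    have hi₀ : rpar i = 0 := rpar_zero (by omega)
    have hl₀ : rpar l = 0 := rpar_zero (by omega)
    have d₁ : dq (lo i) = q := if_pos (show i.val < m by omega)
    have d₂ : dq (lo j) = q := if_pos (show j.val < m by omega)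
    have d₃ : dq (lo l) = q⁻¹ := if_neg (show ¬ l.val < m by omega)
    have hil : i.val + 1 < l.val := by omega
    refine serre4_add q q_ne_zero _ _ _ _ _ _ ?_ ?_ ?_ ?_ ?_ ?_ ?_ ?_ ?_ ?_ ?_ ?_ ?_ ?_ ?_
    · rw [e_AB, hi₀, cwt_even i hi₀, d₁]; simp
    · rw [e_AB, hi₀, (cwt_succ i j hij).1, d₂]; simp
    · rw [e_AB, hi₀, (cwt_far i l hil).1]; simp
    · rw [e_AB, hi₀, (cwt_succ i j hij).2, d₂]; simp
    · rw [e_AB, h, cwt_odd j h]; simp [negOne_smul]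
    · rw [e_AB, hl₀, (cwt_succ j l hjl).1, d₃]; simp
    · rw [e_AB, hi₀, (cwt_far i l hil).2]; simp
    · rw [e_AB, hl₀, (cwt_succ j l hjl).2, d₃]; simp
    · rw [e_AB, hl₀, cwt_even l hl₀, d₃]; simp
    · rw [pp, pp, R.rels.e_e i l hil, S.rels.cinv_comm]
    · rw [pp, pp, S.rels.e_e i l hil, R.s_comm (by rw [← pow_succ', pow_succ])]
    · rw [pp, R.rels.e_sq j h, TensorProduct.map_zero_left]
    · rw [pp, S.rels.e_sq j h, TensorProduct.map_zero_right]
    · exact serre4_map _ _ _ _ _ _ (S.rels.cinv_comm _ _) (S.rels.cinv_comm _ _)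
        (S.rels.cinv_comm _ _) (R.rels.e_quartic i j l h hij hjl)
    · have hs : ∀ a b, R.s a * R.s b = R.s b * R.s a :=
        fun a b => R.s_comm (by rw [← pow_succ', pow_succ]) a
      exact serre4_map' _ _ _ _ _ _ (hs _ _) (hs _ _) (hs _ _)
        (S.rels.e_quartic i j l h hij hjl)
  f_quartic i j l h hij hjl := by
    have hj := rpar_one h
    have hi₀ : rpar i = 0 := rpar_zero (by omega)
    have hl₀ : rpar l = 0 := rpar_zero (by omega)
    have d₁ : dq (lo i) = q := if_pos (show i.val < m by omega)
    have d₂ : dq (lo j) = q := if_pos (show j.val < m by omega)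
    have d₃ : dq (lo l) = q⁻¹ := if_neg (show ¬ l.val < m by omega)
    have hil : i.val + 1 < l.val := by omega
    have comm : ∀ l, tensorGen R S (.f l) =
        TensorProduct.map (R.s l * R.k l) (S.f l) + TensorProduct.map (R.f l) 1 :=
      fun l => add_comm _ _
    simp only [comm]
    refine serre4_add q q_ne_zero _ _ _ _ _ _ ?_ ?_ ?_ ?_ ?_ ?_ ?_ ?_ ?_ ?_ ?_ ?_ ?_ ?_ ?_
    · rw [f_AB, hi₀, cwt_even i hi₀, d₁]; simp
    · rw [f_AB, hi₀, (cwt_succ i j hij).1, d₂]; simp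
    · rw [f_AB, hi₀, (cwt_far i l hil).1]; simp
    · rw [f_AB, hi₀, (cwt_succ i j hij).2, d₂]; simp
    · rw [f_AB, h, cwt_odd j h]; simp [negOne_smul]
    · rw [f_AB, hl₀, (cwt_succ j l hjl).1, d₃]; simp
    · rw [f_AB, hi₀, (cwt_far i l hil).2]; simp
    · rw [f_AB, hl₀, (cwt_succ j l hjl).2, d₃]; simp
    · rw [f_AB, hl₀, cwt_even l hl₀, d₃]; simp
    · rw [pp, pp, S.rels.f_f i l hil, kk_comm]
    · rw [pp, pp, R.rels.f_f i l hil]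
    · rw [pp, S.rels.f_sq j h, TensorProduct.map_zero_right]
    · rw [pp, R.rels.f_sq j h, TensorProduct.map_zero_left]
    · exact serre4_map' _ _ _ _ _ _ (kk_comm R _ _) (kk_comm R _ _) (kk_comm R _ _)
        (S.rels.f_quartic i j l h hij hjl)
    · exact serre4_map _ _ _ _ _ _ rfl rfl rfl (R.rels.f_quartic i j l h hij hjl)

/-- The tensor product of graded representations. -/
def tensor (R : SuperRep m n M) (S : SuperRep m n N) : SuperRep m n (M ⊗[Kq] N) where
  ρ := Uq.lift (tensorGen R S) (tensor_rels R S)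
  σ := TensorProduct.map R.σ S.σ
  σ_sq := by
    rw [pp, R.σ_sq, S.σ_sq]
    exact TensorProduct.map_one
  σ_e i := by
    have h₁ : S.σ * S.kinv i = S.kinv i * S.σ := comm_cartan S.σ_Kinv S.σ_K i
    have h₂ : R.σ * R.s i = R.s i * R.σ := by rw [← pow_succ', pow_succ]
    rw [Uq.lift_ug]
    simp only [tensorGen, mul_add, add_mul, pp, R.σ_e, S.σ_e, h₁, h₂, smul_add,
      TensorProduct.map_smul_left, TensorProduct.map_smul_right]
  σ_f i := by
    have h₂ : R.σ * (R.s i * R.k i) = R.s i * R.k i * R.σ := by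
      rw [← mul_assoc, ← pow_succ', pow_succ, mul_assoc, R.σ_k, mul_assoc]
    rw [Uq.lift_ug]
    simp only [tensorGen, mul_add, add_mul, pp, R.σ_f, S.σ_f, h₂, smul_add,
      TensorProduct.map_smul_left, TensorProduct.map_smul_right, mul_one, one_mul]
  σ_K j := by
    rw [Uq.lift_ug]
    simp only [tensorGen, pp, R.σ_K, S.σ_K]

theorem tensor_ρ (R : SuperRep m n M) (S : SuperRep m n N) (x : UqGen m n) :
    (R.tensor S).ρ (ug x) = tensorGen R S x := Uq.lift_ug _ (tensor_rels R S) _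

end SuperRep

end Tensor

/-! ### The vector representation -/

/-- The superspace `V` of dimension `m|n`, with its standard basis. -/
abbrev V (m n : ℕ) : Type := Fin (m + n) → Kq

/-- The basis vector `aᵢ` of `V`. -/
def a {m n : ℕ} (i : Fin (m + n)) : V m n := Pi.single i 1

/-- The basis `(aᵢ)` of `V`. -/
def aBasis (m n : ℕ) : Module.Basis (Fin (m + n)) Kq (V m n) := Pi.basisFun Kq (Fin (m + n))

theorem aBasis_apply {m n : ℕ} (i : Fin (m + n)) : aBasis m n i = a i := by
  simp [aBasis, a]

/-- The elementary operator `aⱼ ↦ aᵢ`, the other basis vectors going to `0`. -/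
def unit {m n : ℕ} (i j : Fin (m + n)) : Module.End Kq (V m n) :=
  (LinearMap.single Kq (fun _ => Kq) i).comp (LinearMap.proj j)

/-- The diagonal operator with eigenvalue `c j` on `aⱼ`. -/
def diag {m n : ℕ} (c : Fin (m + n) → Kq) : Module.End Kq (V m n) where
  toFun x := fun j => c j * x j
  map_add' x y := by funext j; simp [mul_add]
  map_smul' t x := by funext j; simp; ring

theorem unit_a {m n : ℕ} (i j l : Fin (m + n)) :
    unit i j (a l) = if j = l then a i else 0 := by
  simp only [unit, a, LinearMap.comp_apply, LinearMap.proj_apply, LinearMap.single_apply]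
  split_ifs with h
  · subst h; simp
  · rw [Pi.single_eq_of_ne h]; simp

theorem diag_a {m n : ℕ} (c : Fin (m + n) → Kq) (l : Fin (m + n)) :
    diag c (a l) = c l • a l := by
  funext j
  by_cases h : j = l
  · subst h; simp [diag, a]
  · simp [diag, a, h]

theorem ext_a {m n : ℕ} {W : Type*} [AddCommGroup W] [Module Kq W] {S T : V m n →ₗ[Kq] W}
    (h : ∀ l, S (a l) = T (a l)) : S = T :=
  (aBasis m n).ext fun l => by rw [aBasis_apply, h]

/-- The operators of the generators on `V`: `eᵢ aᵢ₊₁ = aᵢ`, `fᵢ aᵢ = aᵢ₊₁`, and `K j` multiplies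
`aⱼ` by `q` and fixes the other basis vectors. -/
def vecGen (m n : ℕ) : UqGen m n → Module.End Kq (V m n)
  | .e i => unit (lo i) (hi i)
  | .f i => unit (hi i) (lo i)
  | .K j => diag fun l => if l = j then q else 1
  | .Kinv j => diag fun l => if l = j then q⁻¹ else 1

theorem diag_mul {m n : ℕ} (c d : Fin (m + n) → Kq) :
    diag c * diag d = diag fun l => c l * d l := by
  refine ext_a fun l => ?_
  rw [Module.End.mul_apply, diag_a, map_smul, diag_a, diag_a, smul_smul, mul_comm]

theorem diag_one {m n : ℕ} : diag (fun _ : Fin (m + n) => 1) = 1 := by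
  refine ext_a fun l => ?_
  rw [diag_a, one_smul, Module.End.one_apply]

theorem unit_mul {m n : ℕ} (i j k l : Fin (m + n)) :
    unit i j * unit k l = if j = k then unit i l else 0 := by
  refine ext_a fun r => ?_
  rw [Module.End.mul_apply, unit_a]
  by_cases h₁ : l = r
  · subst h₁
    rw [if_pos rfl, unit_a]
    split_ifs
    · rw [unit_a, if_pos rfl]
    · rfl
  · rw [if_neg h₁, map_zero]
    split_ifs
    · rw [unit_a, if_neg h₁]
    · rfl

theorem diag_unit {m n : ℕ} (c : Fin (m + n) → Kq) (i j : Fin (m + n)) :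
    diag c * unit i j = c i • unit i j := by
  refine ext_a fun r => ?_
  rw [Module.End.mul_apply, LinearMap.smul_apply, unit_a]
  split_ifs
  · rw [diag_a]
  · simp

theorem unit_diag {m n : ℕ} (c : Fin (m + n) → Kq) (i j : Fin (m + n)) :
    unit i j * diag c = c j • unit i j := by
  refine ext_a fun r => ?_
  rw [Module.End.mul_apply, LinearMap.smul_apply, unit_a, diag_a, map_smul, unit_a]
  split_ifs with h
  · rw [h]
  · simp

theorem lo_ne_hi {m n : ℕ} (i : Fin (m + n - 1)) : lo i ≠ hi i := by
  simp [lo, hi, Fin.ext_iff]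

theorem lo_inj {m n : ℕ} {i j : Fin (m + n - 1)} : lo i = lo j ↔ i = j := by
  simp [lo, Fin.ext_iff]

theorem hi_inj {m n : ℕ} {i j : Fin (m + n - 1)} : hi i = hi j ↔ i = j := by
  simp [hi, Fin.ext_iff]

theorem hi_eq_lo {m n : ℕ} {i j : Fin (m + n - 1)} : hi i = lo j ↔ i.val + 1 = j.val := by
  simp [lo, hi, Fin.ext_iff]

theorem lo_eq_hi {m n : ℕ} {i j : Fin (m + n - 1)} : lo i = hi j ↔ i.val = j.val + 1 := by
  simp [lo, hi, Fin.ext_iff]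

/-- The eigenvalue of `kᵢ` on `a_l`. -/
def kval {m n : ℕ} (i : Fin (m + n - 1)) (l : Fin (m + n)) : Kq :=
  if l = lo i then dq (lo i) else if l = hi i then (dq (hi i))⁻¹ else 1

theorem kval_ne_zero {m n : ℕ} (i : Fin (m + n - 1)) (l : Fin (m + n)) : kval i l ≠ 0 := by
  unfold kval
  split_ifs <;> simp [dq_ne_zero]

theorem vec_cartan (m n : ℕ) (i : Fin (m + n - 1)) :
    cartan (fun j => vecGen m n (.K j)) (fun j => vecGen m n (.Kinv j)) i = diag (kval i) := by
  have hne := lo_ne_hi i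
  unfold cartan
  refine ext_a fun l => ?_
  rw [diag_a, Module.End.mul_apply]
  unfold kval dq
  simp only [par_eq_zero, vecGen]
  split_ifs with h₁ h₂ h₃ h₄ <;> simp only [diag_a, map_smul, smul_smul] <;> congr 1 <;>
    simp_all

theorem vec_cinv (m n : ℕ) (i : Fin (m + n - 1)) :
    cartan (fun j => vecGen m n (.Kinv j)) (fun j => vecGen m n (.K j)) i =
      diag fun l => (kval i l)⁻¹ := by
  have hne := lo_ne_hi i
  unfold cartan
  refine ext_a fun l => ?_
  rw [diag_a, Module.End.mul_apply]
  unfold kval dq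
  simp only [par_eq_zero, vecGen]
  split_ifs with h₁ h₂ h₃ h₄ <;> simp only [diag_a, map_smul, smul_smul] <;> congr 1 <;>
    simp_all

theorem q_sq_ne_one : q ^ 2 ≠ 1 := by
  intro h
  have h' : ((RatFunc.X : RatFunc ℂ)) ^ 2 = 1 := h
  have h2 := congrArg (RatFunc.num) h'
  rw [← RatFunc.algebraMap_X, ← map_pow, RatFunc.num_algebraMap, RatFunc.num_one] at h2
  have := congrArg Polynomial.natDegree h2
  simp at this

theorem dq_sub_ne_zero {m n : ℕ} (j : Fin (m + n)) : dq j - (dq j)⁻¹ ≠ 0 := by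
  intro h
  have h₁ : dq j * dq j = 1 := by
    have := sub_eq_zero.1 h
    calc dq j * dq j = dq j * (dq j)⁻¹ := by rw [← this]
      _ = 1 := mul_inv_cancel₀ (dq_ne_zero j)
  have q0 := q_ne_zero
  unfold dq at h₁
  split_ifs at h₁
  · exact q_sq_ne_one (by rw [sq, h₁])
  · apply q_sq_ne_one
    rw [← mul_inv, inv_eq_one] at h₁
    rw [sq, h₁]

theorem unit_sq {m n : ℕ} {i j : Fin (m + n)} (h : j ≠ i) : unit i j * unit i j = 0 := by
  rw [unit_mul, if_neg h]

theorem vec_e_f (m n : ℕ) (i j : Fin (m + n - 1)) :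
    vecGen m n (.e i) * vecGen m n (.f j) -
      (-1 : Kq) ^ (rpar i * rpar j) • (vecGen m n (.f j) * vecGen m n (.e i)) =
    if i = j then (dq (lo i) - (dq (lo i))⁻¹)⁻¹ •
      (cartan (fun l => vecGen m n (.K l)) (fun l => vecGen m n (.Kinv l)) i -
        cartan (fun l => vecGen m n (.Kinv l)) (fun l => vecGen m n (.K l)) i) else 0 := by
  rw [vec_cartan, vec_cinv]
  by_cases h : i = j
  · subst h
    have hne := lo_ne_hi i
    rw [if_pos rfl]
    refine ext_a fun l => ?_
    simp only [vecGen, unit_mul, if_true, LinearMap.sub_apply, LinearMap.smul_apply, unit_a,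
      diag_a]
    by_cases h₁ : l = lo i
    · subst h₁
      rw [if_pos rfl, if_neg hne.symm, smul_zero, sub_zero, ← sub_smul, smul_smul, kval,
        if_pos rfl, inv_mul_cancel₀ (dq_sub_ne_zero _), one_smul]
    · by_cases h₂ : l = hi i
      · subst h₂
        rw [if_neg hne, if_pos rfl, zero_sub, ← sub_smul, smul_smul, kval, if_neg hne.symm,
          if_pos rfl, inv_inv, ← neg_smul]
        congr 1
        rcases SuperRep.rpar_le (i := i) with hp | hp
        · have hd : dq (hi i) = dq (lo i) := by
            have : i.val + 1 ≠ m := fun h' => by simp [rpar, h'] at hp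
            unfold dq lo hi
            simp only
            by_cases h1 : i.val < m
            · rw [if_pos h1, if_pos (by omega)]
            · rw [if_neg h1, if_neg (by omega)]
          rw [hp, hd, ← neg_sub (dq (lo i)), mul_neg, inv_mul_cancel₀ (dq_sub_ne_zero _)]
          simp
        · have := SuperRep.rpar_one hp
          have hd₁ : dq (lo i) = q := if_pos (show i.val < m by omega)
          have hd₂ : dq (hi i) = q⁻¹ := if_neg (show ¬ i.val + 1 < m by omega)
          have := dq_sub_ne_zero (lo i)
          rw [hd₁] at this
          rw [hp, hd₁, hd₂, inv_inv, inv_mul_cancel₀ this]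
          simp
      · rw [if_neg (Ne.symm h₁), if_neg (Ne.symm h₂), kval, if_neg h₁, if_neg h₂]
        simp
  · rw [if_neg h]
    simp only [vecGen, unit_mul, hi_inj, lo_inj, h, Ne.symm h, if_false]
    simp

theorem vec_rels (m n : ℕ) : UqRels m n (fun i => vecGen m n (.e i)) (fun i => vecGen m n (.f i))
    (fun j => vecGen m n (.K j)) (fun j => vecGen m n (.Kinv j)) where
  K_Kinv j := by
    simp only [vecGen, diag_mul]
    rw [← diag_one]
    congr 1
    funext l
    split_ifs <;> simp [q_ne_zero]
  Kinv_K j := by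
    simp only [vecGen, diag_mul]
    rw [← diag_one]
    congr 1
    funext l
    split_ifs <;> simp [q_ne_zero]
  K_K j l := by
    simp only [vecGen, diag_mul]
    congr 1
    funext r
    rw [mul_comm]
  K_e j i := by
    have hne := lo_ne_hi i
    have q0 := q_ne_zero
    simp only [vecGen, diag_unit, unit_diag, smul_smul, wt]
    congr 1
    by_cases h₁ : j = lo i
    · subst h₁
      simp [hne, hne.symm]
    · by_cases h₂ : j = hi i
      · subst h₂
        simp [hne, hne.symm, q0]
      · simp [h₁, h₂, Ne.symm h₁, Ne.symm h₂]
  K_f j i := by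
    have hne := lo_ne_hi i
    have q0 := q_ne_zero
    simp only [vecGen, diag_unit, unit_diag, smul_smul, wt]
    congr 1
    by_cases h₁ : j = lo i
    · subst h₁
      simp [hne, hne.symm, q0]
    · by_cases h₂ : j = hi i
      · subst h₂
        simp [hne, hne.symm]
      · simp [h₁, h₂, Ne.symm h₁, Ne.symm h₂]
  e_f i j := vec_e_f m n i j
  e_e i j h := by
    simp only [vecGen, unit_mul]
    rw [if_neg (by rw [hi_eq_lo]; omega), if_neg (by rw [hi_eq_lo]; omega)]
  f_f i j h := by
    simp only [vecGen, unit_mul]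
    rw [if_neg (by rw [lo_eq_hi]; omega), if_neg (by rw [lo_eq_hi]; omega)]
  e_sq i _ := unit_sq (lo_ne_hi i).symm
  f_sq i _ := unit_sq (lo_ne_hi i)
  e_serre i j _ hij := by
    have h₁ := unit_sq (lo_ne_hi i).symm
    have h₂ : unit (lo i) (hi i) * unit (lo j) (hi j) * unit (lo i) (hi i) = 0 := by
      rw [unit_mul]
      split_ifs with h
      · rw [unit_mul, if_neg]
        rw [hi_eq_lo] at h ⊢
        omega
      · rw [zero_mul]
    simp only [serre3, vecGen, h₂, h₁, mul_assoc (unit (lo j) (hi j)), mul_zero, zero_mul,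
      smul_zero, sub_zero, add_zero]
  f_serre i j _ hij := by
    have h₁ := unit_sq (lo_ne_hi i)
    have h₂ : unit (hi i) (lo i) * unit (hi j) (lo j) * unit (hi i) (lo i) = 0 := by
      rw [unit_mul]
      split_ifs with h
      · rw [unit_mul, if_neg]
        rw [lo_eq_hi] at h ⊢
        omega
      · rw [zero_mul]
    simp only [serre3, vecGen, h₂, h₁, mul_assoc (unit (hi j) (lo j)), mul_zero, zero_mul,
      smul_zero, sub_zero, add_zero]
  e_quartic i j l _ hij hjl := by
    have h₁ : unit (lo j) (hi j) * unit (lo i) (hi i) = 0 := by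
      rw [unit_mul, if_neg]; rw [hi_eq_lo]; omega
    have h₂ : unit (lo l) (hi l) * unit (lo j) (hi j) = 0 := by
      rw [unit_mul, if_neg]; rw [hi_eq_lo]; omega
    simp only [serre4, vecGen]
    simp only [h₁, zero_mul, smul_zero, sub_zero, mul_assoc _ (unit (lo l) (hi l)), h₂,
      ← mul_assoc _ (unit (lo l) (hi l)) (unit (lo j) (hi j)), mul_zero]
    simp only [mul_assoc, h₁, h₂, mul_zero, add_zero]
  f_quartic i j l _ hij hjl := by
    have h₁ : unit (hi i) (lo i) * unit (hi j) (lo j) = 0 := by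
      rw [unit_mul, if_neg]; rw [lo_eq_hi]; omega
    have h₂ : unit (hi j) (lo j) * unit (hi l) (lo l) = 0 := by
      rw [unit_mul, if_neg]; rw [lo_eq_hi]; omega
    have h₃ : ∀ w, unit (hi i) (lo i) * (unit (hi l) (lo l) * w) = 0 := fun w => by
      rw [← mul_assoc, unit_mul, if_neg, zero_mul]; rw [lo_eq_hi]; omega
    simp only [serre4, vecGen]
    simp only [mul_assoc, h₁, h₂, h₃, mul_zero, add_zero, smul_zero, sub_zero]
    simp only [← mul_assoc, h₁, h₂, zero_mul, add_zero, smul_zero, sub_zero]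

/-- The vector representation of `U_q(gl(m|n))` on `V`. -/
def vecRep (m n : ℕ) : SuperRep m n (V m n) where
  ρ := Uq.lift (vecGen m n) (vec_rels m n)
  σ := diag fun l => (-1) ^ par l
  σ_sq := by
    rw [diag_mul, ← diag_one]
    congr 1
    funext l
    exact SuperRep.sign_sq _
  σ_e i := by
    rw [Uq.lift_ug]
    simp only [vecGen, diag_unit, unit_diag, smul_smul]
    congr 1
    unfold par rpar lo hi
    simp only
    split_ifs <;> first | omega | simp
  σ_f i := by
    rw [Uq.lift_ug]
    simp only [vecGen, diag_unit, unit_diag, smul_smul]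
    congr 1
    unfold par rpar lo hi
    simp only
    split_ifs <;> first | omega | simp
  σ_K j := by
    rw [Uq.lift_ug]
    simp only [vecGen, diag_mul]
    congr 1
    funext r
    rw [mul_comm]

theorem vecRep_ρ (m n : ℕ) (x : UqGen m n) : (vecRep m n).ρ (ug x) = vecGen m n x :=
  Uq.lift_ug _ (vec_rels m n) _

/-! ### The `R`-matrix and the Hecke algebra -/

/-- The coefficient `(-1) ^ (parity i * parity j) * q ^ ((-1) ^ parity i * δᵢⱼ)`. -/
def rc {m n : ℕ} (i j : Fin (m + n)) : Kq :=
  (-1) ^ (par i * par j) * if i = j then dq i else 1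

/-- The `R`-matrix on `V ⊗ V`: `aᵢ ⊗ aⱼ` goes to
`rc i j • aⱼ ⊗ aᵢ + (q - q⁻¹) • aᵢ ⊗ aⱼ`, the last term being present only for `i < j`. -/
def Rhat (m n : ℕ) : Module.End Kq (V m n ⊗[Kq] V m n) :=
  ((aBasis m n).tensorProduct (aBasis m n)).constr Kq fun p =>
    rc p.1 p.2 • (a p.2 ⊗ₜ[Kq] a p.1) +
      if p.1 < p.2 then (q - q⁻¹) • (a p.1 ⊗ₜ[Kq] a p.2) else 0

theorem Rhat_a {m n : ℕ} (i j : Fin (m + n)) :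
    Rhat m n (a i ⊗ₜ[Kq] a j) = rc i j • (a j ⊗ₜ[Kq] a i) +
      if i < j then (q - q⁻¹) • (a i ⊗ₜ[Kq] a j) else 0 := by
  have := ((aBasis m n).tensorProduct (aBasis m n)).constr_basis Kq (fun p =>
    rc p.1 p.2 • (a p.2 ⊗ₜ[Kq] a p.1) +
      if p.1 < p.2 then (q - q⁻¹) • (a p.1 ⊗ₜ[Kq] a p.2) else 0) (i, j)
  rw [Module.Basis.tensorProduct_apply, aBasis_apply, aBasis_apply] at this
  exact this

/-- The space `V ⊗ V ⊗ V`. -/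
def V3 (m n : ℕ) : Type := (V m n ⊗[Kq] V m n) ⊗[Kq] V m n

instance (m n : ℕ) : AddCommGroup (V3 m n) :=
  inferInstanceAs (AddCommGroup ((V m n ⊗[Kq] V m n) ⊗[Kq] V m n))

instance (m n : ℕ) : Module Kq (V3 m n) :=
  inferInstanceAs (Module Kq ((V m n ⊗[Kq] V m n) ⊗[Kq] V m n))

/-- The basis vector `aᵢ ⊗ aⱼ ⊗ a_k`. -/
def word {m n : ℕ} (i j k : Fin (m + n)) : V3 m n := (a i ⊗ₜ[Kq] a j) ⊗ₜ[Kq] a k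

/-- The `R`-matrix on the first two factors. -/
def R1 (m n : ℕ) : Module.End Kq (V3 m n) := (Rhat m n).rTensor (V m n)

/-- The `R`-matrix on the last two factors. -/
def R2 (m n : ℕ) : Module.End Kq (V3 m n) :=
  (TensorProduct.assoc Kq (V m n) (V m n) (V m n)).symm.toLinearMap ∘ₗ
    (Rhat m n).lTensor (V m n) ∘ₗ (TensorProduct.assoc Kq (V m n) (V m n) (V m n)).toLinearMap

theorem ext_word {m n : ℕ} {W : Type*} [AddCommGroup W] [Module Kq W] {S T : V3 m n →ₗ[Kq] W}
    (h : ∀ i j k, S (word i j k) = T (word i j k)) : S = T := by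
  refine (((aBasis m n).tensorProduct (aBasis m n)).tensorProduct (aBasis m n)).ext ?_
  rintro ⟨⟨i, j⟩, k⟩
  rw [Module.Basis.tensorProduct_apply, Module.Basis.tensorProduct_apply, aBasis_apply,
    aBasis_apply, aBasis_apply]
  exact h i j k

theorem R1_word {m n : ℕ} (i j k : Fin (m + n)) :
    R1 m n (word i j k) = rc i j • word j i k +
      (if i < j then q - q⁻¹ else 0) • word i j k := by
  show (Rhat m n).rTensor (V m n) ((a i ⊗ₜ[Kq] a j) ⊗ₜ[Kq] a k) = _
  rw [LinearMap.rTensor_tmul, Rhat_a]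
  split_ifs
  · rw [TensorProduct.add_tmul]; rfl
  · rw [add_zero, zero_smul, add_zero]; rfl

theorem R2_word {m n : ℕ} (i j k : Fin (m + n)) :
    R2 m n (word i j k) = rc j k • word i k j +
      (if j < k then q - q⁻¹ else 0) • word i j k := by
  show (TensorProduct.assoc Kq (V m n) (V m n) (V m n)).symm ((Rhat m n).lTensor (V m n)
    ((TensorProduct.assoc Kq (V m n) (V m n) (V m n)) ((a i ⊗ₜ[Kq] a j) ⊗ₜ[Kq] a k))) = _
  rw [TensorProduct.assoc_tmul, LinearMap.lTensor_tmul, Rhat_a]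
  split_ifs
  · rw [TensorProduct.tmul_add, map_add, TensorProduct.tmul_smul, TensorProduct.tmul_smul,
      map_smul, map_smul, TensorProduct.assoc_symm_tmul, TensorProduct.assoc_symm_tmul]; rfl
  · rw [add_zero, zero_smul, add_zero, TensorProduct.tmul_smul, map_smul,
      TensorProduct.assoc_symm_tmul]; rfl

theorem rc_symm {m n : ℕ} (i j : Fin (m + n)) : rc i j = rc j i := by
  unfold rc
  by_cases h : i = j
  · subst h; rfl
  · rw [if_neg h, if_neg (Ne.symm h), mul_comm (par i)]

theorem rc_sq {m n : ℕ} {i j : Fin (m + n)} (h : i ≠ j) : rc i j * rc i j = 1 := by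
  unfold rc
  rw [if_neg h, mul_one, SuperRep.sign_sq]

theorem rc_self {m n : ℕ} (i : Fin (m + n)) :
    rc i i * rc i i = 1 + (q - q⁻¹) * rc i i := by
  have := q_ne_zero
  unfold rc par dq
  by_cases h : i.val < m
  · simp only [h, if_true]
    field_simp
    ring
  · simp only [h, if_true, if_false]
    field_simp
    ring

theorem Rhat_sq (m n : ℕ) (i j : Fin (m + n)) :
    Rhat m n (Rhat m n (a i ⊗ₜ[Kq] a j)) =
      a i ⊗ₜ[Kq] a j + (q - q⁻¹) • Rhat m n (a i ⊗ₜ[Kq] a j) := by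
  rcases lt_trichotomy i j with h | h | h
  · simp only [Rhat_a, map_add, map_smul, h, h.not_gt, if_true, if_false, rc_symm j i]
    have := rc_sq h.ne
    match_scalars <;> first | linear_combination this | ring
  · subst h
    have := rc_self i
    simp only [Rhat_a, map_add, map_smul, lt_irrefl, if_false, add_zero]
    match_scalars; linear_combination this
  · simp only [Rhat_a, map_add, map_smul, h, h.not_gt, if_true, if_false, rc_symm j i, add_zero]
    have := rc_sq h.ne'
    match_scalars <;> first | linear_combination this | ring

theorem R1_sq (m n : ℕ) : R1 m n * R1 m n = 1 + (q - q⁻¹) • R1 m n := by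
  refine ext_word fun i j k => ?_
  simp only [Module.End.mul_apply, LinearMap.add_apply, LinearMap.smul_apply,
    Module.End.one_apply]
  rcases lt_trichotomy i j with h | h | h
  · simp only [R1_word, map_add, map_smul, h, h.not_gt, if_true, if_false, rc_symm j i]
    have := rc_sq h.ne
    match_scalars <;> first | linear_combination this | ring
  · subst h
    have := rc_self i
    simp only [R1_word, map_add, map_smul, lt_irrefl, if_false]
    match_scalars; linear_combination this
  · simp only [R1_word, map_add, map_smul, h, h.not_gt, if_true, if_false, rc_symm j i]
    have := rc_sq h.ne'
    match_scalars <;> first | linear_combination this | ring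

theorem R2_sq (m n : ℕ) : R2 m n * R2 m n = 1 + (q - q⁻¹) • R2 m n := by
  refine ext_word fun i j k => ?_
  simp only [Module.End.mul_apply, LinearMap.add_apply, LinearMap.smul_apply,
    Module.End.one_apply]
  rcases lt_trichotomy j k with h | h | h
  · simp only [R2_word, map_add, map_smul, h, h.not_gt, if_true, if_false, rc_symm k j]
    have := rc_sq h.ne
    match_scalars <;> first | linear_combination this | ring
  · subst h
    have := rc_self j
    simp only [R2_word, map_add, map_smul, lt_irrefl, if_false]
    match_scalars; linear_combination this
  · simp only [R2_word, map_add, map_smul, h, h.not_gt, if_true, if_false, rc_symm k j]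
    have := rc_sq h.ne'
    match_scalars <;> first | linear_combination this | ring

theorem R_braid (m n : ℕ) : R1 m n * R2 m n * R1 m n = R2 m n * R1 m n * R2 m n := by
  refine ext_word fun i j k => ?_
  simp only [Module.End.mul_apply]
  have s₁ := rc_symm j i
  have s₂ := rc_symm k i
  have s₃ := rc_symm k j
  have u₁ : i ≠ j → rc i j * rc i j = 1 := rc_sq
  have u₂ : i ≠ k → rc i k * rc i k = 1 := rc_sq
  have u₃ : j ≠ k → rc j k * rc j k = 1 := rc_sq
  have t₁ := rc_self i
  have t₂ := rc_self j
  have t₃ := rc_self k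
  rcases lt_trichotomy i j with h | h | h <;> rcases lt_trichotomy j k with h' | h' | h' <;>
    rcases lt_trichotomy i k with h'' | h'' | h'' <;> try (exfalso; omega)
  all_goals try subst h
  all_goals try subst h'
  all_goals try subst h''
  all_goals simp only [R1_word, R2_word, map_add, map_smul]
  all_goals match_scalars <;> grind

/-- The defining relations of the Hecke algebra `H_r(q)` on `g₁, …, g_{r-1}`. -/
inductive HeckeRel (r : ℕ) :
    FreeAlgebra Kq (Fin (r - 1)) → FreeAlgebra Kq (Fin (r - 1)) → Prop
  | braid (i j : Fin (r - 1)) (h : i.val + 1 = j.val) : HeckeRel r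
      (FreeAlgebra.ι Kq i * FreeAlgebra.ι Kq j * FreeAlgebra.ι Kq i)
      (FreeAlgebra.ι Kq j * FreeAlgebra.ι Kq i * FreeAlgebra.ι Kq j)
  | comm (i j : Fin (r - 1)) (h : i.val + 2 ≤ j.val) : HeckeRel r
      (FreeAlgebra.ι Kq i * FreeAlgebra.ι Kq j) (FreeAlgebra.ι Kq j * FreeAlgebra.ι Kq i)
  | quad (i : Fin (r - 1)) : HeckeRel r
      (FreeAlgebra.ι Kq i * FreeAlgebra.ι Kq i) (1 + (q - q⁻¹) • FreeAlgebra.ι Kq i)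

/-- The Hecke algebra `H_r(q)` over `ℂ(q)`. -/
def Hecke (r : ℕ) : Type := RingQuot (HeckeRel r)

instance (r : ℕ) : Ring (Hecke r) := inferInstanceAs (Ring (RingQuot (HeckeRel r)))

instance (r : ℕ) : Algebra Kq (Hecke r) := inferInstanceAs (Algebra Kq (RingQuot (HeckeRel r)))

/-- The generator `g_{i+1}` of the Hecke algebra. -/
def hg {r : ℕ} (i : Fin (r - 1)) : Hecke r :=
  RingQuot.mkAlgHom Kq (HeckeRel r) (FreeAlgebra.ι Kq i)

/-- The Hecke algebra `H₃(q)`. -/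
abbrev H3 : Type := Hecke 3

/-- The generator `g₁` of `H₃(q)`. -/
def g₁ : H3 := hg (r := 3) (0 : Fin 2)

/-- The generator `g₂` of `H₃(q)`. -/
def g₂ : H3 := hg (r := 3) (1 : Fin 2)

/-- The images of `g₁`, `g₂` under the sign permutation action. -/
def Rgen (m n : ℕ) (i : Fin (3 - 1)) : Module.End Kq (V3 m n) :=
  if i.val = 0 then R1 m n else R2 m n

theorem Rgen_rel (m n : ℕ) ⦃x y : FreeAlgebra Kq (Fin (3 - 1))⦄ (h : HeckeRel 3 x y) :
    FreeAlgebra.lift Kq (Rgen m n) x = FreeAlgebra.lift Kq (Rgen m n) y := by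
  cases h with
  | braid i j h =>
    simp only [map_mul, FreeAlgebra.lift_ι_apply, Rgen]
    rw [if_pos (by omega), if_neg (by omega), R_braid]
  | comm i j h => omega
  | quad i =>
    simp only [map_mul, map_add, map_one, map_smul, FreeAlgebra.lift_ι_apply, Rgen]
    split_ifs
    · exact R1_sq m n
    · exact R2_sq m n

/-- The sign permutation action of `H₃(q)` on `V ⊗ V ⊗ V`. -/
def heckeRep (m n : ℕ) : H3 →ₐ[Kq] Module.End Kq (V3 m n) :=
  RingQuot.liftAlgHom Kq ⟨FreeAlgebra.lift Kq (Rgen m n), Rgen_rel m n⟩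

theorem heckeRep_hg (m n : ℕ) (i : Fin (3 - 1)) : heckeRep m n (hg i) = Rgen m n i :=
  (RingQuot.liftAlgHom_mkAlgHom_apply Kq _ _ _).trans (FreeAlgebra.lift_ι_apply _ _)

/-- The action of `U_q(gl(m|n))` on `V ⊗ V ⊗ V`. -/
def V3Rep (m n : ℕ) : SuperRep m n (V3 m n) :=
  ((vecRep m n).tensor (vecRep m n)).tensor (vecRep m n)

/-! ### The two actions commute -/

theorem par_hi {m n : ℕ} (i : Fin (m + n - 1)) : par (hi i) = par (lo i) + rpar i := by
  unfold par rpar lo hi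
  simp only
  split_ifs <;> omega

theorem lohi_cases {m n : ℕ} (i : Fin (m + n - 1)) :
    (par (lo i) = 0 ∧ par (hi i) = 0 ∧ rpar i = 0 ∧ dq (lo i) = q ∧ dq (hi i) = q) ∨
    (par (lo i) = 1 ∧ par (hi i) = 1 ∧ rpar i = 0 ∧ dq (lo i) = q⁻¹ ∧ dq (hi i) = q⁻¹) ∨
    (par (lo i) = 0 ∧ par (hi i) = 1 ∧ rpar i = 1 ∧ dq (lo i) = q ∧ dq (hi i) = q⁻¹) := by
  unfold dq par rpar lo hi
  rcases lt_trichotomy (i.val + 1) m with h | h | h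
  · left
    simp [h, h.ne, show i.val < m by omega]
  · right; right
    have h₁ : i.val < m := by omega
    have h₂ : ¬ i.val + 1 < m := by omega
    refine ⟨if_pos h₁, if_neg h₂, if_pos h, if_pos h₁, if_neg h₂⟩
  · right; left
    have h₁ : ¬ i.val < m := by omega
    have h₂ : ¬ i.val + 1 < m := by omega
    simp only [h₁, h₂, h.ne', if_false, and_self]

theorem par_cases {m n : ℕ} (i : Fin (m + n)) : par i = 0 ∨ par i = 1 := by
  unfold par; split_ifs <;> simp

theorem vec_e (m n : ℕ) (i : Fin (m + n - 1)) : (vecRep m n).e i = unit (lo i) (hi i) :=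
  vecRep_ρ m n _

theorem vec_f (m n : ℕ) (i : Fin (m + n - 1)) : (vecRep m n).f i = unit (hi i) (lo i) :=
  vecRep_ρ m n _

theorem vec_k (m n : ℕ) (i : Fin (m + n - 1)) : (vecRep m n).k i = diag (kval i) := by
  rw [← vec_cartan]
  exact congrArg₂ (fun x y => cartan x y i) (funext fun j => vecRep_ρ m n (.K j))
    (funext fun j => vecRep_ρ m n (.Kinv j))

theorem vec_kinv (m n : ℕ) (i : Fin (m + n - 1)) :
    (vecRep m n).kinv i = diag fun l => (kval i l)⁻¹ := by
  rw [← vec_cinv]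
  exact congrArg₂ (fun x y => cartan x y i) (funext fun j => vecRep_ρ m n (.Kinv j))
    (funext fun j => vecRep_ρ m n (.K j))

theorem vec_s (m n : ℕ) (i : Fin (m + n - 1)) :
    (vecRep m n).s i = diag fun l => (-1) ^ (par l * rpar i) := by
  show (diag fun l => (-1 : Kq) ^ par l) ^ rpar i = _
  rcases SuperRep.rpar_le (i := i) with h | h
  · rw [h, pow_zero, ← diag_one]; simp
  · rw [h, pow_one]; simp

/-- The action of the generators on `V ⊗ V`. -/
theorem V2_e (m n : ℕ) (i : Fin (m + n - 1)) (p r : Fin (m + n)) :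
    (vecRep m n).tensorGen (vecRep m n) (.e i) (a p ⊗ₜ[Kq] a r) =
      (if hi i = p then (kval i r)⁻¹ else 0) • (a (lo i) ⊗ₜ[Kq] a r) +
      (if hi i = r then (-1 : Kq) ^ (par p * rpar i) else 0) • (a p ⊗ₜ[Kq] a (lo i)) := by
  simp only [SuperRep.tensorGen, LinearMap.add_apply, TensorProduct.map_tmul, vec_e, vec_kinv,
    vec_s, diag_a, unit_a]
  split_ifs <;> simp only [TensorProduct.tmul_smul, ← TensorProduct.smul_tmul',
    TensorProduct.zero_tmul, TensorProduct.tmul_zero, smul_zero, zero_smul, one_smul]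

theorem V2_f (m n : ℕ) (i : Fin (m + n - 1)) (p r : Fin (m + n)) :
    (vecRep m n).tensorGen (vecRep m n) (.f i) (a p ⊗ₜ[Kq] a r) =
      (if lo i = p then (1 : Kq) else 0) • (a (hi i) ⊗ₜ[Kq] a r) +
      (if lo i = r then (-1) ^ (par p * rpar i) * kval i p else 0) •
        (a p ⊗ₜ[Kq] a (hi i)) := by
  simp only [SuperRep.tensorGen, LinearMap.add_apply, TensorProduct.map_tmul, vec_f, vec_k,
    vec_s, diag_mul, diag_a, unit_a, Module.End.one_apply]
  split_ifs <;> simp only [TensorProduct.tmul_smul, ← TensorProduct.smul_tmul',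
    TensorProduct.zero_tmul, TensorProduct.tmul_zero, smul_zero, zero_smul, one_smul]

theorem V2_diag {m n : ℕ} (c d : Fin (m + n) → Kq) (p r : Fin (m + n)) :
    TensorProduct.map (diag c) (diag d) (a p ⊗ₜ[Kq] a r) =
      (c p * d r) • (a p ⊗ₜ[Kq] a r) := by
  rw [TensorProduct.map_tmul, diag_a, diag_a, TensorProduct.tmul_smul,
    ← TensorProduct.smul_tmul', smul_smul, mul_comm]

theorem ext_a2 {m n : ℕ} {W : Type*} [AddCommGroup W] [Module Kq W]
    {S T : V m n ⊗[Kq] V m n →ₗ[Kq] W}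
    (h : ∀ i j, S (a i ⊗ₜ[Kq] a j) = T (a i ⊗ₜ[Kq] a j)) : S = T := by
  refine ((aBasis m n).tensorProduct (aBasis m n)).ext ?_
  rintro ⟨i, j⟩
  rw [Module.Basis.tensorProduct_apply, aBasis_apply, aBasis_apply]
  exact h i j

/-- `Rhat` commutes with operators acting in the same diagonal way on both factors. -/
theorem Rhat_diag {m n : ℕ} (c : Fin (m + n) → Kq) :
    Rhat m n * TensorProduct.map (diag c) (diag c) =
      TensorProduct.map (diag c) (diag c) * Rhat m n := by
  refine ext_a2 fun p r => ?_
  rw [Module.End.mul_apply, Module.End.mul_apply, V2_diag, map_smul, Rhat_a, map_add, map_smul,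
    V2_diag, smul_add, smul_comm, mul_comm (c p)]
  congr 1
  split_ifs
  · rw [map_smul, V2_diag, smul_comm, mul_comm (c r)]
  · rw [smul_zero, map_zero]

theorem Rhat_a' {m n : ℕ} (i j : Fin (m + n)) :
    Rhat m n (a i ⊗ₜ[Kq] a j) = rc i j • (a j ⊗ₜ[Kq] a i) +
      (if i < j then q - q⁻¹ else 0) • (a i ⊗ₜ[Kq] a j) := by
  rw [Rhat_a]
  split_ifs
  · rfl
  · rw [zero_smul]

/-- The two letters of the `i`-th simple root compare in the same way with any other letter. -/
theorem lt_lohi {m n : ℕ} (i : Fin (m + n - 1)) {p : Fin (m + n)} (h₁ : p ≠ lo i)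
    (h₂ : p ≠ hi i) : (hi i < p ↔ lo i < p) ∧ (p < hi i ↔ p < lo i) := by
  simp only [lo, hi, Fin.lt_def, ne_eq, Fin.ext_iff] at *
  constructor <;> constructor <;> intro _ <;> omega

theorem kval_lo {m n : ℕ} (i : Fin (m + n - 1)) : kval i (lo i) = dq (lo i) := if_pos rfl

theorem kval_hi {m n : ℕ} (i : Fin (m + n - 1)) : kval i (hi i) = (dq (hi i))⁻¹ := by
  rw [kval, if_neg (lo_ne_hi i).symm, if_pos rfl]

theorem kval_of_ne {m n : ℕ} (i : Fin (m + n - 1)) {p : Fin (m + n)} (h₁ : p ≠ lo i)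
    (h₂ : p ≠ hi i) : kval i p = 1 := by
  rw [kval, if_neg h₁, if_neg h₂]

theorem Rhat_e (m n : ℕ) (i : Fin (m + n - 1)) :
    Rhat m n * (vecRep m n).tensorGen (vecRep m n) (.e i) =
      (vecRep m n).tensorGen (vecRep m n) (.e i) * Rhat m n := by
  refine ext_a2 fun p r => ?_
  rw [Module.End.mul_apply, Module.End.mul_apply, V2_e, Rhat_a']
  simp only [map_add, map_smul, V2_e, Rhat_a']
  have hlh : lo i < hi i := by simp [lo, hi, Fin.lt_def]
  have hne := lo_ne_hi i
  have q0 := q_ne_zero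
  have hc := lohi_cases i
  by_cases hp : hi i = p <;> by_cases hr : hi i = r
  · subst hp; subst hr
    simp only [if_true, kval_hi, hlh, hlh.not_gt, if_false, lt_irrefl, inv_inv, rc, hne, hne.symm]
    rcases hc with h | h | h <;> obtain ⟨h₁, h₂, h₃, h₄, h₅⟩ := h <;>
      simp only [h₁, h₂, h₃, h₄, h₅] <;> match_scalars <;> field_simp <;> ring
  · subst hp
    by_cases hl : r = lo i
    · subst hl
      simp only [if_true, kval_lo, kval_hi, hlh, hlh.not_gt, if_false, lt_irrefl, inv_inv, rc,
        hne, hne.symm]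
      rcases hc with h | h | h <;> obtain ⟨h₁, h₂, h₃, h₄, h₅⟩ := h <;>
        simp only [h₁, h₂, h₃, h₄, h₅] <;> match_scalars <;> field_simp <;> ring
    · obtain ⟨c₁, c₂⟩ := lt_lohi i hl (Ne.symm hr)
      simp only [if_true, kval_of_ne i hl (Ne.symm hr), if_false, rc, hr, c₁, Ne.symm hl, Ne.symm hr]
      rcases par_cases r with h' | h' <;>
      rcases hc with h | h | h <;> obtain ⟨h₁, h₂, h₃, h₄, h₅⟩ := h <;>
        simp only [h₁, h₂, h₃, h₄, h₅, h'] <;> match_scalars <;> field_simp <;> ring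
  · subst hr
    by_cases hl : p = lo i
    · subst hl
      simp only [if_true, kval_lo, kval_hi, hlh, hlh.not_gt, if_false, lt_irrefl, inv_inv, rc,
        hne, hne.symm]
      rcases hc with h | h | h <;> obtain ⟨h₁, h₂, h₃, h₄, h₅⟩ := h <;>
        simp only [h₁, h₂, h₃, h₄, h₅] <;> match_scalars <;> field_simp <;> ring
    · obtain ⟨c₁, c₂⟩ := lt_lohi i hl (Ne.symm hp)
      simp only [if_true, kval_of_ne i hl (Ne.symm hp), if_false, rc, hp, c₂, hl, Ne.symm hp]
      rcases par_cases p with h' | h' <;>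
      rcases hc with h | h | h <;> obtain ⟨h₁, h₂, h₃, h₄, h₅⟩ := h <;>
        simp only [h₁, h₂, h₃, h₄, h₅, h'] <;> match_scalars <;> field_simp <;> ring
  · simp only [hp, hr, if_false, zero_smul, smul_zero, add_zero]

theorem Rhat_f (m n : ℕ) (i : Fin (m + n - 1)) :
    Rhat m n * (vecRep m n).tensorGen (vecRep m n) (.f i) =
      (vecRep m n).tensorGen (vecRep m n) (.f i) * Rhat m n := by
  refine ext_a2 fun p r => ?_
  rw [Module.End.mul_apply, Module.End.mul_apply, V2_f, Rhat_a']
  simp only [map_add, map_smul, V2_f, Rhat_a']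
  have hlh : lo i < hi i := by simp [lo, hi, Fin.lt_def]
  have hne := lo_ne_hi i
  have q0 := q_ne_zero
  have hc := lohi_cases i
  by_cases hp : lo i = p <;> by_cases hr : lo i = r
  · subst hp; subst hr
    simp only [if_true, kval_lo, hlh, hlh.not_gt, if_false, lt_irrefl, inv_inv, rc, hne, hne.symm]
    rcases hc with h | h | h <;> obtain ⟨h₁, h₂, h₃, h₄, h₅⟩ := h <;>
      simp only [h₁, h₂, h₃, h₄, h₅] <;> match_scalars <;> field_simp <;> ring
  · subst hp
    by_cases hl : r = hi i
    · subst hl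
      simp only [if_true, kval_lo, kval_hi, hlh, hlh.not_gt, if_false, lt_irrefl, inv_inv, rc,
        hne, hne.symm]
      rcases hc with h | h | h <;> obtain ⟨h₁, h₂, h₃, h₄, h₅⟩ := h <;>
        simp only [h₁, h₂, h₃, h₄, h₅] <;> match_scalars <;> field_simp <;> ring
    · obtain ⟨c₁, c₂⟩ := lt_lohi i (Ne.symm hr) hl
      simp only [if_true, kval_of_ne i (Ne.symm hr) hl, if_false, rc, hr, c₁, Ne.symm hl, Ne.symm hr]
      rcases par_cases r with h' | h' <;>
      rcases hc with h | h | h <;> obtain ⟨h₁, h₂, h₃, h₄, h₅⟩ := h <;>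
        simp only [h₁, h₂, h₃, h₄, h₅, h'] <;> match_scalars <;> field_simp <;> ring
  · subst hr
    by_cases hl : p = hi i
    · subst hl
      simp only [if_true, kval_lo, kval_hi, hlh, hlh.not_gt, if_false, lt_irrefl, inv_inv, rc,
        hne, hne.symm]
      rcases hc with h | h | h <;> obtain ⟨h₁, h₂, h₃, h₄, h₅⟩ := h <;>
        simp only [h₁, h₂, h₃, h₄, h₅] <;> match_scalars <;> field_simp <;> ring
    · obtain ⟨c₁, c₂⟩ := lt_lohi i (Ne.symm hp) hl
      simp only [if_true, kval_of_ne i (Ne.symm hp) hl, if_false, rc, hp, c₂, hl, Ne.symm hp]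
      rcases par_cases p with h' | h' <;>
      rcases hc with h | h | h <;> obtain ⟨h₁, h₂, h₃, h₄, h₅⟩ := h <;>
        simp only [h₁, h₂, h₃, h₄, h₅, h'] <;> match_scalars <;> field_simp <;> ring
  · simp only [hp, hr, if_false, zero_smul, smul_zero, add_zero]

/-- Conjugation by the associator. -/
def cj {m n : ℕ} (Y : Module.End Kq (V m n ⊗[Kq] (V m n ⊗[Kq] V m n))) :
    Module.End Kq ((V m n ⊗[Kq] V m n) ⊗[Kq] V m n) :=
  (TensorProduct.assoc Kq (V m n) (V m n) (V m n)).symm.toLinearMap ∘ₗ Y ∘ₗ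
    (TensorProduct.assoc Kq (V m n) (V m n) (V m n)).toLinearMap

theorem cj_mul {m n : ℕ} (X Y : Module.End Kq (V m n ⊗[Kq] (V m n ⊗[Kq] V m n))) :
    cj (X * Y) = cj X * cj Y := by
  refine LinearMap.ext fun x => ?_
  simp [cj]

theorem cj_add {m n : ℕ} (X Y : Module.End Kq (V m n ⊗[Kq] (V m n ⊗[Kq] V m n))) :
    cj (X + Y) = cj X + cj Y := by
  refine LinearMap.ext fun x => ?_
  simp [cj]

theorem cj_map {m n : ℕ} (A B C : Module.End Kq (V m n)) :
    cj (TensorProduct.map A (TensorProduct.map B C)) =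
      TensorProduct.map (TensorProduct.map A B) C :=
  TensorProduct.ext_threefold fun x y z => by simp [cj]

theorem R2_eq (m n : ℕ) : R2 m n = cj (TensorProduct.map 1 (Rhat m n)) := rfl

theorem R1_eq (m n : ℕ) : R1 m n = TensorProduct.map (Rhat m n) 1 := rfl

section Commute

variable (m n : ℕ)

theorem T_e (i) : ((vecRep m n).tensor (vecRep m n)).e i =
    (vecRep m n).tensorGen (vecRep m n) (.e i) := SuperRep.tensor_ρ _ _ _

theorem T_f (i) : ((vecRep m n).tensor (vecRep m n)).f i =
    (vecRep m n).tensorGen (vecRep m n) (.f i) := SuperRep.tensor_ρ _ _ _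

theorem T_K (j) : ((vecRep m n).tensor (vecRep m n)).K j =
    TensorProduct.map ((vecRep m n).K j) ((vecRep m n).K j) := SuperRep.tensor_ρ _ _ _

theorem T_Kinv (j) : ((vecRep m n).tensor (vecRep m n)).Kinv j =
    TensorProduct.map ((vecRep m n).Kinv j) ((vecRep m n).Kinv j) := SuperRep.tensor_ρ _ _ _

theorem T_k (i) : ((vecRep m n).tensor (vecRep m n)).k i =
    TensorProduct.map ((vecRep m n).k i) ((vecRep m n).k i) :=
  (congrArg₂ (fun x y => cartan x y i) (funext (T_K m n)) (funext (T_Kinv m n))).trans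
    (SuperRep.cartan_map _ _ i)

theorem T_kinv (i) : ((vecRep m n).tensor (vecRep m n)).kinv i =
    TensorProduct.map ((vecRep m n).kinv i) ((vecRep m n).kinv i) :=
  (congrArg₂ (fun x y => cartan x y i) (funext (T_Kinv m n)) (funext (T_K m n))).trans
    (SuperRep.cinv_map _ _ i)

theorem T_s (i) : ((vecRep m n).tensor (vecRep m n)).s i =
    TensorProduct.map ((vecRep m n).s i) ((vecRep m n).s i) :=
  TensorProduct.map_pow _ _ _

theorem Rhat_kinv (i) : Rhat m n * TensorProduct.map ((vecRep m n).kinv i) ((vecRep m n).kinv i) =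
    TensorProduct.map ((vecRep m n).kinv i) ((vecRep m n).kinv i) * Rhat m n := by
  rw [vec_kinv]; exact Rhat_diag _

theorem Rhat_k (i) : Rhat m n * TensorProduct.map ((vecRep m n).k i) ((vecRep m n).k i) =
    TensorProduct.map ((vecRep m n).k i) ((vecRep m n).k i) * Rhat m n := by
  rw [vec_k]; exact Rhat_diag _

theorem Rhat_s (i) : Rhat m n * TensorProduct.map ((vecRep m n).s i) ((vecRep m n).s i) =
    TensorProduct.map ((vecRep m n).s i) ((vecRep m n).s i) * Rhat m n := by
  rw [vec_s]; exact Rhat_diag _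

theorem Rhat_K (j) : Rhat m n * TensorProduct.map ((vecRep m n).K j) ((vecRep m n).K j) =
    TensorProduct.map ((vecRep m n).K j) ((vecRep m n).K j) * Rhat m n := by
  have : (vecRep m n).K j = diag fun l => if l = j then q else 1 := vecRep_ρ m n _
  rw [this]; exact Rhat_diag _

theorem Rhat_Kinv (j) : Rhat m n * TensorProduct.map ((vecRep m n).Kinv j) ((vecRep m n).Kinv j) =
    TensorProduct.map ((vecRep m n).Kinv j) ((vecRep m n).Kinv j) * Rhat m n := by
  have : (vecRep m n).Kinv j = diag fun l => if l = j then q⁻¹ else 1 := vecRep_ρ m n _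
  rw [this]; exact Rhat_diag _

theorem map_comm_left {X Y : Module.End Kq (V m n ⊗[Kq] V m n)} (h : X * Y = Y * X)
    (C : Module.End Kq (V m n)) :
    TensorProduct.map X 1 * TensorProduct.map Y C =
      TensorProduct.map Y C * TensorProduct.map X 1 := by
  rw [SuperRep.pp, SuperRep.pp, h, one_mul, mul_one]

theorem map_comm_right {X Y : Module.End Kq (V m n ⊗[Kq] V m n)} (h : X * Y = Y * X)
    (C : Module.End Kq (V m n)) :
    TensorProduct.map 1 X * TensorProduct.map C Y =
      TensorProduct.map C Y * TensorProduct.map 1 X := by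
  rw [SuperRep.pp, SuperRep.pp, h, one_mul, mul_one]

theorem R1_comm_gen (x : UqGen m n) :
    TensorProduct.map (Rhat m n) 1 *
        ((vecRep m n).tensor (vecRep m n)).tensorGen (vecRep m n) x =
      ((vecRep m n).tensor (vecRep m n)).tensorGen (vecRep m n) x *
        TensorProduct.map (Rhat m n) 1 := by
  cases x with
  | e i =>
    have h₁ := map_comm_left m n (Rhat_e m n i) ((vecRep m n).kinv i)
    have h₂ := map_comm_left m n (Rhat_s m n i) ((vecRep m n).e i)
    simp only [SuperRep.tensorGen, T_s]
    rw [T_e, mul_add, add_mul, h₁, h₂]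
  | f i =>
    have h₁ := map_comm_left m n (Rhat_f m n i) 1
    have h₃ : Rhat m n * (TensorProduct.map ((vecRep m n).s i) ((vecRep m n).s i) *
        TensorProduct.map ((vecRep m n).k i) ((vecRep m n).k i)) =
        TensorProduct.map ((vecRep m n).s i) ((vecRep m n).s i) *
        TensorProduct.map ((vecRep m n).k i) ((vecRep m n).k i) * Rhat m n := by
      rw [← mul_assoc, Rhat_s, mul_assoc, Rhat_k, mul_assoc]
    have h₂ := map_comm_left m n h₃ ((vecRep m n).f i)
    simp only [SuperRep.tensorGen, T_s]
    rw [T_f, T_k, mul_add, add_mul, h₁, h₂]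
  | K j =>
    simp only [SuperRep.tensorGen]
    rw [T_K]
    exact map_comm_left m n (Rhat_K m n j) _
  | Kinv j =>
    simp only [SuperRep.tensorGen]
    rw [T_Kinv]
    exact map_comm_left m n (Rhat_Kinv m n j) _

theorem cj_comm {X Y : Module.End Kq (V m n ⊗[Kq] (V m n ⊗[Kq] V m n))} (h : X * Y = Y * X) :
    cj X * cj Y = cj Y * cj X := by
  rw [← cj_mul, h, cj_mul]

theorem R2_comm_gen (x : UqGen m n) :
    cj (TensorProduct.map 1 (Rhat m n)) *
        ((vecRep m n).tensor (vecRep m n)).tensorGen (vecRep m n) x =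
      ((vecRep m n).tensor (vecRep m n)).tensorGen (vecRep m n) x *
        cj (TensorProduct.map 1 (Rhat m n)) := by
  cases x with
  | e i =>
    have h : ((vecRep m n).tensor (vecRep m n)).tensorGen (vecRep m n) (.e i) =
        cj (TensorProduct.map ((vecRep m n).e i)
            (TensorProduct.map ((vecRep m n).kinv i) ((vecRep m n).kinv i)) +
          TensorProduct.map ((vecRep m n).s i)
            ((vecRep m n).tensorGen (vecRep m n) (.e i))) := by
      simp only [SuperRep.tensorGen, T_s]
      rw [T_e]
      simp only [SuperRep.tensorGen, TensorProduct.map_add_left, TensorProduct.map_add_right,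
        cj_add, cj_map, add_assoc]
    rw [h]
    refine cj_comm m n ?_
    rw [mul_add, add_mul, map_comm_right m n (Rhat_kinv m n i),
      map_comm_right m n (Rhat_e m n i)]
  | f i =>
    have h : ((vecRep m n).tensor (vecRep m n)).tensorGen (vecRep m n) (.f i) =
        cj (TensorProduct.map ((vecRep m n).f i) (TensorProduct.map 1 1) +
          TensorProduct.map ((vecRep m n).s i * (vecRep m n).k i)
            ((vecRep m n).tensorGen (vecRep m n) (.f i))) := by
      simp only [SuperRep.tensorGen, T_s]
      rw [T_f, T_k, SuperRep.pp]
      simp only [SuperRep.tensorGen, TensorProduct.map_add_left, TensorProduct.map_add_right,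
        cj_add, cj_map, add_assoc]
    have h₁ : Rhat m n * TensorProduct.map 1 1 = TensorProduct.map 1 1 * Rhat m n := by
      rw [TensorProduct.map_one, one_mul, mul_one]
    rw [h]
    refine cj_comm m n ?_
    rw [mul_add, add_mul, map_comm_right m n h₁, map_comm_right m n (Rhat_f m n i)]
  | K j =>
    simp only [SuperRep.tensorGen]
    rw [T_K, ← cj_map]
    exact cj_comm m n (map_comm_right m n (Rhat_K m n j) _)
  | Kinv j =>
    simp only [SuperRep.tensorGen]
    rw [T_Kinv, ← cj_map]
    exact cj_comm m n (map_comm_right m n (Rhat_Kinv m n j) _)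

theorem V3_ρ (x : UqGen m n) : (V3Rep m n).ρ (ug x) =
    ((vecRep m n).tensor (vecRep m n)).tensorGen (vecRep m n) x := SuperRep.tensor_ρ _ _ _

theorem Rgen_comm (i : Fin (3 - 1)) (x : UqGen m n) :
    Rgen m n i * (V3Rep m n).ρ (ug x) = (V3Rep m n).ρ (ug x) * Rgen m n i := by
  rw [V3_ρ, Rgen]
  split_ifs
  · exact R1_comm_gen m n x
  · exact R2_comm_gen m n x

theorem quot_induction {X A : Type*} [Ring A] [Algebra Kq A]
    {r : FreeAlgebra Kq X → FreeAlgebra Kq X → Prop} (φ : RingQuot r →ₐ[Kq] A) {y : A}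
    (h : ∀ x, φ (RingQuot.mkAlgHom Kq r (FreeAlgebra.ι Kq x)) * y =
      y * φ (RingQuot.mkAlgHom Kq r (FreeAlgebra.ι Kq x))) (z : RingQuot r) :
    φ z * y = y * φ z := by
  obtain ⟨z, rfl⟩ := RingQuot.mkAlgHom_surjective Kq r z
  induction z using FreeAlgebra.induction with
  | grade0 c => rw [AlgHom.commutes, AlgHom.commutes, Algebra.commutes]
  | grade1 x => exact h x
  | mul a b ha hb => rw [map_mul, map_mul, mul_assoc, hb, ← mul_assoc, ha, mul_assoc]
  | add a b ha hb => rw [map_add, map_add, add_mul, mul_add, ha, hb]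

theorem Uq.comm_of_gen {m n : ℕ} {A : Type*} [Ring A] [Algebra Kq A] (φ : Uq m n →ₐ[Kq] A) {y : A}
    (h : ∀ x, φ (ug x) * y = y * φ (ug x)) (u : Uq m n) : φ u * y = y * φ u :=
  quot_induction (r := UqRel m n) φ h u

theorem Hecke.comm_of_gen {r : ℕ} {A : Type*} [Ring A] [Algebra Kq A] (φ : Hecke r →ₐ[Kq] A)
    {y : A} (h : ∀ i, φ (hg i) * y = y * φ (hg i)) (u : Hecke r) : φ u * y = y * φ u :=
  quot_induction (r := HeckeRel r) φ h u

/-- The actions of `H₃(q)` and of `U_q(gl(m|n))` on `V ⊗ V ⊗ V` commute. -/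
theorem actions_commute (h : H3) (u : Uq m n) :
    heckeRep m n h * (V3Rep m n).ρ u = (V3Rep m n).ρ u * heckeRep m n h := by
  refine Hecke.comm_of_gen (heckeRep m n) (fun i => ?_) h
  refine (Uq.comm_of_gen (V3Rep m n).ρ (fun x => ?_) u).symm
  rw [heckeRep_hg]
  exact (Rgen_comm m n i x).symm

end Commute

/-! ### The `q`-Schur functor in degree three -/

instance (m n : ℕ) : Module (Uq m n) (V3 m n) :=
  Module.compHom (V3 m n) (V3Rep m n).ρ.toRingHom

theorem Uq_smul_V3 {m n : ℕ} (u : Uq m n) (w : V3 m n) : u • w = (V3Rep m n).ρ u w := rfl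

section Schur

open MulOpposite

variable (m n : ℕ) (M : Type*) [AddCommGroup M] [Module Kq M] [Module H3ᵐᵒᵖ M]

/-- The relations `x h ⊗ w = x ⊗ h w` of the tensor product over `H₃(q)`, for a right
`H₃(q)`-module `M` and the left module `V ⊗ V ⊗ V`. -/
def balancedRel : Submodule Kq (M ⊗[Kq] V3 m n) :=
  Submodule.span Kq {z | ∃ (x : M) (h : H3) (w : V3 m n),
    z = (op h • x) ⊗ₜ[Kq] w - x ⊗ₜ[Kq] heckeRep m n h w}

/-- The tensor product of the right `H₃(q)`-module `M` with `V ⊗ V ⊗ V` over `H₃(q)`. -/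
def QSchur : Type _ := (M ⊗[Kq] V3 m n) ⧸ balancedRel m n M

instance : AddCommGroup (QSchur m n M) :=
  inferInstanceAs (AddCommGroup ((M ⊗[Kq] V3 m n) ⧸ balancedRel m n M))

instance : Module Kq (QSchur m n M) :=
  inferInstanceAs (Module Kq ((M ⊗[Kq] V3 m n) ⧸ balancedRel m n M))

/-- The class of `x ⊗ w`. -/
def QSchur.mk (x : M) (w : V3 m n) : QSchur m n M :=
  (balancedRel m n M).mkQ (x ⊗ₜ[Kq] w)

theorem balancedRel_le (u : Uq m n) :
    balancedRel m n M ≤ (balancedRel m n M).comap (((V3Rep m n).ρ u).lTensor M) := by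
  unfold balancedRel
  rw [Submodule.span_le]
  rintro _ ⟨x, h, w, rfl⟩
  refine Submodule.subset_span ⟨x, h, (V3Rep m n).ρ u w, ?_⟩
  have := LinearMap.congr_fun (actions_commute m n h u) w
  rw [Module.End.mul_apply, Module.End.mul_apply] at this
  rw [map_sub, LinearMap.lTensor_tmul, LinearMap.lTensor_tmul, this]

/-- The operator `id ⊗ u` on the tensor product over `H₃(q)`. -/
def QSchur.act (u : Uq m n) : Module.End Kq (QSchur m n M) :=
  (balancedRel m n M).mapQ (balancedRel m n M) (((V3Rep m n).ρ u).lTensor M)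
    (balancedRel_le m n M u)

theorem QSchur.act_mk (u : Uq m n) (x : M) (w : V3 m n) :
    QSchur.act m n M u (QSchur.mk m n M x w) = QSchur.mk m n M x ((V3Rep m n).ρ u w) := rfl

theorem QSchur.ext {m n : ℕ} {M : Type*} [AddCommGroup M] [Module Kq M] [Module H3ᵐᵒᵖ M]
    {W : Type*} [AddCommGroup W] [Module Kq W] {S T : QSchur m n M →ₗ[Kq] W}
    (h : ∀ x w, S (QSchur.mk m n M x w) = T (QSchur.mk m n M x w)) : S = T :=
  Submodule.linearMap_qext _ (TensorProduct.ext' h)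

/-- The linear map out of the tensor product over `H₃(q)` given by a balanced bilinear map. -/
def QSchur.lift {W : Type*} [AddCommGroup W] [Module Kq W] (F : M →ₗ[Kq] V3 m n →ₗ[Kq] W)
    (hF : ∀ x h w, F (op h • x) w = F x (heckeRep m n h w)) : QSchur m n M →ₗ[Kq] W :=
  (balancedRel m n M).liftQ (TensorProduct.lift F) <| by
    unfold balancedRel
    rw [Submodule.span_le]
    rintro _ ⟨x, h, w, rfl⟩
    rw [SetLike.mem_coe, LinearMap.mem_ker, map_sub, TensorProduct.lift.tmul,
      TensorProduct.lift.tmul, sub_eq_zero]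
    exact hF x h w

theorem QSchur.lift_mk {W : Type*} [AddCommGroup W] [Module Kq W]
    (F : M →ₗ[Kq] V3 m n →ₗ[Kq] W)
    (hF : ∀ x h w, F (op h • x) w = F x (heckeRep m n h w)) (x : M) (w : V3 m n) :
    QSchur.lift m n M F hF (QSchur.mk m n M x w) = F x w := rfl

theorem QSchur.mk_add (x : M) (v w : V3 m n) :
    QSchur.mk m n M x (v + w) = QSchur.mk m n M x v + QSchur.mk m n M x w := by
  unfold QSchur.mk; rw [TensorProduct.tmul_add]; exact map_add _ _ _

/-- The action of `U_q(gl(m|n))` on the image of the `q`-Schur functor. -/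
def QSchur.rep : Uq m n →+* Module.End Kq (QSchur m n M) where
  toFun := QSchur.act m n M
  map_one' := QSchur.ext fun x w => by rw [QSchur.act_mk, map_one]; rfl
  map_mul' u v := QSchur.ext fun x w => by
    rw [Module.End.mul_apply, QSchur.act_mk, QSchur.act_mk, QSchur.act_mk, map_mul]; rfl
  map_zero' := QSchur.ext fun x w => by
    rw [QSchur.act_mk, map_zero, LinearMap.zero_apply, LinearMap.zero_apply]
    unfold QSchur.mk; rw [TensorProduct.tmul_zero]; exact map_zero _
  map_add' u v := QSchur.ext fun x w => by
    rw [LinearMap.add_apply, QSchur.act_mk, QSchur.act_mk, QSchur.act_mk, map_add,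
      LinearMap.add_apply, QSchur.mk_add]

instance : Module (Uq m n) (QSchur m n M) := Module.compHom (QSchur m n M) (QSchur.rep m n M)

theorem QSchur.smul_mk (u : Uq m n) (x : M) (w : V3 m n) :
    u • QSchur.mk m n M x w = QSchur.mk m n M x (u • w) := rfl

end Schur

/-- The bilinear map `(x, w) ↦ x w` for a right ideal `J` of `H₃(q)`. -/
def idealAct (m n : ℕ) (J : Submodule H3ᵐᵒᵖ H3) : J →ₗ[Kq] V3 m n →ₗ[Kq] V3 m n where
  toFun x := heckeRep m n (x : H3)
  map_add' x y := map_add (heckeRep m n) (x : H3) (y : H3)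
  map_smul' c x := map_smul (heckeRep m n) c (x : H3)

theorem idealAct_balanced (m n : ℕ) (J : Submodule H3ᵐᵒᵖ H3) (x : J) (h : H3) (w : V3 m n) :
    idealAct m n J (MulOpposite.op h • x) w = idealAct m n J x (heckeRep m n h w) := by
  have : heckeRep m n ((x : H3) * h) w = heckeRep m n x (heckeRep m n h w) := by
    rw [map_mul]; rfl
  exact this

/-- The `ℂ(q)`-linear map underlying `toTensor`. -/
def toTensorLin (m n : ℕ) (J : Submodule H3ᵐᵒᵖ H3) : QSchur m n J →ₗ[Kq] V3 m n :=
  QSchur.lift m n J (idealAct m n J) (idealAct_balanced m n J)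

theorem toTensorLin_mk (m n : ℕ) (J : Submodule H3ᵐᵒᵖ H3) (x : J) (w : V3 m n) :
    toTensorLin m n J (QSchur.mk m n J x w) = heckeRep m n (x : H3) w := rfl

theorem toTensorLin_act (m n : ℕ) (J : Submodule H3ᵐᵒᵖ H3) (u : Uq m n) :
    toTensorLin m n J ∘ₗ QSchur.act m n J u = (V3Rep m n).ρ u ∘ₗ toTensorLin m n J :=
  QSchur.ext fun x w => by
    rw [LinearMap.comp_apply, LinearMap.comp_apply, QSchur.act_mk, toTensorLin_mk,
      toTensorLin_mk]
    exact LinearMap.congr_fun (actions_commute m n x u) w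

/-- For a right ideal `J` of `H₃(q)`, the canonical map `x ⊗ w ↦ x w` from its image under the
`q`-Schur functor to `V ⊗ V ⊗ V`. -/
def toTensor (m n : ℕ) (J : Submodule H3ᵐᵒᵖ H3) : QSchur m n J →ₗ[Uq m n] V3 m n where
  toFun := toTensorLin m n J
  map_add' := map_add (toTensorLin m n J)
  map_smul' u z := LinearMap.congr_fun (toTensorLin_act m n J u) z

theorem toTensor_mk (m n : ℕ) (J : Submodule H3ᵐᵒᵖ H3) (x : J) (w : V3 m n) :
    toTensor m n J (QSchur.mk m n J x w) = heckeRep m n (x : H3) w := rfl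

/-! ### The two right ideals of `H₃(q)` and the modules they define -/

/-- The deformed Eulerian idempotent `e(q)`; here `[3] = q² + 1 + q⁻²`. -/
def eIdem : H3 :=
  (q ^ 2 + 1 + (q ^ 2)⁻¹)⁻¹ •
    (1 - (2 : Kq)⁻¹ • (g₁ * g₂ + g₁ + g₂ + g₂ * g₁) + g₁ * g₂ * g₁) +
  ((q - q⁻¹) * (2 * (q ^ 2 + 1 + (q ^ 2)⁻¹))⁻¹) • (g₁ - g₂ * g₁ - g₁ * g₂ + g₂)

/-- The right ideal `e(q) H₃(q)`. -/
def idealI3 : Submodule H3ᵐᵒᵖ H3 := Submodule.span H3ᵐᵒᵖ {eIdem}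

/-- The irreducible right `H₃(q)`-module labelled by the partition `(2,1)`, as the Specht module
`x T y H₃(q)`: `x = 1 + q g₁` and `y = 1 - q⁻¹ g₁` are the `q`-symmetrizer and the
`q`-antisymmetrizer of the Young subgroup generated by `(1 2)`, and `T = g₂` belongs to the
permutation that takes the row reading of the diagram to its column reading. -/
def specht21 : Submodule H3ᵐᵒᵖ H3 :=
  Submodule.span H3ᵐᵒᵖ {(1 + q • g₁) * g₂ * (1 - q⁻¹ • g₁)}

/-- The space `I₃(V)`: the image of the right module `e(q) H₃(q)` under the `q`-Schur functor. -/
abbrev I3V (m n : ℕ) : Type := QSchur m n idealI3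

/-- The module `V^(2,1)`: the image of the irreducible right module labelled by `(2,1)` under the
`q`-Schur functor. -/
abbrev V21 (m n : ℕ) : Type := QSchur m n specht21

/-! ### Tableaux and `q`-deformed double supercommutators -/

/-- An `(m,n)`-semistandard tableau of shape `(2,1)`: first row `x y`, second row `z`. Even letters
may repeat in rows only, odd letters in columns only. -/
@[ext]
structure Tableau21 (m n : ℕ) where
  x : Fin (m + n)
  y : Fin (m + n)
  z : Fin (m + n)
  row : x < y ∨ (x = y ∧ par x = 0)
  col : x < z ∨ (x = z ∧ par x = 1)

/-- The supercommutator `⟦aᵢ, aⱼ⟧ = aᵢ ⊗ aⱼ - (-1) ^ (î ĵ) aⱼ ⊗ aᵢ`. -/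
def br {m n : ℕ} (i j : Fin (m + n)) : V m n ⊗[Kq] V m n :=
  a i ⊗ₜ[Kq] a j - (-1 : Kq) ^ (par i * par j) • (a j ⊗ₜ[Kq] a i)

/-- `v ⊗ X` as an element of `V ⊗ V ⊗ V`. -/
def lmul {m n : ℕ} (v : V m n) (X : V m n ⊗[Kq] V m n) : V3 m n :=
  (TensorProduct.assoc Kq (V m n) (V m n) (V m n)).symm (v ⊗ₜ[Kq] X)

/-- `X ⊗ v` as an element of `V ⊗ V ⊗ V`. -/
def rmul {m n : ℕ} (X : V m n ⊗[Kq] V m n) (v : V m n) : V3 m n := X ⊗ₜ[Kq] v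

/-- `⟦aᵢ, ⟦aⱼ, a_k⟧⟧_t`, where `⟦x, y⟧_t = x y - (-1) ^ (x̂ ŷ) t y x`. -/
def brL {m n : ℕ} (t : Kq) (i j k : Fin (m + n)) : V3 m n :=
  lmul (a i) (br j k) - ((-1 : Kq) ^ (par i * (par j + par k)) * t) • rmul (br j k) (a i)

/-- `⟦⟦aᵢ, aⱼ⟧, a_k⟧_t`, where `⟦x, y⟧_t = x y - (-1) ^ (x̂ ŷ) t y x`. -/
def brR {m n : ℕ} (t : Kq) (i j k : Fin (m + n)) : V3 m n :=
  rmul (br i j) (a k) - ((-1 : Kq) ^ ((par i + par j) * par k) * t) • lmul (a k) (br i j)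

/-- The element `Γ` of `V ⊗ V ⊗ V` attached to a tableau with first row `x y` and second
row `z`. -/
def Gam {m n : ℕ} (T : Tableau21 m n) : V3 m n :=
  if T.x = T.y then brR q⁻¹ T.x T.z T.x
  else if T.x = T.z then brL q⁻¹ T.x T.x T.y
  else if T.y = T.z then
    if par T.y = 1 then brR q⁻¹ T.x T.y T.y else brL q⁻¹ T.y T.x T.y
  else if T.y < T.z then
    brR (q ^ 2)⁻¹ T.z T.x T.y -
      ((-1 : Kq) ^ (par T.y * (par T.x + par T.z)) * q⁻¹) • brR 1 T.y T.z T.x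
  else
    brL (q ^ 2)⁻¹ T.z T.y T.x -
      ((-1 : Kq) ^ (par T.z * (par T.x + par T.y)) * q⁻¹) • brL 1 T.y T.x T.z

end Parastat

end

/-! Write E for `eNum`, that is [3] e(q), and s for `spechtGen`.

Injectivity and the isomorphism are algebra in H₃(q). If an element r satisfies r y r = r for some
y, then the canonical map from the image of r H₃(q) under the functor to V⊗V⊗V has the left inverse
v ↦ r ⊗ y v (`mk_toTensor`), so this image is r(V⊗V⊗V), with no appeal to semisimplicity. This
applies to the idempotent e(q) with y = 1. The identities E s E = -([3]²/2) E and s E s = -([3]²/2)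
s (`eNum_spechtGen_eNum`, `spechtGen_eNum_spechtGen`) show that it applies to s as well, and that
left multiplications by s and by -(2/[3]) e(q) are mutually inverse between e(q)(V⊗V⊗V) and
s(V⊗V⊗V). They commute with U_q, which gives I₃(V) ≅ V^(2,1).

For the basis, the right ideal of e(q) is spanned by E and E g₂. Hence the vectors w for which E w
and E g₂ w both lie in the span of the Γ form a subspace stable under both R-matrices, and it is
enough to test sorted words, where explicit formulas express E w through Γ (`eNum_mem_gamSpan`). The
coefficients in these formulas do not vanish in ℂ(q), so conversely each Γ lies in the image of E
(`Gam_mem_range`). Independence comes from a linear map that sends each Γ to a nonzero multiple of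
the word x y z of its tableau (`reading_Gam`).

Irreducibility is a weight argument. The Γ are weight vectors and weights record multiplicities of
letters, because powers of q are distinct. Measure a tableau by the sum of its letters, counted from
0: each eᵢ lowers this sum by one, and exactly one tableau has the minimal sum 1. The key point,
`mem_loweredSpan`, is that every weight vector z of larger sum lies in the U_q-submodule generated
by the eᵢ z. If some letter i is absent while i+1 is present, fᵢ eᵢ z is a nonzero multiple of z by
the relation for [eᵢ, fᵢ]. Otherwise the letters are 0,1,1 or 0,1,2. In the first case fᵢ eᵢ is
again a nonzero scalar; in the second the sum of two operators fᵢ eᵢ satisfies a quadratic equation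
with nonzero constant term, hence is invertible on the weight space. It follows that a nonzero
submodule contains the highest weight vector (apply the eᵢ; they cannot all kill z) and then, by
induction on the sum, every Γ. -/

noncomputable section

namespace Parastat

/-! ### Nonvanishing of some Laurent polynomials in `q` -/

instance : CharZero Kq := inferInstanceAs (CharZero (RatFunc ℂ))

/-- The polynomial X² + cX + 1 has constant coefficient 1. The cases c = ±1 are the coefficients met
when e(q) acts on words, and their product is q²[3]. -/
theorem quad_q_ne_zero (c : ℤ) : q ^ 2 + c * q + 1 ≠ 0 := by
  have h : (Polynomial.X ^ 2 + Polynomial.C (c : ℂ) * Polynomial.X + 1 : Polynomial ℂ) ≠ 0 := by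
    intro h
    have := congrArg (fun p => Polynomial.coeff p 0) h
    simp at this
  have h' : (algebraMap (Polynomial ℂ) (RatFunc ℂ)
      (Polynomial.X ^ 2 + Polynomial.C (c : ℂ) * Polynomial.X + 1)) ≠ 0 := by
    rwa [ne_eq, map_eq_zero_iff _ (IsFractionRing.injective (Polynomial ℂ) (RatFunc ℂ))]
  have h'' : (RatFunc.X : RatFunc ℂ) ^ 2 + (c : RatFunc ℂ) * RatFunc.X + 1 ≠ 0 := by
    simpa [RatFunc.algebraMap_X, RatFunc.algebraMap_C] using h'
  exact h''

theorem q_pos_ne_zero : q ^ 2 + q + 1 ≠ 0 := by simpa using quad_q_ne_zero 1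

theorem q_neg_ne_zero : q ^ 2 - q + 1 ≠ 0 := by
  simpa [← sub_eq_add_neg] using quad_q_ne_zero (-1)

theorem three_q_ne_zero : q ^ 2 + 1 + (q ^ 2)⁻¹ ≠ 0 := by
  have q0 := q_ne_zero
  have h : q ^ 2 + 1 + (q ^ 2)⁻¹ = (q ^ 2 + q + 1) * (q ^ 2 - q + 1) * (q ^ 2)⁻¹ := by
    field_simp
    ring
  rw [h]
  exact mul_ne_zero (mul_ne_zero q_pos_ne_zero q_neg_ne_zero) (inv_ne_zero (pow_ne_zero 2 q0))

/-! ### Computations in `H₃(q)` -/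

theorem g₁_sq : g₁ * g₁ = 1 + (q - q⁻¹) • g₁ := by
  have := RingQuot.mkAlgHom_rel Kq (HeckeRel.quad (r := 3) (0 : Fin 2))
  simp only [map_mul, map_add, map_one, map_smul] at this
  exact this

theorem g₂_sq : g₂ * g₂ = 1 + (q - q⁻¹) • g₂ := by
  have := RingQuot.mkAlgHom_rel Kq (HeckeRel.quad (r := 3) (1 : Fin 2))
  simp only [map_mul, map_add, map_one, map_smul] at this
  exact this

/-- Oriented as the rewriting rule g₂g₁g₂ → g₁g₂g₁. Together with the quadratic relations and the
versions below with a trailing factor, it reduces right-associated products to combinations of 1,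
g₁, g₂, g₁g₂, g₂g₁, g₁g₂g₁, whose coefficients can be compared. -/
theorem g_braid : g₂ * (g₁ * g₂) = g₁ * (g₂ * g₁) := by
  have := RingQuot.mkAlgHom_rel Kq (HeckeRel.braid (r := 3) (0 : Fin 2) (1 : Fin 2) rfl)
  simp only [map_mul] at this
  rw [← mul_assoc, ← mul_assoc]
  exact this.symm

theorem g₁_sq_mul (x : H3) : g₁ * (g₁ * x) = x + (q - q⁻¹) • (g₁ * x) := by
  rw [← mul_assoc, g₁_sq, add_mul, one_mul, smul_mul_assoc]

theorem g₂_sq_mul (x : H3) : g₂ * (g₂ * x) = x + (q - q⁻¹) • (g₂ * x) := by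
  rw [← mul_assoc, g₂_sq, add_mul, one_mul, smul_mul_assoc]

theorem g_braid_mul (x : H3) : g₂ * (g₁ * (g₂ * x)) = g₁ * (g₂ * (g₁ * x)) := by
  rw [← mul_assoc, ← mul_assoc, mul_assoc g₂, g_braid]; simp only [mul_assoc]

/-- The multiple `[3] e(q)` of the idempotent `e(q)`. -/
def eNum : H3 :=
  (1 - (2 : Kq)⁻¹ • (g₁ * g₂ + g₁ + g₂ + g₂ * g₁) + g₁ * g₂ * g₁) +
  ((q - q⁻¹) * 2⁻¹) • (g₁ - g₂ * g₁ - g₁ * g₂ + g₂)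

theorem eIdem_eq : eIdem = (q ^ 2 + 1 + (q ^ 2)⁻¹)⁻¹ • eNum := by
  unfold eIdem eNum
  conv_rhs => rw [smul_add, smul_smul]
  rw [mul_inv]
  congr 2
  ring

/-- The generator of the Specht module of shape `(2,1)`. -/
def spechtGen : H3 := (1 + q • g₁) * g₂ * (1 - q⁻¹ • g₁)

/-- With `eNum_mul_g₂g₁` and the quadratic relation for g₂, this shows that the right ideal
generated by `eNum` is spanned by `eNum` and `eNum * g₂`. All later computations with `eNum` on the
left take place in this plane. -/
theorem eNum_mul_g₁ : eNum * g₁ = (q - q⁻¹ - 1) • eNum - eNum * g₂ := by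
  have q0 := q_ne_zero
  simp only [eNum, mul_add, add_mul, mul_sub, sub_mul, smul_mul_assoc, mul_smul_comm, smul_add,
    smul_sub, mul_one, one_mul, mul_assoc, g₁_sq, g₂_sq, g_braid, g₁_sq_mul, g₂_sq_mul,
    g_braid_mul]
  match_scalars <;> field_simp <;> ring

theorem eNum_mul_g₂g₁ : eNum * (g₂ * g₁) = eNum * g₂ - (q - q⁻¹) • eNum := by
  have q0 := q_ne_zero
  simp only [eNum, mul_add, add_mul, mul_sub, sub_mul, smul_mul_assoc, mul_smul_comm, smul_add,
    smul_sub, mul_one, one_mul, mul_assoc, g₁_sq, g₂_sq, g_braid, g₁_sq_mul, g₂_sq_mul,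
    g_braid_mul]
  match_scalars <;> field_simp <;> ring

/-- Only the right-hand factor is unfolded. A factor `eNum` inside x stays an atom, so that the
relations of its right ideal can be applied to it. -/
theorem mul_eNum (x : H3) : x * eNum = x * (1 - (2 : Kq)⁻¹ • (g₁ * g₂ + g₁ + g₂ + g₂ * g₁) +
    g₁ * g₂ * g₁) + ((q - q⁻¹) * 2⁻¹) • (x * (g₁ - g₂ * g₁ - g₁ * g₂ + g₂)) := by
  rw [← mul_smul_comm, ← mul_add]
  rfl

theorem eNum_mul_g₁g₂ :
    eNum * (g₁ * g₂) = (q - q⁻¹ - 1) • (eNum * g₂) - (eNum + (q - q⁻¹) • (eNum * g₂)) := by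
  rw [← mul_assoc, eNum_mul_g₁, sub_mul, smul_mul_assoc, mul_assoc, g₂_sq, mul_add, mul_one,
    mul_smul_comm]

theorem eNum_mul_g₁g₂g₁ : eNum * (g₁ * (g₂ * g₁)) = (q - q⁻¹ - 1) • (eNum * (g₂ * g₁)) -
    (eNum * g₁ + (q - q⁻¹) • (eNum * (g₂ * g₁))) := by
  rw [← mul_assoc g₁, ← mul_assoc, eNum_mul_g₁g₂, sub_mul, add_mul]
  simp only [smul_mul_assoc, mul_assoc]

theorem eNum_sq : eNum * eNum = (q ^ 2 + 1 + (q ^ 2)⁻¹) • eNum := by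
  have q0 := q_ne_zero
  rw [mul_eNum]
  simp only [mul_add, mul_sub, mul_smul_comm, smul_add, smul_sub, mul_one, mul_assoc,
    eNum_mul_g₁g₂, eNum_mul_g₁g₂g₁, eNum_mul_g₁, eNum_mul_g₂g₁]
  match_scalars <;> field_simp <;> ring

/-- A multiple of `eNum` is to be expected, since e(q) is a primitive idempotent; the scalar is
needed for the product with the Specht generator. -/
theorem eNum_mul_g₂_mul_eNum :
    eNum * (g₂ * eNum) = ((q ^ 2 + 1 + (q ^ 2)⁻¹) * ((q - q⁻¹ - 1) / 2)) • eNum := by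
  have q0 := q_ne_zero
  have h : eNum * (g₁ * (g₂ * (g₁ * g₁))) =
      eNum * (g₁ * g₂) + (q - q⁻¹) • (eNum * (g₁ * (g₂ * g₁))) := by
    simp only [g₁_sq, mul_add, mul_one, mul_smul_comm]
  rw [mul_eNum]
  simp only [mul_add, mul_sub, mul_smul_comm, smul_add, smul_sub, mul_one, mul_assoc, g₂_sq,
    g₂_sq_mul, g_braid, g_braid_mul, h, eNum_mul_g₁g₂, eNum_mul_g₁g₂g₁, eNum_mul_g₁,
    eNum_mul_g₂g₁]
  match_scalars <;> field_simp <;> ring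

theorem eIdem_sq : eIdem * eIdem = eIdem := by
  rw [eIdem_eq, smul_mul_smul_comm, eNum_sq, smul_smul, mul_assoc,
    inv_mul_cancel₀ three_q_ne_zero, mul_one]

/-- The two right ideals are isomorphic irreducible modules, so that going from one to the other and
back is a scalar. What matters is that this scalar is nonzero, here and in
`spechtGen_eNum_spechtGen`. -/
theorem eNum_spechtGen_eNum : eNum * spechtGen * eNum =
    (-(q ^ 2 + 1 + (q ^ 2)⁻¹) ^ 2 / 2) • eNum := by
  have q0 := q_ne_zero
  have h : eNum * spechtGen = eNum * g₂ - q⁻¹ • (eNum * (g₂ * g₁)) + q • (eNum * (g₁ * g₂)) -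
      eNum * (g₁ * (g₂ * g₁)) := by
    simp only [spechtGen, add_mul, mul_sub, mul_add, one_mul, mul_one, smul_mul_assoc,
      mul_smul_comm, mul_assoc]
    match_scalars <;> field_simp
  rw [h]
  simp only [eNum_mul_g₁g₂, eNum_mul_g₁g₂g₁, eNum_mul_g₁, eNum_mul_g₂g₁, sub_mul, add_mul,
    smul_mul_assoc, mul_assoc, eNum_sq, eNum_mul_g₂_mul_eNum]
  match_scalars
  field_simp
  ring

theorem spechtGen_eNum_spechtGen : spechtGen * eNum * spechtGen =
    (-(q ^ 2 + 1 + (q ^ 2)⁻¹) ^ 2 / 2) • spechtGen := by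
  have q0 := q_ne_zero
  simp only [spechtGen, eNum, mul_add, add_mul, mul_sub, sub_mul, smul_mul_assoc, mul_smul_comm, smul_add,
    smul_sub, mul_one, one_mul, mul_assoc, g₁_sq, g₂_sq, g_braid, g₁_sq_mul, g₂_sq_mul,
    g_braid_mul]
  match_scalars <;> field_simp <;> ring

/-! ### Images of principal right ideals under the `q`-Schur functor -/

/-- The action of an element of `H₃(q)` on `V ⊗ V ⊗ V`, as a `U_q(gl(m|n))`-linear map. -/
def heckeHom (m n : ℕ) (h : H3) : V3 m n →ₗ[Uq m n] V3 m n where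
  toFun := heckeRep m n h
  map_add' := map_add (heckeRep m n h)
  map_smul' u w := LinearMap.congr_fun (actions_commute m n h u) w

theorem heckeRep_mul_apply (m n : ℕ) (x y : H3) (w : V3 m n) :
    heckeRep m n (x * y) w = heckeRep m n x (heckeRep m n y w) := by
  rw [map_mul]; rfl

theorem heckeRep_smul_apply (m n : ℕ) (c : Kq) (x : H3) (w : V3 m n) :
    heckeRep m n (c • x) w = c • heckeRep m n x w := by
  rw [map_smul]; rfl

/-- The generator of a principal right ideal, as an element of it. -/
def idealGen (s : H3) : (Submodule.span H3ᵐᵒᵖ {s} : Submodule H3ᵐᵒᵖ H3) :=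
  ⟨s, Submodule.mem_span_singleton_self s⟩

theorem QSchur.mk_op_smul (m n : ℕ) {M : Type*} [AddCommGroup M] [Module Kq M] [Module H3ᵐᵒᵖ M]
    (x : M) (h : H3) (w : V3 m n) :
    QSchur.mk m n M (MulOpposite.op h • x) w = QSchur.mk m n M x (heckeRep m n h w) :=
  (Submodule.Quotient.eq _).2 (Submodule.subset_span ⟨x, h, w, rfl⟩)

/-- The map `w ↦ x ⊗ w`. -/
def QSchur.mkLin (m n : ℕ) {M : Type*} [AddCommGroup M] [Module Kq M] [Module H3ᵐᵒᵖ M] (x : M) :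
    V3 m n →ₗ[Kq] QSchur m n M :=
  (balancedRel m n M).mkQ ∘ₗ TensorProduct.mk Kq M (V3 m n) x

theorem QSchur.mkLin_apply (m n : ℕ) {M : Type*} [AddCommGroup M] [Module Kq M]
    [Module H3ᵐᵒᵖ M] (x : M) (w : V3 m n) : QSchur.mkLin m n x w = QSchur.mk m n M x w := rfl

/-- If `s y s = s`, an element of the image of `s H₃(q)` is determined by its image in
`V ⊗ V ⊗ V`. -/
theorem mk_toTensor (m n : ℕ) {s y : H3} (h : s * y * s = s)
    (z : QSchur m n (Submodule.span H3ᵐᵒᵖ {s} : Submodule H3ᵐᵒᵖ H3)) :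
    QSchur.mk m n _ (idealGen s) (heckeRep m n y (toTensor m n _ z)) = z := by
  have e : MulOpposite.op (y * s) • idealGen s = idealGen s :=
    Subtype.ext (show s * (y * s) = s by rw [← mul_assoc, h])
  have : QSchur.mkLin m n (idealGen s) ∘ₗ heckeRep m n y ∘ₗ toTensorLin m n _ =
      LinearMap.id := by
    refine QSchur.ext fun x w => ?_
    obtain ⟨k, hk⟩ := Submodule.mem_span_singleton.1 x.2
    have hx : x = MulOpposite.op k.unop • idealGen s := Subtype.ext hk.symm
    -- With x = s k, the class of x ⊗ w is that of s ⊗ k w and its image is s k w. Moving y s across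
    -- the tensor sign turns s ⊗ y s k w into s y s ⊗ k w, which is s ⊗ k w.
    rw [LinearMap.id_apply, hx, LinearMap.comp_apply, LinearMap.comp_apply,
      QSchur.mk_op_smul, toTensorLin_mk, QSchur.mkLin_apply, ← heckeRep_mul_apply,
      ← QSchur.mk_op_smul]
    exact congrArg (fun x => QSchur.mk m n _ x _) e
  exact LinearMap.congr_fun this z

/-- `mk_toTensor` provides a left inverse. -/
theorem toTensor_injective (m n : ℕ) {s y : H3} (h : s * y * s = s) :
    Function.Injective (toTensor m n (Submodule.span H3ᵐᵒᵖ {s})) := fun z z' hz => by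
  rw [← mk_toTensor m n h z, ← mk_toTensor m n h z', hz]

theorem range_toTensor (m n : ℕ) {s y : H3} (h : s * y * s = s) :
    LinearMap.range (toTensor m n (Submodule.span H3ᵐᵒᵖ {s})) =
      LinearMap.range (heckeHom m n s) := by
  apply le_antisymm
  · rintro _ ⟨z, rfl⟩
    rw [← mk_toTensor m n h z]
    exact ⟨_, rfl⟩
  · rintro _ ⟨w, rfl⟩
    exact ⟨QSchur.mk m n _ (idealGen s) w, rfl⟩

/-- The image of `s H₃(q)` under the `q`-Schur functor is the subspace `s (V ⊗ V ⊗ V)`. -/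
def QSchur.equivRange (m n : ℕ) {s y : H3} (h : s * y * s = s) :
    QSchur m n (Submodule.span H3ᵐᵒᵖ {s} : Submodule H3ᵐᵒᵖ H3) ≃ₗ[Uq m n]
      LinearMap.range (heckeHom m n s) :=
  (LinearEquiv.ofInjective _ (toTensor_injective m n h)).trans
    (LinearEquiv.ofEq _ _ (range_toTensor m n h))

/-- If `r y s r = r` and `s r y s = s`, left multiplications by `s` and `r y` identify
`r (V ⊗ V ⊗ V)` and `s (V ⊗ V ⊗ V)`. -/
def rangeEquiv (m n : ℕ) {r s y : H3} (h₁ : r * y * s * r = r) (h₂ : s * (r * y) * s = s) :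
    LinearMap.range (heckeHom m n r) ≃ₗ[Uq m n] LinearMap.range (heckeHom m n s) :=
  LinearEquiv.ofLinearMap
    (((heckeHom m n s).domRestrict _).codRestrict _ fun w => ⟨w, rfl⟩)
    (((heckeHom m n (r * y)).domRestrict _).codRestrict _ fun w =>
      ⟨heckeRep m n y w, (heckeRep_mul_apply m n r y w).symm⟩)
    (LinearMap.ext fun ⟨_, w, hw⟩ => Subtype.ext <| by
      subst hw
      show heckeRep m n s (heckeRep m n (r * y) (heckeRep m n s w)) = heckeRep m n s w
      rw [← heckeRep_mul_apply, ← heckeRep_mul_apply, h₂])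
    (LinearMap.ext fun ⟨_, w, hw⟩ => Subtype.ext <| by
      subst hw
      show heckeRep m n (r * y) (heckeRep m n s (heckeRep m n r w)) = heckeRep m n r w
      rw [← heckeRep_mul_apply, ← heckeRep_mul_apply, h₁])

theorem I3V_equiv_V21 (m n : ℕ) : Nonempty (I3V m n ≃ₗ[Uq m n] V21 m n) := by
  have t0 := three_q_ne_zero
  set t : Kq := q ^ 2 + 1 + (q ^ 2)⁻¹ with ht
  -- The factor for which c e(q) inverts s: the product e s e is -([3]/2) e once the denominators of
  -- e(q) = [3]⁻¹ `eNum` are restored.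
  set c : Kq := -(2 / t) with hc
  have h₁ : eIdem * (c • 1) * spechtGen * eIdem = eIdem := by
    rw [eIdem_eq, ← ht]
    simp only [smul_mul_assoc, mul_smul_comm, mul_one, eNum_spechtGen_eNum, smul_smul, ← ht]
    congr 1
    rw [hc]
    field_simp
  have h₂ : spechtGen * (eIdem * (c • 1)) * spechtGen = spechtGen := by
    rw [eIdem_eq, ← ht]
    simp only [smul_mul_assoc, mul_smul_comm, mul_one, spechtGen_eNum_spechtGen, smul_smul, ← ht]
    conv_rhs => rw [← one_smul Kq spechtGen]
    congr 1
    rw [hc]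
    field_simp
  have h₃ : eIdem * 1 * eIdem = eIdem := by rw [mul_one, eIdem_sq]
  exact ⟨(QSchur.equivRange m n h₃).trans
    ((rangeEquiv m n h₁ h₂).trans (QSchur.equivRange m n h₂).symm)⟩

/-! ### The action of `e(q)` on words -/

/-- The sign `(-1) ^ (parity i * parity j)`. -/
def sgn {m n : ℕ} (i j : Fin (m + n)) : Kq := (-1) ^ (par i * par j)

theorem sgn_sq {m n : ℕ} (i j : Fin (m + n)) : sgn i j * sgn i j = 1 := SuperRep.sign_sq _

theorem sgn_symm {m n : ℕ} (i j : Fin (m + n)) : sgn i j = sgn j i := by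
  unfold sgn; rw [mul_comm]

theorem sgn_eq {m n : ℕ} (i j : Fin (m + n)) : sgn i j = 1 ∨ sgn i j = -1 :=
  mul_self_eq_one_iff.1 (sgn_sq i j)

theorem sgn_add {m n : ℕ} (i j k : Fin (m + n)) :
    (-1 : Kq) ^ (par i * (par j + par k)) = sgn i j * sgn i k := by
  rw [mul_add, pow_add]; rfl

theorem sgn_add' {m n : ℕ} (i j k : Fin (m + n)) :
    (-1 : Kq) ^ ((par i + par j) * par k) = sgn i k * sgn j k := by
  rw [add_mul, pow_add]; rfl

/-- The eigenvalue of the `R`-matrix on `aᵢ ⊗ aᵢ`. -/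
def rii {m n : ℕ} (i : Fin (m + n)) : Kq := if par i = 0 then q else -q⁻¹

theorem rc_ne {m n : ℕ} {i j : Fin (m + n)} (h : i ≠ j) : rc i j = sgn i j := by
  rw [rc, if_neg h, mul_one, sgn]

theorem rc_same {m n : ℕ} (i : Fin (m + n)) : rc i i = rii i := by
  unfold rc rii dq
  rcases par_cases i with h | h
  · rw [if_pos rfl, if_pos h, h, if_pos ((par_eq_zero i).1 h)]; simp
  · have h' : ¬ i.val < m := fun h' => by rw [(par_eq_zero i).2 h'] at h; simp at h
    rw [if_pos rfl, h, if_neg h']; simp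

theorem heckeRep_g₁ (m n : ℕ) : heckeRep m n g₁ = R1 m n := heckeRep_hg m n (0 : Fin 2)

theorem heckeRep_g₂ (m n : ℕ) : heckeRep m n g₂ = R2 m n := heckeRep_hg m n (1 : Fin 2)

section Words

variable {m n : ℕ} {i j k : Fin (m + n)}

theorem R1_lt (h : i < j) :
    R1 m n (word i j k) = sgn i j • word j i k + (q - q⁻¹) • word i j k := by
  rw [R1_word, rc_ne h.ne, if_pos h]

theorem R1_gt (h : i < j) : R1 m n (word j i k) = sgn i j • word i j k := by
  rw [R1_word, rc_ne h.ne', if_neg h.le.not_gt, zero_smul, add_zero, sgn_symm]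

theorem R1_same : R1 m n (word i i k) = rii i • word i i k := by
  rw [R1_word, rc_same, if_neg (lt_irrefl i), zero_smul, add_zero]

theorem R2_lt (h : j < k) :
    R2 m n (word i j k) = sgn j k • word i k j + (q - q⁻¹) • word i j k := by
  rw [R2_word, rc_ne h.ne, if_pos h]

theorem R2_gt (h : j < k) : R2 m n (word i k j) = sgn j k • word i j k := by
  rw [R2_word, rc_ne h.ne', if_neg h.le.not_gt, zero_smul, add_zero, sgn_symm]

theorem R2_same : R2 m n (word i j j) = rii j • word i j j := by
  rw [R2_word, rc_same, if_neg (lt_irrefl j), zero_smul, add_zero]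

theorem brL_word (t : Kq) : brL t i j k = (word i j k - sgn j k • word i k j) -
    (sgn i j * sgn i k * t) • (word j k i - sgn j k • word k j i) := by
  unfold brL
  rw [sgn_add]
  congr 1
  · unfold lmul br
    rw [TensorProduct.tmul_sub, TensorProduct.tmul_smul, map_sub, map_smul]
    rfl
  · congr 1
    unfold rmul br
    rw [TensorProduct.sub_tmul]
    rfl

theorem brR_word (t : Kq) : brR t i j k = (word i j k - sgn i j • word j i k) -
    (sgn i k * sgn j k * t) • (word k i j - sgn i j • word k j i) := by
  unfold brR
  rw [sgn_add']
  congr 1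
  · unfold rmul br
    rw [TensorProduct.sub_tmul]
    rfl
  · congr 1
    unfold lmul br
    rw [TensorProduct.tmul_sub, TensorProduct.tmul_smul, map_sub, map_smul]
    rfl

theorem eNum_apply (w : V3 m n) : heckeRep m n eNum w =
    w - (2 : Kq)⁻¹ • (R1 m n (R2 m n w) + R1 m n w + R2 m n w + R2 m n (R1 m n w)) +
      R1 m n (R2 m n (R1 m n w)) + ((q - q⁻¹) * 2⁻¹) •
        (R1 m n w - R2 m n (R1 m n w) - R1 m n (R2 m n w) + R2 m n w) := by
  simp only [eNum, map_add, map_sub, map_smul, map_mul, map_one, heckeRep_g₁, heckeRep_g₂,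
    LinearMap.add_apply, LinearMap.sub_apply, LinearMap.smul_apply, Module.End.mul_apply,
    Module.End.one_apply]

/-- `Γ` for the first row `i j` and the second row `k`, where `i < j < k`. -/
def GamR (i j k : Fin (m + n)) : V3 m n :=
  brR (q ^ 2)⁻¹ k i j - ((-1 : Kq) ^ (par j * (par i + par k)) * q⁻¹) • brR 1 j k i

/-- `Γ` for the first row `i k` and the second row `j`, where `i < j < k`. -/
def GamL (i j k : Fin (m + n)) : V3 m n :=
  brL (q ^ 2)⁻¹ j k i - ((-1 : Kq) ^ (par j * (par i + par k)) * q⁻¹) • brL 1 k i j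

/-- For three distinct letters the image of e(q) in the given weight is spanned by two elements Γ.
This formula and `eNum_R2_word` express the images of the sorted word and of its transform by `R2`
through them. -/
theorem eNum_word (hij : i < j) (hjk : j < k) :
    heckeRep m n eNum (word i j k) =
      (sgn i k * sgn j k * (q / 2)) • GamR i j k + (sgn i j * sgn i k * (q / 2)) • GamL i j k := by
  have q0 := q_ne_zero
  have hik := hij.trans hjk
  simp only [GamR, GamL, sgn_add, brR_word, brL_word, eNum_apply, map_add, map_smul, R1_lt hij,
    R1_lt hik, R1_lt hjk, R1_gt hij, R1_gt hik, R1_gt hjk, R2_lt hij, R2_lt hik, R2_lt hjk,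
    R2_gt hij, R2_gt hik, R2_gt hjk, sgn_symm j i, sgn_symm k i, sgn_symm k j]
  -- Signs square to 1, which ring normalization does not know; replacing them by ±1 leaves rational
  -- identities in q.
  rcases sgn_eq i j with h₁ | h₁ <;> rcases sgn_eq i k with h₂ | h₂ <;>
    rcases sgn_eq j k with h₃ | h₃ <;> rw [h₁, h₂, h₃] <;>
    match_scalars <;> field_simp <;> ring

/-- The combination is chosen to eliminate `GamL`. The system made of this and `eNum_word` is thus
triangular, with pivots (q² - q + 1)/2 and q/2 up to sign, and can be solved for `GamR` and then
`GamL`. -/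
theorem eNum_R2_word (hij : i < j) (hjk : j < k) :
    heckeRep m n eNum (R2 m n (word i j k)) = (q - 1) • heckeRep m n eNum (word i j k) -
      (sgn i k * sgn j k * ((q ^ 2 - q + 1) / 2)) • GamR i j k := by
  have q0 := q_ne_zero
  have hik := hij.trans hjk
  simp only [GamR, sgn_add, brR_word, eNum_apply, map_add, map_smul, R1_lt hij, R1_lt hik,
    R1_lt hjk, R1_gt hij, R1_gt hik, R1_gt hjk, R2_lt hij, R2_lt hik, R2_lt hjk, R2_gt hij,
    R2_gt hik, R2_gt hjk, sgn_symm j i, sgn_symm k i, sgn_symm k j]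
  rcases sgn_eq i j with h₁ | h₁ <;> rcases sgn_eq i k with h₂ | h₂ <;>
    rcases sgn_eq j k with h₃ | h₃ <;> rw [h₁, h₂, h₃] <;>
    match_scalars <;> field_simp <;> ring

theorem eNum_word_iij_even (hij : i < j) (hi : par i = 0) :
    heckeRep m n eNum (word i i j) = (-(q ^ 2 - q + 1) / (2 * q)) • brR q⁻¹ i j i := by
  have q0 := q_ne_zero
  have h₁ : sgn i j = 1 := by rw [sgn, hi, zero_mul, pow_zero]
  have h₂ : sgn i i = 1 := by rw [sgn, hi, zero_mul, pow_zero]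
  have h₃ : rii i = q := by rw [rii, if_pos hi]
  simp only [brR_word, eNum_apply, map_add, map_smul, R1_lt hij, R1_gt hij, R2_lt hij, R2_gt hij,
    R1_same, R2_same, sgn_symm j i, h₁, h₂, h₃]
  match_scalars <;> field_simp <;> ring

theorem eNum_word_iij_odd (hij : i < j) (hi : par i = 1) :
    heckeRep m n eNum (word i i j) = ((q ^ 2 + q + 1) / 2) • brL q⁻¹ i i j := by
  have q0 := q_ne_zero
  have h₂ : sgn i i = -1 := by rw [sgn, hi, one_mul, pow_one]
  have h₃ : rii i = -q⁻¹ := by rw [rii, if_neg (by rw [hi]; exact one_ne_zero)]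
  simp only [brL_word, eNum_apply, map_add, map_smul, R1_lt hij, R1_gt hij, R2_lt hij, R2_gt hij,
    R1_same, R2_same, sgn_symm j i, h₂, h₃]
  rcases sgn_eq i j with h₁ | h₁ <;> rw [h₁] <;>
    match_scalars <;> field_simp <;> ring

theorem eNum_word_ijj_even (hij : i < j) (hj : par j = 0) :
    heckeRep m n eNum (word i j j) = (-(q ^ 2 - q + 1) / (2 * q)) • brL q⁻¹ j i j := by
  have q0 := q_ne_zero
  have h₁ : sgn i j = 1 := by rw [sgn, hj, mul_zero, pow_zero]
  have h₂ : sgn j j = 1 := by rw [sgn, hj, zero_mul, pow_zero]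
  have h₃ : rii j = q := by rw [rii, if_pos hj]
  simp only [brL_word, eNum_apply, map_add, map_smul, R1_lt hij, R1_gt hij, R2_lt hij, R2_gt hij,
    R1_same, R2_same, sgn_symm j i, h₁, h₂, h₃]
  match_scalars <;> field_simp <;> ring

theorem eNum_word_ijj_odd (hij : i < j) (hj : par j = 1) :
    heckeRep m n eNum (word i j j) = ((q ^ 2 + q + 1) / 2) • brR q⁻¹ i j j := by
  have q0 := q_ne_zero
  have h₂ : sgn j j = -1 := by rw [sgn, hj, one_mul, pow_one]
  have h₃ : rii j = -q⁻¹ := by rw [rii, if_neg (by rw [hj]; exact one_ne_zero)]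
  simp only [brR_word, eNum_apply, map_add, map_smul, R1_lt hij, R1_gt hij, R2_lt hij, R2_gt hij,
    R1_same, R2_same, sgn_symm j i, h₂, h₃]
  rcases sgn_eq i j with h₁ | h₁ <;> rw [h₁] <;>
    match_scalars <;> field_simp <;> ring

/-- On this word g₁ and g₂ act by one common eigenvalue, q or -q⁻¹. The word therefore spans a
one-dimensional representation of H₃(q), in which an idempotent of type (2,1) vanishes. -/
theorem eNum_word_iii : heckeRep m n eNum (word i i i) = 0 := by
  have q0 := q_ne_zero
  simp only [eNum_apply, map_smul, R1_same, R2_same]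
  rcases par_cases i with h | h
  · have h₃ : rii i = q := by rw [rii, if_pos h]
    rw [h₃]
    match_scalars
    field_simp
    ring
  · have h₃ : rii i = -q⁻¹ := by rw [rii, if_neg (by rw [h]; exact one_ne_zero)]
    rw [h₃]
    match_scalars
    field_simp
    ring

end Words

section GamBasis

variable {m n : ℕ}

/-! ### The elements `Γ` span the image of `e(q)` -/

/-- The nested conditionals of `Gam` are resolved together with the strict inequalities and parities
that semistandardness supplies in each case, in the form required by the formulas for `eNum` on
words. -/
theorem Gam_cases (T : Tableau21 m n) :
    (T.x < T.y ∧ T.y < T.z ∧ Gam T = GamR T.x T.y T.z) ∨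
    (T.x < T.z ∧ T.z < T.y ∧ Gam T = GamL T.x T.z T.y) ∨
    (T.x = T.y ∧ T.x < T.z ∧ par T.x = 0 ∧ Gam T = brR q⁻¹ T.x T.z T.x) ∨
    (T.x = T.z ∧ T.x < T.y ∧ par T.x = 1 ∧ Gam T = brL q⁻¹ T.x T.x T.y) ∨
    (T.y = T.z ∧ T.x < T.y ∧ par T.y = 0 ∧ Gam T = brL q⁻¹ T.y T.x T.y) ∨
    (T.y = T.z ∧ T.x < T.y ∧ par T.y = 1 ∧ Gam T = brR q⁻¹ T.x T.y T.y) := by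
  obtain ⟨x, y, z, row, col⟩ := T
  simp only [Gam]
  rcases eq_or_ne x y with h₁ | h₁
  · subst h₁
    have hp : par x = 0 := by simpa using row
    have hz : x < z := by simpa [hp] using col
    simp [hp, hz]
  · have hxy : x < y := by simpa [h₁] using row
    rcases eq_or_ne x z with h₂ | h₂
    · subst h₂
      have hp : par x = 1 := by simpa using col
      simp [h₁, hp, hxy]
    · have hxz : x < z := by simpa [h₂] using col
      rcases eq_or_ne y z with h₃ | h₃
      · subst h₃
        rcases par_cases y with hp | hp <;> simp [h₁, hp, hxy]
      · rcases lt_or_gt_of_ne h₃ with h₄ | h₄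
        · simp [h₁, h₂, h₃, h₄, hxy, GamR]
        · simp [h₁, h₂, h₃, h₄, h₄.le, hxz, GamL]

theorem Gam_eq_GamR {i j k : Fin (m + n)} (hij : i < j) (hjk : j < k) :
    Gam ⟨i, j, k, .inl hij, .inl (hij.trans hjk)⟩ = GamR i j k := by
  simp [Gam, GamR, hij.ne, (hij.trans hjk).ne, hjk.ne, hjk]

theorem Gam_eq_GamL {i j k : Fin (m + n)} (hij : i < j) (hjk : j < k) :
    Gam ⟨i, k, j, .inl (hij.trans hjk), .inl hij⟩ = GamL i j k := by
  simp [Gam, GamL, hij.ne, (hij.trans hjk).ne, hjk.ne', hjk.le]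

theorem Gam_iij_even {i j : Fin (m + n)} (hij : i < j) (hi : par i = 0) :
    Gam ⟨i, i, j, .inr ⟨rfl, hi⟩, .inl hij⟩ = brR q⁻¹ i j i := by
  simp [Gam]

theorem Gam_iij_odd {i j : Fin (m + n)} (hij : i < j) (hi : par i = 1) :
    Gam ⟨i, j, i, .inl hij, .inr ⟨rfl, hi⟩⟩ = brL q⁻¹ i i j := by
  simp [Gam, hij.ne]

theorem Gam_ijj_even {i j : Fin (m + n)} (hij : i < j) (hj : par j = 0) :
    Gam ⟨i, j, j, .inl hij, .inl hij⟩ = brL q⁻¹ j i j := by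
  simp [Gam, hij.ne, hj]

theorem Gam_ijj_odd {i j : Fin (m + n)} (hij : i < j) (hj : par j = 1) :
    Gam ⟨i, j, j, .inl hij, .inl hij⟩ = brR q⁻¹ i j j := by
  simp [Gam, hij.ne, hj]

theorem sgn_ne_zero (i j : Fin (m + n)) : sgn i j ≠ 0 := left_ne_zero_of_mul_eq_one (sgn_sq i j)

/-- A subspace stable under the `R`-matrices that contains all sorted words is everything. -/
theorem eq_top_of_sorted_words (Q : Submodule Kq (V3 m n))
    (h₁ : ∀ w ∈ Q, R1 m n w ∈ Q) (h₂ : ∀ w ∈ Q, R2 m n w ∈ Q)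
    (h : ∀ i j k : Fin (m + n), i ≤ j → j ≤ k → word i j k ∈ Q) : Q = ⊤ := by
  have s₁ : ∀ i j k : Fin (m + n), i ≤ j → word i j k ∈ Q → word j i k ∈ Q := by
    intro i j k hij hw
    rcases hij.eq_or_lt with rfl | hij
    · exact hw
    · have := Q.sub_mem (h₁ _ hw) (Q.smul_mem (q - q⁻¹) hw)
      rw [R1_lt hij, add_sub_cancel_right] at this
      exact (Q.smul_mem_iff (sgn_ne_zero i j)).1 this
  have s₂ : ∀ i j k : Fin (m + n), j ≤ k → word i j k ∈ Q → word i k j ∈ Q := by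
    intro i j k hjk hw
    rcases hjk.eq_or_lt with rfl | hjk
    · exact hw
    · have := Q.sub_mem (h₂ _ hw) (Q.smul_mem (q - q⁻¹) hw)
      rw [R2_lt hjk, add_sub_cancel_right] at this
      exact (Q.smul_mem_iff (sgn_ne_zero j k)).1 this
  have key : ∀ i j k : Fin (m + n), word i j k ∈ Q := by
    intro i j k
    rcases le_total i j with hij | hij <;> rcases le_total j k with hjk | hjk <;>
      rcases le_total i k with hik | hik
    · exact h _ _ _ hij hjk
    · exact h _ _ _ hij hjk
    · exact s₂ _ _ _ hjk (h _ _ _ hik hjk)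
    · exact s₂ _ _ _ hjk (s₁ _ _ _ hik (h _ _ _ hik hij))
    · exact s₁ _ _ _ hij (h _ _ _ hij hik)
    · exact s₁ _ _ _ hij (s₂ _ _ _ hik (h _ _ _ hjk hik))
    · exact s₁ _ _ _ hij (s₂ _ _ _ (hjk.trans hij) (s₁ _ _ _ hjk (h _ _ _ hjk hij)))
    · exact s₁ _ _ _ hij (s₂ _ _ _ (hjk.trans hij) (s₁ _ _ _ hjk (h _ _ _ hjk hij)))
  rw [← Submodule.ker_mkQ Q]
  exact LinearMap.ker_eq_top.2 (ext_word fun i j k => by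
    rw [LinearMap.zero_apply, Submodule.mkQ_apply, Submodule.Quotient.mk_eq_zero]
    exact key i j k)

/-- The span of the elements `Γ`. -/
def gamSpan (m n : ℕ) : Submodule Kq (V3 m n) := Submodule.span Kq (Set.range Gam)

theorem Gam_mem (T : Tableau21 m n) : Gam T ∈ gamSpan m n := Submodule.subset_span ⟨T, rfl⟩

/-- Asking for E w alone would not give a stable condition; adding E g₂ w does, because `eNum` and
`eNum * g₂` span a right ideal. Sorted words then suffice. -/
theorem eNum_mem_gamSpan (w : V3 m n) : heckeRep m n eNum w ∈ gamSpan m n := by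
  set U := gamSpan m n with hU
  set E := heckeRep m n eNum with hE
  have e₁ : ∀ w, E (R1 m n w) = (q - q⁻¹ - 1) • E w - E (R2 m n w) := fun w => by
    rw [hE, ← heckeRep_g₁, ← heckeRep_mul_apply, eNum_mul_g₁, map_sub, map_smul,
      LinearMap.sub_apply, heckeRep_mul_apply, heckeRep_g₂]
    rfl
  have e₂ : ∀ w, E (R2 m n (R1 m n w)) = E (R2 m n w) - (q - q⁻¹) • E w := fun w => by
    rw [hE, ← heckeRep_g₁, ← heckeRep_g₂, ← heckeRep_mul_apply, ← heckeRep_mul_apply,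
      mul_assoc, eNum_mul_g₂g₁, map_sub, map_smul, LinearMap.sub_apply, heckeRep_mul_apply]
    rfl
  have e₃ : ∀ w, R2 m n (R2 m n w) = w + (q - q⁻¹) • R2 m n w := fun w =>
    LinearMap.congr_fun (R2_sq m n) w
  have main : U.comap E ⊓ U.comap (E ∘ₗ R2 m n) = ⊤ := by
    refine eq_top_of_sorted_words _ ?_ ?_ ?_
    · rintro w ⟨ha, hb⟩
      have ha : E w ∈ U := ha
      have hb : E (R2 m n w) ∈ U := hb
      refine ⟨?_, ?_⟩
      · show E (R1 m n w) ∈ U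
        rw [e₁]
        exact U.sub_mem (U.smul_mem _ ha) hb
      · show E (R2 m n (R1 m n w)) ∈ U
        rw [e₂]
        exact U.sub_mem hb (U.smul_mem _ ha)
    · rintro w ⟨ha, hb⟩
      have ha : E w ∈ U := ha
      have hb : E (R2 m n w) ∈ U := hb
      refine ⟨hb, ?_⟩
      show E (R2 m n (R2 m n w)) ∈ U
      rw [e₃, map_add, map_smul]
      exact U.add_mem ha (U.smul_mem _ hb)
    · intro i j k hij hjk
      rcases hij.eq_or_lt with rfl | hij
      · have hw : E (word i i k) ∈ U := by
          rcases hjk.eq_or_lt with rfl | hjk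
          · rw [hE, eNum_word_iii]
            exact U.zero_mem
          · rcases par_cases i with hp | hp
            · rw [hE, eNum_word_iij_even hjk hp, ← Gam_iij_even hjk hp]
              exact U.smul_mem _ (Gam_mem _)
            · rw [hE, eNum_word_iij_odd hjk hp, ← Gam_iij_odd hjk hp]
              exact U.smul_mem _ (Gam_mem _)
        refine ⟨hw, ?_⟩
        show E (R2 m n (word i i k)) ∈ U
        -- `R1` is a scalar on this word, so the relation `e₁` can be solved for E(R2 w) as a
        -- multiple of E w.
        have := e₁ (word i i k)
        rw [R1_same, map_smul, eq_sub_iff_add_eq, add_comm, ← eq_sub_iff_add_eq] at this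
        rw [this]
        exact U.sub_mem (U.smul_mem _ hw) (U.smul_mem _ hw)
      · rcases hjk.eq_or_lt with rfl | hjk
        · have hw : E (word i j j) ∈ U := by
            rcases par_cases j with hp | hp
            · rw [hE, eNum_word_ijj_even hij hp, ← Gam_ijj_even hij hp]
              exact U.smul_mem _ (Gam_mem _)
            · rw [hE, eNum_word_ijj_odd hij hp, ← Gam_ijj_odd hij hp]
              exact U.smul_mem _ (Gam_mem _)
          refine ⟨hw, ?_⟩
          show E (R2 m n (word i j j)) ∈ U
          rw [R2_same, map_smul]
          exact U.smul_mem _ hw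
        · have hR : GamR i j k ∈ U := by
            rw [← Gam_eq_GamR hij hjk]
            exact Gam_mem _
          have hL : GamL i j k ∈ U := by
            rw [← Gam_eq_GamL hij hjk]
            exact Gam_mem _
          have hw : E (word i j k) ∈ U := by
            rw [hE, eNum_word hij hjk]
            exact U.add_mem (U.smul_mem _ hR) (U.smul_mem _ hL)
          refine ⟨hw, ?_⟩
          show E (R2 m n (word i j k)) ∈ U
          rw [hE, eNum_R2_word hij hjk]
          exact U.sub_mem (U.smul_mem _ hw) (U.smul_mem _ hR)
  have : w ∈ U.comap E ⊓ U.comap (E ∘ₗ R2 m n) := by rw [main]; trivial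
  exact this.1

/-- The formulas for `eNum` on sorted words are read backwards, their coefficients being nonzero. -/
theorem Gam_mem_range (T : Tableau21 m n) : Gam T ∈ LinearMap.range (heckeRep m n eNum) := by
  have q0 := q_ne_zero
  set W := LinearMap.range (heckeRep m n eNum) with hW
  have hE : ∀ w, heckeRep m n eNum w ∈ W := fun w => ⟨w, rfl⟩
  have c₁ : (q ^ 2 + q + 1) / 2 ≠ 0 := div_ne_zero q_pos_ne_zero two_ne_zero
  have c₂ : -(q ^ 2 - q + 1) / (2 * q) ≠ 0 :=
    div_ne_zero (neg_ne_zero.2 q_neg_ne_zero) (mul_ne_zero two_ne_zero q0)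
  have hR : ∀ {i j k : Fin (m + n)}, i < j → j < k → GamR i j k ∈ W := fun {i j k} hij hjk => by
    have h := W.sub_mem (W.smul_mem (q - 1) (hE (word i j k))) (hE (R2 m n (word i j k)))
    rw [eNum_R2_word hij hjk, sub_sub_cancel] at h
    exact (W.smul_mem_iff (mul_ne_zero (mul_ne_zero (sgn_ne_zero _ _) (sgn_ne_zero _ _))
      (div_ne_zero q_neg_ne_zero two_ne_zero))).1 h
  rcases Gam_cases T with ⟨h₁, h₂, h⟩ | ⟨h₁, h₂, h⟩ | ⟨-, h₁, h₂, h⟩ | ⟨-, h₁, h₂, h⟩ |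
    ⟨-, h₁, h₂, h⟩ | ⟨-, h₁, h₂, h⟩ <;> rw [h]
  · exact hR h₁ h₂
  · have h := hE (word T.x T.z T.y)
    -- `GamR` is already known to lie in the range, so `eNum_word` leaves a nonzero multiple of
    -- `GamL`.
    rw [eNum_word h₁ h₂, W.add_mem_iff_right (W.smul_mem _ (hR h₁ h₂))] at h
    exact (W.smul_mem_iff (mul_ne_zero (mul_ne_zero (sgn_ne_zero _ _) (sgn_ne_zero _ _))
      (div_ne_zero q0 two_ne_zero))).1 h
  · exact (W.smul_mem_iff c₂).1 (eNum_word_iij_even h₁ h₂ ▸ hE (word T.x T.x T.z))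
  · exact (W.smul_mem_iff c₁).1 (eNum_word_iij_odd h₁ h₂ ▸ hE (word T.x T.x T.y))
  · exact (W.smul_mem_iff c₂).1 (eNum_word_ijj_even h₁ h₂ ▸ hE (word T.x T.y T.y))
  · exact (W.smul_mem_iff c₁).1 (eNum_word_ijj_odd h₁ h₂ ▸ hE (word T.x T.y T.y))

theorem eIdem_eNum : eIdem * eNum = eNum := by
  rw [eIdem_eq, smul_mul_assoc, eNum_sq, smul_smul, inv_mul_cancel₀ three_q_ne_zero, one_smul]

/-- An idempotent fixes its image. Hence the class of e(q) ⊗ Γ in I₃(V) is mapped to Γ itself. -/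
theorem eIdem_Gam (T : Tableau21 m n) : heckeRep m n eIdem (Gam T) = Gam T := by
  obtain ⟨w, hw⟩ := Gam_mem_range T
  rw [← hw, ← heckeRep_mul_apply, eIdem_eNum]

theorem eIdem_mem_gamSpan (w : V3 m n) : heckeRep m n eIdem w ∈ gamSpan m n := by
  rw [eIdem_eq, heckeRep_smul_apply]
  exact Submodule.smul_mem _ _ (eNum_mem_gamSpan w)

end GamBasis

section Independence

variable {m n : ℕ}

/-! ### The elements `Γ` are linearly independent -/

/-- The basis of words of `V ⊗ V ⊗ V`. -/
def wordBasis (m n : ℕ) :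
    Module.Basis ((Fin (m + n) × Fin (m + n)) × Fin (m + n)) Kq (V3 m n) :=
  ((aBasis m n).tensorProduct (aBasis m n)).tensorProduct (aBasis m n)

theorem wordBasis_apply (i j k : Fin (m + n)) : wordBasis m n ((i, j), k) = word i j k := by
  have : ((aBasis m n).tensorProduct (aBasis m n)).tensorProduct (aBasis m n) ((i, j), k) =
      (a i ⊗ₜ[Kq] a j) ⊗ₜ[Kq] a k := by
    rw [Module.Basis.tensorProduct_apply, Module.Basis.tensorProduct_apply, aBasis_apply,
      aBasis_apply, aBasis_apply]
  exact this

/-- A linear map sending each `Γ` to a multiple of the reading word of its tableau. -/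
def reading (m n : ℕ) : V3 m n →ₗ[Kq] V3 m n :=
  (wordBasis m n).constr Kq fun p =>
    -- Of the six arrangements of i < j < k, only ijk, ikj and jik have nonzero image. The value on
    -- ijk is the correction that cancels the cross terms: `GamR` keeps only the word ijk and `GamL`
    -- only the word ikj, both with coefficient ±(q² + q + 1)/q².
    if p.1.1 < p.1.2 ∧ p.1.2 < p.2 then
      -q⁻¹ • (sgn p.1.2 p.2 • word p.1.1 p.1.2 p.2 + sgn p.1.1 p.1.2 • word p.1.1 p.2 p.1.2)
    else if p.1.1 < p.2 ∧ p.2 < p.1.2 then word p.1.1 p.2 p.1.2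
    else if p.1.2 < p.1.1 ∧ p.1.1 < p.2 then word p.1.2 p.2 p.1.1
    else if p.1.1 = p.1.2 ∧ p.1.1 < p.2 then
      if par p.1.1 = 0 then word p.1.1 p.1.1 p.2 else word p.1.1 p.2 p.1.1
    else if p.1.2 = p.2 ∧ p.1.1 < p.1.2 then word p.1.1 p.1.2 p.1.2
    else 0

theorem reading_word (i j k : Fin (m + n)) : reading m n (word i j k) =
    if i < j ∧ j < k then -q⁻¹ • (sgn j k • word i j k + sgn i j • word i k j)
    else if i < k ∧ k < j then word i k j
    else if j < i ∧ i < k then word j k i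
    else if i = j ∧ i < k then if par i = 0 then word i i k else word i k i
    else if j = k ∧ i < j then word i j j
    else 0 := by
  rw [← wordBasis_apply i j k, reading, Module.Basis.constr_basis]
  simp only [wordBasis_apply]

theorem reading_GamR {i j k : Fin (m + n)} (hij : i < j) (hjk : j < k) :
    reading m n (GamR i j k) = (-sgn i k * ((q ^ 2 + q + 1) / q ^ 2)) • word i j k := by
  have q0 := q_ne_zero
  have hik := hij.trans hjk
  simp only [GamR, sgn_add, brR_word, map_sub, map_smul, reading_word, hij, hjk, hik, hij.not_gt,
    hjk.not_gt, hik.not_gt, hij.ne, hij.ne', hik.ne, hik.ne', hjk.ne, hjk.ne', and_true, true_and,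
    and_false, false_and, if_true, if_false, sgn_symm j i, sgn_symm k i, sgn_symm k j]
  rcases sgn_eq i j with h₁ | h₁ <;> rcases sgn_eq i k with h₂ | h₂ <;>
    rcases sgn_eq j k with h₃ | h₃ <;> rw [h₁, h₂, h₃] <;>
    match_scalars <;> field_simp <;> ring

theorem reading_GamL {i j k : Fin (m + n)} (hij : i < j) (hjk : j < k) :
    reading m n (GamL i j k) = (-sgn i k * ((q ^ 2 + q + 1) / q ^ 2)) • word i k j := by
  have q0 := q_ne_zero
  have hik := hij.trans hjk
  simp only [GamL, sgn_add, brL_word, map_sub, map_smul, reading_word, hij, hjk, hik, hij.not_gt,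
    hjk.not_gt, hik.not_gt, hij.ne, hij.ne', hik.ne, hik.ne', hjk.ne, hjk.ne', and_true, true_and,
    and_false, false_and, if_true, if_false, sgn_symm j i, sgn_symm k i, sgn_symm k j]
  rcases sgn_eq i j with h₁ | h₁ <;> rcases sgn_eq i k with h₂ | h₂ <;>
    rcases sgn_eq j k with h₃ | h₃ <;> rw [h₁, h₂, h₃] <;>
    match_scalars <;> field_simp <;> ring

theorem reading_Gam (T : Tableau21 m n) :
    ∃ c : Kqˣ, reading m n (Gam T) = c • word T.x T.y T.z := by
  have q0 := q_ne_zero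
  suffices h : ∃ c : Kq, c ≠ 0 ∧ reading m n (Gam T) = c • word T.x T.y T.z by
    obtain ⟨c, hc, h⟩ := h
    exact ⟨Units.mk0 c hc, h⟩
  have c₁ : ∀ i j : Fin (m + n), -sgn i j * ((q ^ 2 + q + 1) / q ^ 2) ≠ 0 := fun i j =>
    mul_ne_zero (neg_ne_zero.2 (sgn_ne_zero i j)) (div_ne_zero q_pos_ne_zero (pow_ne_zero 2 q0))
  have s₀ : ∀ i j : Fin (m + n), par i = 0 → sgn i j = 1 := fun i j hi => by
    rw [sgn, hi, zero_mul, pow_zero]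
  rcases Gam_cases T with ⟨h₁, h₂, h⟩ | ⟨h₁, h₂, h⟩ | ⟨h₀, h₁, h₂, h⟩ | ⟨h₀, h₁, h₂, h⟩ |
    ⟨h₀, h₁, h₂, h⟩ | ⟨h₀, h₁, h₂, h⟩ <;> rw [h]
  · exact ⟨_, c₁ _ _, reading_GamR h₁ h₂⟩
  · exact ⟨_, c₁ _ _, reading_GamL h₁ h₂⟩
  · refine ⟨-q⁻¹, neg_ne_zero.2 (inv_ne_zero q0), ?_⟩
    rw [← h₀]
    simp only [brR_word, map_sub, map_smul, reading_word, h₁, h₁.not_gt, h₁.ne, h₁.ne', lt_irrefl,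
      and_true, true_and, and_false, false_and, if_true, if_false, h₂, sgn_symm T.z T.x, s₀ _ _ h₂]
    module
  · refine ⟨1, one_ne_zero, ?_⟩
    rw [← h₀]
    have h₃ : par T.x ≠ 0 := by rw [h₂]; exact one_ne_zero
    simp only [brL_word, map_sub, map_smul, reading_word, h₁, h₁.not_gt, h₁.ne, h₁.ne', lt_irrefl,
      and_true, true_and, and_false, false_and, if_true, if_false, h₃]
    module
  · refine ⟨-q⁻¹, neg_ne_zero.2 (inv_ne_zero q0), ?_⟩
    rw [← h₀]
    simp only [brL_word, map_sub, map_smul, reading_word, h₁, h₁.not_gt, h₁.ne, h₁.ne', lt_irrefl,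
      and_true, true_and, and_false, false_and, if_true, if_false, h₂, s₀ _ _ h₂]
    module
  · refine ⟨1, one_ne_zero, ?_⟩
    rw [← h₀]
    simp only [brR_word, map_sub, map_smul, reading_word, h₁, h₁.not_gt, h₁.ne, h₁.ne', lt_irrefl,
      and_true, true_and, and_false, false_and, if_true, if_false]
    module

/-- Under `reading` the family becomes nonzero multiples of distinct basis words, and independence
of the images implies that of the family. -/
theorem Gam_linearIndependent : LinearIndependent Kq (Gam : Tableau21 m n → V3 m n) := by
  choose c hc using fun T : Tableau21 m n => reading_Gam T
  refine LinearIndependent.of_comp (reading m n) ?_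
  have h : LinearIndependent Kq (fun T : Tableau21 m n => word T.x T.y T.z) := by
    have := (wordBasis m n).linearIndependent.comp
      (fun T : Tableau21 m n => ((T.x, T.y), T.z)) (fun S T h => by
        simp only [Prod.mk.injEq] at h
        exact Tableau21.ext h.1.1 h.1.2 h.2)
    convert this using 1
    exact funext fun T => (wordBasis_apply _ _ _).symm
  have h' := h.units_smul c
  convert h' using 1
  exact funext hc

theorem toTensor_idealGen (w : V3 m n) :
    toTensor m n idealI3 (QSchur.mkLin m n (idealGen eIdem) w) = heckeRep m n eIdem w := rfl

theorem eIdem_one_eIdem : eIdem * 1 * eIdem = eIdem := by rw [mul_one, eIdem_sq]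

/-- The basis of `I₃(V)` sent to the elements `Γ`. -/
def gamBasis (m n : ℕ) : Module.Basis (Tableau21 m n) Kq (I3V m n) :=
  Module.Basis.mk (v := fun T => QSchur.mkLin m n (idealGen eIdem) (Gam T))
    (LinearIndependent.of_comp (toTensorLin m n idealI3) (by
      convert Gam_linearIndependent (m := m) (n := n) using 1
      exact funext eIdem_Gam))
    (fun z _ => by
      -- Every z is e(q) ⊗ v with v its image in V⊗V⊗V, and v lies in the span of the Γ; applying v
      -- ↦ e(q) ⊗ v to that span gives generation.
      have hz : QSchur.mkLin m n (idealGen eIdem) (toTensor m n idealI3 z) = z := by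
        have := mk_toTensor m n eIdem_one_eIdem z
        rwa [map_one] at this
      rw [← hz]
      have hw : toTensor m n idealI3 z ∈ gamSpan m n := by
        rw [← hz, toTensor_idealGen]
        exact eIdem_mem_gamSpan _
      have := Submodule.mem_map_of_mem (f := QSchur.mkLin m n (idealGen eIdem)) hw
      rw [gamSpan, Submodule.map_span, ← Set.range_comp] at this
      exact this)

theorem toTensor_gamBasis (T : Tableau21 m n) :
    toTensor m n idealI3 (gamBasis m n T) = Gam T :=
  (congrArg (toTensor m n idealI3) (Module.Basis.mk_apply _ _ T)).trans (eIdem_Gam T)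

end Independence

section Action

variable {m n : ℕ}

/-! ### The action of the generators on words -/

/-- The sign and eigenvalue operators in the formulas for `eᵢ` and `fᵢ`. -/
def skew (i : Fin (m + n - 1)) (p : Fin (m + n)) : Kq := (-1) ^ (par p * rpar i)

/-- The coproduct applied twice: eᵢ acts on one letter at a time, with kᵢ⁻¹ on the letters to its
right and a parity sign from the letters to its left. -/
theorem V3_e_word (i : Fin (m + n - 1)) (p r s : Fin (m + n)) :
    (V3Rep m n).ρ (ug (.e i)) (word p r s) =
      (if hi i = p then (kval i r)⁻¹ * (kval i s)⁻¹ else 0) • word (lo i) r s +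
      (if hi i = r then skew i p * (kval i s)⁻¹ else 0) • word p (lo i) s +
      (if hi i = s then skew i p * skew i r else 0) • word p r (lo i) := by
  -- The computation is done in the iterated tensor product to which `V3` unfolds, where the rules
  -- for pure tensors apply.
  have h : ((vecRep m n).tensor (vecRep m n)).tensorGen (vecRep m n) (.e i)
      ((a p ⊗ₜ[Kq] a r) ⊗ₜ[Kq] a s) =
      (if hi i = p then (kval i r)⁻¹ * (kval i s)⁻¹ else 0) •
        ((a (lo i) ⊗ₜ[Kq] a r) ⊗ₜ[Kq] a s) +
      (if hi i = r then skew i p * (kval i s)⁻¹ else 0) •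
        ((a p ⊗ₜ[Kq] a (lo i)) ⊗ₜ[Kq] a s) +
      (if hi i = s then skew i p * skew i r else 0) •
        ((a p ⊗ₜ[Kq] a r) ⊗ₜ[Kq] a (lo i)) := by
    simp only [SuperRep.tensorGen, LinearMap.add_apply, TensorProduct.map_tmul, T_e, T_s, V2_e,
      vec_e, vec_kinv, vec_s, diag_a, unit_a, skew, V2_diag]
    split_ifs <;> simp only [TensorProduct.tmul_smul, ← TensorProduct.smul_tmul',
      TensorProduct.zero_tmul, TensorProduct.tmul_zero, smul_zero, zero_smul, one_smul,
      TensorProduct.add_tmul, smul_smul, zero_add, add_zero, smul_add] <;> module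
  rw [V3_ρ]
  exact h

/-- For fᵢ both the sign and the eigenvalue of kᵢ come from the letters to the left. -/
theorem V3_f_word (i : Fin (m + n - 1)) (p r s : Fin (m + n)) :
    (V3Rep m n).ρ (ug (.f i)) (word p r s) =
      (if lo i = p then 1 else 0 : Kq) • word (hi i) r s +
      (if lo i = r then skew i p * kval i p else 0) • word p (hi i) s +
      (if lo i = s then skew i p * skew i r * (kval i p * kval i r) else 0) •
        word p r (hi i) := by
  have h : ((vecRep m n).tensor (vecRep m n)).tensorGen (vecRep m n) (.f i)
      ((a p ⊗ₜ[Kq] a r) ⊗ₜ[Kq] a s) =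
      (if lo i = p then 1 else 0 : Kq) • ((a (hi i) ⊗ₜ[Kq] a r) ⊗ₜ[Kq] a s) +
      (if lo i = r then skew i p * kval i p else 0) •
        ((a p ⊗ₜ[Kq] a (hi i)) ⊗ₜ[Kq] a s) +
      (if lo i = s then skew i p * skew i r * (kval i p * kval i r) else 0) •
        ((a p ⊗ₜ[Kq] a r) ⊗ₜ[Kq] a (hi i)) := by
    simp only [SuperRep.tensorGen, LinearMap.add_apply, TensorProduct.map_tmul, T_f, T_s, T_k,
      V2_f, vec_f, vec_k, vec_s, diag_a, unit_a, skew, V2_diag, Module.End.mul_apply,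
      Module.End.one_apply, map_smul]
    split_ifs <;> simp only [TensorProduct.tmul_smul, ← TensorProduct.smul_tmul',
      TensorProduct.zero_tmul, TensorProduct.tmul_zero, smul_zero, zero_smul, one_smul,
      TensorProduct.add_tmul, smul_smul, zero_add, add_zero, smul_add] <;> module
  rw [V3_ρ]
  exact h

/-- The multiplicity of a letter in a word of length three. -/
def cnt (p r s j : Fin (m + n)) : ℕ :=
  (if p = j then 1 else 0) + (if r = j then 1 else 0) + (if s = j then 1 else 0)

theorem V3_K_word (j p r s : Fin (m + n)) :
    (V3Rep m n).ρ (ug (.K j)) (word p r s) = q ^ cnt p r s j • word p r s := by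
  have h : ((vecRep m n).tensor (vecRep m n)).tensorGen (vecRep m n) (.K j)
      ((a p ⊗ₜ[Kq] a r) ⊗ₜ[Kq] a s) = q ^ cnt p r s j • ((a p ⊗ₜ[Kq] a r) ⊗ₜ[Kq] a s) := by
    have hK : (vecRep m n).K j = diag fun l => if l = j then q else 1 := vecRep_ρ m n _
    simp only [SuperRep.tensorGen, TensorProduct.map_tmul, T_K, hK, diag_a, V2_diag,
      TensorProduct.tmul_smul, ← TensorProduct.smul_tmul', smul_smul, cnt]
    congr 1
    split_ifs <;> ring
  rw [V3_ρ]
  exact h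

/-- A bracket is a combination of rearrangements of its three letters, and the eigenvalue of `K j`
on a word depends only on multiplicities. -/
theorem brL_mem_eigenspace {j p r s : Fin (m + n)} {c : ℕ} (t : Kq) (h : cnt p r s j = c) :
    brL t p r s ∈ ((V3Rep m n).ρ (ug (.K j))).eigenspace (q ^ c) := by
  set S := ((V3Rep m n).ρ (ug (.K j))).eigenspace (q ^ c)
  have hw : ∀ {x y z : Fin (m + n)}, cnt x y z j = c → word x y z ∈ S := fun h =>
    Module.End.mem_eigenspace_iff.2 (by rw [V3_K_word, h])
  have h₁ : cnt p s r j = c := by rw [← h]; unfold cnt; ring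
  have h₂ : cnt r s p j = c := by rw [← h]; unfold cnt; ring
  have h₃ : cnt s r p j = c := by rw [← h]; unfold cnt; ring
  rw [brL_word]
  exact S.sub_mem (S.sub_mem (hw h) (S.smul_mem _ (hw h₁)))
    (S.smul_mem _ (S.sub_mem (hw h₂) (S.smul_mem _ (hw h₃))))

theorem brR_mem_eigenspace {j p r s : Fin (m + n)} {c : ℕ} (t : Kq) (h : cnt p r s j = c) :
    brR t p r s ∈ ((V3Rep m n).ρ (ug (.K j))).eigenspace (q ^ c) := by
  set S := ((V3Rep m n).ρ (ug (.K j))).eigenspace (q ^ c)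
  have hw : ∀ {x y z : Fin (m + n)}, cnt x y z j = c → word x y z ∈ S := fun h =>
    Module.End.mem_eigenspace_iff.2 (by rw [V3_K_word, h])
  have h₁ : cnt r p s j = c := by rw [← h]; unfold cnt; ring
  have h₂ : cnt s p r j = c := by rw [← h]; unfold cnt; ring
  have h₃ : cnt s r p j = c := by rw [← h]; unfold cnt; ring
  rw [brR_word]
  exact S.sub_mem (S.sub_mem (hw h) (S.smul_mem _ (hw h₁)))
    (S.smul_mem _ (S.sub_mem (hw h₂) (S.smul_mem _ (hw h₃))))

theorem V3_K_Gam (j : Fin (m + n)) (T : Tableau21 m n) :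
    (V3Rep m n).ρ (ug (.K j)) (Gam T) = q ^ cnt T.x T.y T.z j • Gam T := by
  rw [← Module.End.mem_eigenspace_iff]
  rcases Gam_cases T with ⟨-, -, h⟩ | ⟨-, -, h⟩ | ⟨h₀, -, -, h⟩ | ⟨h₀, -, -, h⟩ | ⟨h₀, -, -, h⟩ |
    ⟨h₀, -, -, h⟩ <;> rw [h]
  · exact Submodule.sub_mem _ (brR_mem_eigenspace _ (by unfold cnt; ring))
      (Submodule.smul_mem _ _ (brR_mem_eigenspace _ (by unfold cnt; ring)))
  · exact Submodule.sub_mem _ (brL_mem_eigenspace _ (by unfold cnt; ring))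
      (Submodule.smul_mem _ _ (brL_mem_eigenspace _ (by unfold cnt; ring)))
  · exact brR_mem_eigenspace _ (by rw [← h₀]; unfold cnt; ring)
  · exact brL_mem_eigenspace _ (by rw [← h₀]; unfold cnt; ring)
  · exact brL_mem_eigenspace _ (by rw [← h₀]; unfold cnt; ring)
  · exact brR_mem_eigenspace _ (by rw [← h₀])

/-! ### The operators `fᵢ eᵢ` on the elements `Γ` in the first letters -/

theorem par_mono {p r : Fin (m + n)} (h : p ≤ r) : par p ≤ par r := by
  unfold par
  have : p.val ≤ r.val := h
  split_ifs <;> omega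

theorem dq_even {p : Fin (m + n)} (h : par p = 0) : dq p = q := by
  unfold par at h; unfold dq
  split_ifs at h ⊢
  rfl

theorem dq_odd {p : Fin (m + n)} (h : par p = 1) : dq p = q⁻¹ := by
  unfold par at h; unfold dq
  split_ifs at h ⊢
  rfl

theorem lo_lt_hi (i : Fin (m + n - 1)) : lo i < hi i := Nat.lt_succ_self _

/-- `fᵢ eᵢ` acts by a nonzero scalar on the element `Γ` with letters `i, i+1, i+1`. -/
theorem f_e_Gam_ijj (i : Fin (m + n - 1)) : ∃ c : Kq, c ≠ 0 ∧
    (V3Rep m n).ρ (ug (.f i)) ((V3Rep m n).ρ (ug (.e i))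
      (Gam ⟨lo i, hi i, hi i, .inl (lo_lt_hi i), .inl (lo_lt_hi i)⟩)) =
      c • Gam ⟨lo i, hi i, hi i, .inl (lo_lt_hi i), .inl (lo_lt_hi i)⟩ := by
  have q0 := q_ne_zero
  have hlt := lo_lt_hi i
  -- For equal parities the vector is a lowest weight vector of a two-dimensional representation of
  -- U_q(gl₂), and the scalar is 1. For mixed parities fᵢ kills it and kᵢ has eigenvalue q³, so the
  -- scalar is (q³ - q⁻³)/(q - q⁻¹) = [3].
  rcases lohi_cases i with ⟨h₁, h₂, h₃, h₄, h₅⟩ | ⟨h₁, h₂, h₃, h₄, h₅⟩ | ⟨h₁, h₂, h₃, h₄, h₅⟩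
  · refine ⟨1, one_ne_zero, ?_⟩
    rw [Gam_ijj_even hlt h₂]
    simp only [brL_word, map_sub, map_smul, map_add, map_neg, map_zero, V3_e_word, V3_f_word, kval_lo, kval_hi,
      hlt.ne, hlt.ne', if_true, if_false, zero_smul, add_zero, zero_add, skew, sgn, h₁, h₂, h₃, h₄, h₅, mul_zero,
      pow_zero]
    match_scalars <;> field_simp <;> ring
  · refine ⟨1, one_ne_zero, ?_⟩
    rw [Gam_ijj_odd hlt h₂]
    simp only [brR_word, map_sub, map_smul, map_add, map_neg, map_zero, V3_e_word, V3_f_word, kval_lo, kval_hi,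
      hlt.ne, hlt.ne', if_true, if_false, zero_smul, add_zero, zero_add, skew, sgn, h₁, h₂, h₃, h₄, h₅, mul_zero,
      pow_zero, mul_one, pow_one]
    match_scalars <;> field_simp <;> ring
  · refine ⟨q ^ 2 + 1 + (q ^ 2)⁻¹, three_q_ne_zero, ?_⟩
    rw [Gam_ijj_odd hlt h₂]
    simp only [brR_word, map_sub, map_smul, map_add, map_neg, map_zero, V3_e_word, V3_f_word, kval_lo, kval_hi,
      hlt.ne, hlt.ne', if_true, if_false, zero_smul, add_zero, zero_add, skew, sgn, h₁, h₂, h₃, h₄, h₅, mul_zero,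
      zero_mul, pow_zero, mul_one, pow_one]
    match_scalars <;> field_simp <;> ring

end Action

/-! ### The sum of two operators fᵢ eᵢ on a weight space with three distinct letters -/

section Casimir

variable {m n : ℕ}

/-- The operator `fᵢ eᵢ + fⱼ eⱼ` on `V ⊗ V ⊗ V`. -/
def feSum (i j : Fin (m + n - 1)) (w : V3 m n) : V3 m n :=
  (V3Rep m n).ρ (ug (.f i)) ((V3Rep m n).ρ (ug (.e i)) w) +
    (V3Rep m n).ρ (ug (.f j)) ((V3Rep m n).ρ (ug (.e j)) w)

set_option maxHeartbeats 1000000 in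
-- Each eᵢ maps this two-dimensional weight space to a line, so a single fᵢ eᵢ has rank at most one
-- and cannot be invertible; hence the sum. Since even letters precede odd ones, this case,
-- `feSum_Gam_odd` and `feSum_Gam_mixed` cover all parities, the third letter being arbitrary here.
theorem feSum_Gam_even {i j : Fin (m + n - 1)} (h : hi i = lo j) (hp : par (hi i) = 0) :
    feSum i j (GamR (lo i) (hi i) (hi j)) =
      (q + q⁻¹) • GamR (lo i) (hi i) (hi j) - GamL (lo i) (hi i) (hi j) ∧
    feSum i j (GamL (lo i) (hi i) (hi j)) =
      (q + q⁻¹) • GamL (lo i) (hi i) (hi j) - GamR (lo i) (hi i) (hi j) := by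
  have q0 := q_ne_zero
  have h₁ := lo_lt_hi i
  have h₂ : hi i < hi j := h ▸ lo_lt_hi j
  have h₃ := h₁.trans h₂
  have p₁ : par (lo i) = 0 := by have := par_mono h₁.le; omega
  have r₁ : rpar i = 0 := by have := par_hi i; omega
  have r₂ : rpar j = par (hi j) := by have := par_hi j; rw [← h, hp] at this; omega
  have k₁ : kval i (hi j) = 1 := kval_of_ne i h₃.ne' h₂.ne'
  have k₂ : kval j (lo i) = 1 := kval_of_ne j (h ▸ h₁.ne) h₃.ne
  have k₃ : kval i (lo i) = q := by rw [kval_lo, dq_even p₁]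
  have k₄ : kval i (hi i) = q⁻¹ := by rw [kval_hi, dq_even hp]
  have k₅ : kval j (hi i) = q := by rw [h, kval_lo, ← h, dq_even hp]
  have k₆ : kval j (hi j) = (dq (hi j))⁻¹ := kval_hi j
  constructor
  all_goals
    simp only [feSum, GamR, GamL, brR_word, brL_word, map_sub, map_smul, map_add, map_zero,
      V3_e_word, V3_f_word, ← h, k₁, k₂, k₃, k₄, k₅, k₆, h₁.ne, h₁.ne', h₂.ne, h₂.ne', h₃.ne,
      h₃.ne', if_true, if_false, zero_smul, add_zero, zero_add, skew, sgn, r₁, r₂, p₁, hp,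
      mul_zero, zero_mul, pow_zero, one_mul, mul_one]
    match_scalars <;> field_simp <;> ring

theorem feSum_Gam_odd {i j : Fin (m + n - 1)} (h : hi i = lo j) (p₁ : par (lo i) = 1) :
    feSum i j (GamR (lo i) (hi i) (hi j)) =
      (q + q⁻¹) • GamR (lo i) (hi i) (hi j) + GamL (lo i) (hi i) (hi j) ∧
    feSum i j (GamL (lo i) (hi i) (hi j)) =
      (q + q⁻¹) • GamL (lo i) (hi i) (hi j) + GamR (lo i) (hi i) (hi j) := by
  have q0 := q_ne_zero
  have h₁ := lo_lt_hi i
  have h₂ : hi i < hi j := h ▸ lo_lt_hi j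
  have h₃ := h₁.trans h₂
  have hp : par (hi i) = 1 := by
    have := par_mono h₁.le; have := par_cases (hi i); omega
  have p₃ : par (hi j) = 1 := by
    have := par_mono h₂.le; have := par_cases (hi j); omega
  have r₁ : rpar i = 0 := by have := par_hi i; omega
  have r₂ : rpar j = 0 := by have := par_hi j; rw [← h, hp] at this; omega
  have k₁ : kval i (hi j) = 1 := kval_of_ne i h₃.ne' h₂.ne'
  have k₂ : kval j (lo i) = 1 := kval_of_ne j (h ▸ h₁.ne) h₃.ne
  have k₃ : kval i (lo i) = q⁻¹ := by rw [kval_lo, dq_odd p₁]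
  have k₄ : kval i (hi i) = q := by rw [kval_hi, dq_odd hp, inv_inv]
  have k₅ : kval j (hi i) = q⁻¹ := by rw [h, kval_lo, ← h, dq_odd hp]
  have k₆ : kval j (hi j) = q := by rw [kval_hi, dq_odd p₃, inv_inv]
  constructor
  all_goals
    simp only [feSum, GamR, GamL, brR_word, brL_word, map_sub, map_smul, map_add, map_zero,
      V3_e_word, V3_f_word, ← h, k₁, k₂, k₃, k₄, k₅, k₆, h₁.ne, h₁.ne', h₂.ne, h₂.ne', h₃.ne,
      h₃.ne', if_true, if_false, zero_smul, add_zero, zero_add, skew, sgn, r₁, r₂, p₁, hp, p₃,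
      mul_zero, zero_mul, pow_zero, pow_one, one_mul, mul_one]
    match_scalars <;> field_simp <;> ring

theorem feSum_Gam_mixed {i j : Fin (m + n - 1)} (h : hi i = lo j) (p₁ : par (lo i) = 0)
    (hp : par (hi i) = 1) :
    feSum i j (GamR (lo i) (hi i) (hi j)) =
      (2 * (q + q⁻¹)) • GamR (lo i) (hi i) (hi j) - GamL (lo i) (hi i) (hi j) ∧
    feSum i j (GamL (lo i) (hi i) (hi j)) = GamR (lo i) (hi i) (hi j) := by
  have q0 := q_ne_zero
  have h₁ := lo_lt_hi i
  have h₂ : hi i < hi j := h ▸ lo_lt_hi j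
  have h₃ := h₁.trans h₂
  have p₃ : par (hi j) = 1 := by
    have := par_mono h₂.le; have := par_cases (hi j); omega
  have r₁ : rpar i = 1 := by have := par_hi i; omega
  have r₂ : rpar j = 0 := by have := par_hi j; rw [← h, hp] at this; omega
  have k₁ : kval i (hi j) = 1 := kval_of_ne i h₃.ne' h₂.ne'
  have k₂ : kval j (lo i) = 1 := kval_of_ne j (h ▸ h₁.ne) h₃.ne
  have k₃ : kval i (lo i) = q := by rw [kval_lo, dq_even p₁]
  have k₄ : kval i (hi i) = q := by rw [kval_hi, dq_odd hp, inv_inv]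
  have k₅ : kval j (hi i) = q⁻¹ := by rw [h, kval_lo, ← h, dq_odd hp]
  have k₆ : kval j (hi j) = q := by rw [kval_hi, dq_odd p₃, inv_inv]
  constructor
  all_goals
    simp only [feSum, GamR, GamL, brR_word, brL_word, map_sub, map_smul, map_add, map_zero,
      V3_e_word, V3_f_word, ← h, k₁, k₂, k₃, k₄, k₅, k₆, h₁.ne, h₁.ne', h₂.ne, h₂.ne', h₃.ne,
      h₃.ne', if_true, if_false, zero_smul, add_zero, zero_add, skew, sgn, r₁, r₂, p₁, hp, p₃,
      mul_zero, zero_mul, pow_zero, pow_one, one_mul, mul_one]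
    match_scalars <;> field_simp <;> ring

/-- On the span of the two elements `Γ` with letters `i, i+1, i+2`, the operator `feSum` satisfies
a quadratic equation with nonzero constant term. -/
theorem feSum_quadratic {i j : Fin (m + n - 1)} (h : hi i = lo j) : ∃ b d : Kq, d ≠ 0 ∧
    ∀ w ∈ Submodule.span Kq ({GamR (lo i) (hi i) (hi j), GamL (lo i) (hi i) (hi j)} : Set (V3 m n)),
      feSum i j (feSum i j w) = b • feSum i j w - d • w := by
  have q0 := q_ne_zero
  let S : V3 m n →ₗ[Kq] V3 m n :=
    (V3Rep m n).ρ (ug (.f i)) ∘ₗ (V3Rep m n).ρ (ug (.e i)) +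
      (V3Rep m n).ρ (ug (.f j)) ∘ₗ (V3Rep m n).ρ (ug (.e j))
  have hS : ∀ w, feSum i j w = S w := fun w => rfl
  have key : ∀ b d : Kq, d ≠ 0 →
      S (S (GamR (lo i) (hi i) (hi j))) =
        b • S (GamR (lo i) (hi i) (hi j)) - d • GamR (lo i) (hi i) (hi j) →
      S (S (GamL (lo i) (hi i) (hi j))) =
        b • S (GamL (lo i) (hi i) (hi j)) - d • GamL (lo i) (hi i) (hi j) → ∃ b d : Kq, d ≠ 0 ∧
      ∀ w ∈ Submodule.span Kq ({GamR (lo i) (hi i) (hi j), GamL (lo i) (hi i) (hi j)} : Set (V3 m n)),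
      feSum i j (feSum i j w) = b • feSum i j w - d • w := by
    intro b d hd h₁ h₂
    refine ⟨b, d, hd, fun w hw => ?_⟩
    obtain ⟨x, y, rfl⟩ := Submodule.mem_span_pair.1 hw
    simp only [hS, map_add, map_smul, h₁, h₂]
    module
  -- Cayley–Hamilton: b is the trace 2(q + q⁻¹) in all three cases, and d is the determinant, (q +
  -- q⁻¹)² - 1 = [3] for equal parities of the first two letters and 1 for different ones.
  rcases par_cases (hi i) with hp | hp
  · obtain ⟨h₁, h₂⟩ := feSum_Gam_even h hp
    rw [hS] at h₁ h₂
    refine key (2 * (q + q⁻¹)) _ three_q_ne_zero ?_ ?_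
    all_goals
      simp only [h₁, h₂, map_sub, map_smul]
      match_scalars <;> field_simp <;> ring
  · rcases par_cases (lo i) with p₁ | p₁
    · obtain ⟨h₁, h₂⟩ := feSum_Gam_mixed h p₁ hp
      rw [hS] at h₁ h₂
      refine key (2 * (q + q⁻¹)) 1 one_ne_zero ?_ ?_
      all_goals
        simp only [h₁, h₂, map_sub, map_smul]
        match_scalars <;> field_simp
    · obtain ⟨h₁, h₂⟩ := feSum_Gam_odd h p₁
      rw [hS] at h₁ h₂
      refine key (2 * (q + q⁻¹)) _ three_q_ne_zero ?_ ?_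
      all_goals
        simp only [h₁, h₂, map_add, map_smul]
        match_scalars <;> field_simp <;> ring

end Casimir

/-- Since q is an indeterminate, the eigenvalues of the `K j` determine the multiplicities of the
letters. -/
theorem q_pow_injective {r s : ℕ} (h : q ^ r = q ^ s) : r = s := by
  have h' : (RatFunc.X : RatFunc ℂ) ^ r = RatFunc.X ^ s := h
  rw [← RatFunc.algebraMap_X, ← map_pow, ← map_pow] at h'
  have := congrArg Polynomial.natDegree
    (IsFractionRing.injective (Polynomial ℂ) (RatFunc ℂ) h')
  simpa using this

section Weights

variable {m n : ℕ}

/-! ### Weights of `I₃(V)` -/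

/-- The action of `U_q(gl(m|n))` on `I₃(V)`, as a homomorphism of algebras. -/
def I3Rep (m n : ℕ) : Uq m n →ₐ[Kq] Module.End Kq (I3V m n) :=
  { QSchur.rep m n idealI3 with
    commutes' := fun c => QSchur.ext fun x w => by
      have h : (V3Rep m n).ρ (algebraMap Kq (Uq m n) c) w = c • w := by
        rw [AlgHom.commutes]; rfl
      have h' : QSchur.act m n idealI3 (algebraMap Kq (Uq m n) c) (QSchur.mk m n idealI3 x w) =
          QSchur.mkLin m n x (c • w) := by rw [QSchur.act_mk, h]; rfl
      rw [map_smul] at h'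
      exact h' }

theorem smul_eq_I3Rep (u : Uq m n) (z : I3V m n) : u • z = I3Rep m n u z := rfl

theorem toTensor_I3Rep (u : Uq m n) (z : I3V m n) :
    toTensor m n idealI3 (I3Rep m n u z) = (V3Rep m n).ρ u (toTensor m n idealI3 z) :=
  map_smul (toTensor m n idealI3) u z

theorem toTensor_I3V_injective : Function.Injective (toTensor m n idealI3) :=
  toTensor_injective m n eIdem_one_eIdem

theorem toTensor_smul (c : Kq) (z : I3V m n) :
    toTensor m n idealI3 (c • z) = c • toTensor m n idealI3 z :=
  map_smul (toTensorLin m n idealI3) c z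

/-- The multiplicity of a letter in a tableau. -/
def Tableau21.mult (T : Tableau21 m n) (j : Fin (m + n)) : ℕ := cnt T.x T.y T.z j

theorem K_gamBasis (T : Tableau21 m n) (j : Fin (m + n)) :
    I3Rep m n (ug (.K j)) (gamBasis m n T) = q ^ T.mult j • gamBasis m n T :=
  toTensor_I3V_injective (by
    rw [toTensor_I3Rep, toTensor_smul, toTensor_gamBasis, V3_K_Gam, Tableau21.mult])

theorem repr_K (z : I3V m n) (T : Tableau21 m n) (j : Fin (m + n)) :
    (gamBasis m n).repr (I3Rep m n (ug (.K j)) z) T =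
      q ^ T.mult j * (gamBasis m n).repr z T := by
  have : (gamBasis m n).coord T ∘ₗ I3Rep m n (ug (.K j)) =
      q ^ T.mult j • (gamBasis m n).coord T := by
    refine (gamBasis m n).ext fun S => ?_
    rw [LinearMap.comp_apply, K_gamBasis, map_smul, LinearMap.smul_apply,
      Module.Basis.coord_apply, Module.Basis.repr_self]
    by_cases h : S = T
    · rw [h]
    · rw [Finsupp.single_eq_of_ne' h, smul_zero, smul_zero]
  exact LinearMap.congr_fun this z

/-- The operators `K j` are diagonal in the basis of the Γ. Any nonzero component of an eigenvector
therefore reveals its eigenvalue as a power of q with natural exponent. -/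
theorem eigenvalue_of_repr_ne_zero {z : I3V m n} {T : Tableau21 m n} {j : Fin (m + n)} {c : Kq}
    (h : I3Rep m n (ug (.K j)) z = c • z) (hz : (gamBasis m n).repr z T ≠ 0) :
    c = q ^ T.mult j := by
  have := repr_K z T j
  rw [h, map_smul, Finsupp.smul_apply, smul_eq_mul] at this
  exact mul_right_cancel₀ hz this

/-- The vectors of the weight of the tableau `T`. -/
def IsWt (T : Tableau21 m n) (z : I3V m n) : Prop :=
  ∀ j, I3Rep m n (ug (.K j)) z = q ^ T.mult j • z

theorem IsWt.mult_eq {T S : Tableau21 m n} {z : I3V m n} (h : IsWt T z)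
    (hz : (gamBasis m n).repr z S ≠ 0) : S.mult = T.mult :=
  funext fun j => (q_pow_injective (eigenvalue_of_repr_ne_zero (h j) hz)).symm

theorem gamBasis_isWt (T : Tableau21 m n) : IsWt T (gamBasis m n T) := K_gamBasis T

theorem I3_rels (m n : ℕ) : UqRels m n (fun i => I3Rep m n (ug (.e i)))
    (fun i => I3Rep m n (ug (.f i))) (fun j => I3Rep m n (ug (.K j)))
    (fun j => I3Rep m n (ug (.Kinv j))) := Uq.rels (I3Rep m n)

theorem Kinv_apply {z : I3V m n} {j : Fin (m + n)} {c : Kq} (hc : c ≠ 0)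
    (h : I3Rep m n (ug (.K j)) z = c • z) : I3Rep m n (ug (.Kinv j)) z = c⁻¹ • z := by
  have h₁ : I3Rep m n (ug (.Kinv j)) (I3Rep m n (ug (.K j)) z) = z :=
    LinearMap.congr_fun ((I3_rels m n).Kinv_K j) z
  rw [h, map_smul] at h₁
  conv_rhs => rw [← h₁, smul_smul, inv_mul_cancel₀ hc, one_smul]

theorem K_e_apply {z : I3V m n} {j : Fin (m + n)} {c : Kq}
    (h : I3Rep m n (ug (.K j)) z = c • z) (i : Fin (m + n - 1)) :
    I3Rep m n (ug (.K j)) (I3Rep m n (ug (.e i)) z) =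
      (wt j i * c) • I3Rep m n (ug (.e i)) z := by
  have := LinearMap.congr_fun ((I3_rels m n).K_e j i) z
  simp only [Module.End.mul_apply, LinearMap.smul_apply, h, map_smul, smul_smul] at this
  exact this

theorem K_f_apply {z : I3V m n} {j : Fin (m + n)} {c : Kq}
    (h : I3Rep m n (ug (.K j)) z = c • z) (i : Fin (m + n - 1)) :
    I3Rep m n (ug (.K j)) (I3Rep m n (ug (.f i)) z) =
      ((wt j i)⁻¹ * c) • I3Rep m n (ug (.f i)) z := by
  have := LinearMap.congr_fun ((I3_rels m n).K_f j i) z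
  simp only [Module.End.mul_apply, LinearMap.smul_apply, h, map_smul, smul_smul] at this
  exact this

/-- `fᵢ` kills the weights in which the letter `i` does not occur. -/
theorem f_eq_zero {T : Tableau21 m n} {z : I3V m n} (h : IsWt T z) {i : Fin (m + n - 1)}
    (hi₀ : T.mult (lo i) = 0) : I3Rep m n (ug (.f i)) z = 0 := by
  by_contra hne
  obtain ⟨S, hS⟩ : ∃ S, (gamBasis m n).repr (I3Rep m n (ug (.f i)) z) S ≠ 0 := by
    by_contra! hall
    exact hne ((gamBasis m n).repr.map_eq_zero_iff.1 (Finsupp.ext hall))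
  have := eigenvalue_of_repr_ne_zero (K_f_apply (h (lo i)) i) hS
  rw [hi₀, pow_zero, mul_one, wt, if_pos rfl] at this
  -- The weight of a nonzero image would contain the letter i with multiplicity -1, that is, q⁻¹
  -- would be a power of q with natural exponent.
  have h₁ : q ^ (S.mult (lo i) + 1) = q ^ 0 := by
    rw [pow_succ, ← this, inv_mul_cancel₀ q_ne_zero, pow_zero]
  exact absurd (q_pow_injective h₁) (Nat.succ_ne_zero _)

/-- If the letter `i` does not occur but `i+1` does, then `fᵢ eᵢ` acts by a nonzero scalar. -/
theorem f_e_of_gap {T : Tableau21 m n} {z : I3V m n} (h : IsWt T z) {i : Fin (m + n - 1)}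
    (h₀ : T.mult (lo i) = 0) (h₁ : T.mult (hi i) ≠ 0) : ∃ c : Kq, c ≠ 0 ∧
      I3Rep m n (ug (.f i)) (I3Rep m n (ug (.e i)) z) = c • z := by
  have q0 := q_ne_zero
  set r := T.mult (hi i) with hr
  have qr : q ^ r ≠ 0 := pow_ne_zero r q0
  have k₁ : I3Rep m n (ug (.K (lo i))) z = z := by rw [h, h₀, pow_zero, one_smul]
  have k₂ : I3Rep m n (ug (.Kinv (lo i))) z = z := by
    rw [Kinv_apply (one_ne_zero) (by rw [k₁, one_smul]), inv_one, one_smul]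
  have k₃ : I3Rep m n (ug (.K (hi i))) z = q ^ r • z := h (hi i)
  have k₄ : I3Rep m n (ug (.Kinv (hi i))) z = (q ^ r)⁻¹ • z := Kinv_apply qr k₃
  -- Here r ≥ 1, and q is not a root of unity.
  have hne : q ^ r - (q ^ r)⁻¹ ≠ 0 := fun h' => by
    have h2 : q ^ (r + r) = q ^ 0 := by
      rw [pow_add, pow_zero]
      nth_rw 1 [sub_eq_zero.1 h']
      exact inv_mul_cancel₀ qr
    have := q_pow_injective h2
    omega
  -- `K (lo i)` fixes z, so kᵢ acts on it by q⁻ʳ or qʳ according to the parity of the letter i+1.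
  obtain ⟨c, hc, hcz⟩ : ∃ c : Kq, c ≠ 0 ∧
      (cartan (fun j => I3Rep m n (ug (.K j))) (fun j => I3Rep m n (ug (.Kinv j))) i -
        cartan (fun j => I3Rep m n (ug (.Kinv j))) (fun j => I3Rep m n (ug (.K j))) i) z =
      c • z := by
    unfold cartan
    rcases par_cases (hi i) with hp | hp
    · refine ⟨-(q ^ r - (q ^ r)⁻¹), neg_ne_zero.2 hne, ?_⟩
      simp only [if_pos hp, LinearMap.sub_apply]
      split_ifs <;>
        simp only [Module.End.mul_apply, k₁, k₂, k₃, k₄, map_smul] <;> module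
    · have hp' : par (hi i) ≠ 0 := by rw [hp]; exact one_ne_zero
      refine ⟨q ^ r - (q ^ r)⁻¹, hne, ?_⟩
      simp only [if_neg hp', LinearMap.sub_apply]
      split_ifs <;>
        simp only [Module.End.mul_apply, k₁, k₂, k₃, k₄, map_smul] <;> module
  -- As fᵢ z = 0, only the term with fᵢ eᵢ remains on the left of the relation between eᵢ and fᵢ.
  have hef := LinearMap.congr_fun ((I3_rels m n).e_f i i) z
  rw [if_pos rfl, LinearMap.smul_apply, hcz, LinearMap.sub_apply, LinearMap.smul_apply,
    Module.End.mul_apply, Module.End.mul_apply, f_eq_zero h h₀, map_zero, zero_sub,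
    smul_smul] at hef
  set s : Kq := (-1) ^ (rpar i * rpar i) with hs
  have hss : s * s = 1 := SuperRep.sign_sq _
  refine ⟨-s * ((dq (lo i) - (dq (lo i))⁻¹)⁻¹ * c), mul_ne_zero
    (neg_ne_zero.2 (left_ne_zero_of_mul_eq_one hss))
    (mul_ne_zero (inv_ne_zero (dq_sub_ne_zero _)) hc), ?_⟩
  rw [mul_smul, ← hef, smul_neg, neg_smul, neg_neg, smul_smul, hss, one_smul]

end Weights

section Irreducible

variable {m n : ℕ}

/-! ### Irreducibility of `I₃(V)` -/

/-- The sum of the positions of the letters of a tableau. -/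
def Tableau21.size (T : Tableau21 m n) : ℕ := T.x.val + T.y.val + T.z.val

theorem Tableau21.size_eq_sum (T : Tableau21 m n) : T.size = ∑ j, j.val * T.mult j := by
  simp only [Tableau21.mult, cnt, mul_add, Finset.sum_add_distrib, mul_ite, mul_one, mul_zero,
    Finset.sum_ite_eq, Finset.mem_univ, if_true, Tableau21.size]

theorem Tableau21.mult_ne_zero {T : Tableau21 m n} {j : Fin (m + n)} :
    T.mult j ≠ 0 ↔ T.x = j ∨ T.y = j ∨ T.z = j := by
  unfold Tableau21.mult cnt
  split_ifs <;> simp_all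

/-- The simple root whose second letter is the nonzero letter `j`. -/
theorem exists_hi {j : Fin (m + n)} (h : j.val ≠ 0) :
    ∃ i : Fin (m + n - 1), hi i = j ∧ (lo i).val + 1 = j.val :=
  ⟨⟨j.val - 1, by omega⟩, Fin.ext (show j.val - 1 + 1 = j.val by omega),
    show j.val - 1 + 1 = j.val by omega⟩

/-- Without a gap the letters fill an initial segment, so they are 0,0,0 or 0,0,1 or 0,1,1 or 0,1,2.
The first is not semistandard for any parity of the letter 0, and the second has sum 1. -/
theorem Tableau21.cases_of_size_ne_one (T : Tableau21 m n) (h : T.size ≠ 1) :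
    (∃ i, T.mult (lo i) = 0 ∧ T.mult (hi i) ≠ 0) ∨
    (∃ i, T.x = lo i ∧ T.y = hi i ∧ T.z = hi i ∧ (lo i).val = 0) ∨
    (∃ i j, hi i = lo j ∧ (lo i).val = 0 ∧ T.x = lo i ∧
      ((T.y = hi i ∧ T.z = hi j) ∨ (T.y = hi j ∧ T.z = hi i))) := by
  by_contra! hcon
  obtain ⟨hgap, hcon₁, hcon₂⟩ := hcon
  -- Absence of gaps, restated: the predecessor of every nonzero letter that occurs also occurs.
  have gap : ∀ j : Fin (m + n), (T.x = j ∨ T.y = j ∨ T.z = j) → j.val ≠ 0 →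
      (T.x.val + 1 = j.val ∨ T.y.val + 1 = j.val ∨ T.z.val + 1 = j.val) := by
    intro j hj hj₀
    obtain ⟨i, rfl, -⟩ := exists_hi hj₀
    have h₁ := mult_ne_zero.1 (fun h₀ => mult_ne_zero.2 hj (hgap i h₀))
    simp only [Fin.ext_iff] at h₁
    have : (hi i).val = (lo i).val + 1 := rfl
    omega
  have gx := gap T.x (.inl rfl)
  have gy := gap T.y (.inr (.inl rfl))
  have gz := gap T.z (.inr (.inr rfl))
  have hp := T.row
  have hc := T.col
  simp only [Fin.ext_iff, Fin.lt_def] at hp hc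
  unfold size at h
  have hx : T.x.val = 0 := by omega
  have h₁ : (T.y.val = 1 ∧ T.z.val = 1) ∨ (T.y.val = 1 ∧ T.z.val = 2) ∨
      (T.y.val = 2 ∧ T.z.val = 1) := by omega
  rcases h₁ with ⟨hy, hz⟩ | ⟨hy, hz⟩ | ⟨hy, hz⟩
  · obtain ⟨i, hi₁, hi₀⟩ := exists_hi (j := T.y) (by omega)
    exact hcon₁ i (Fin.ext (by omega)) hi₁.symm (Fin.ext (by rw [hi₁]; omega)) (by omega)
  · obtain ⟨i, hi₁, hi₀⟩ := exists_hi (j := T.y) (by omega)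
    obtain ⟨j, hj₁, hj₀⟩ := exists_hi (j := T.z) (by omega)
    exact (hcon₂ i j (Fin.ext (by rw [hi₁]; omega)) (by omega) (Fin.ext (by omega))).1
      hi₁.symm hj₁.symm
  · obtain ⟨i, hi₁, hi₀⟩ := exists_hi (j := T.z) (by omega)
    obtain ⟨j, hj₁, hj₀⟩ := exists_hi (j := T.y) (by omega)
    exact (hcon₂ i j (Fin.ext (by rw [hi₁]; omega)) (by omega) (Fin.ext (by omega))).2
      hj₁.symm hi₁.symm

/-- The letters are 0,0,1, and the parity of the letter 0 decides whether the two zeros stand in the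
row or in the column. -/
theorem Tableau21.eq_of_size_eq_one {S T : Tableau21 m n} (hS : S.size = 1) (hT : T.size = 1) :
    S = T := by
  have h₁ := S.row
  have h₂ := S.col
  have h₃ := T.row
  have h₄ := T.col
  unfold size at hS hT
  have hx : S.x = T.x := by
    simp only [Fin.ext_iff, Fin.lt_def] at *
    omega
  rw [hx] at h₁ h₂
  simp only [Fin.ext_iff, Fin.lt_def] at *
  have hy : S.y.val = T.y.val := by omega
  exact Tableau21.ext (Fin.ext hx) (Fin.ext hy) (Fin.ext (by omega))

theorem Tableau21.size_eq_of_mult_eq {S T : Tableau21 m n} (h : S.mult = T.mult) :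
    S.size = T.size := by
  rw [size_eq_sum, size_eq_sum, h]

theorem exists_repr_ne_zero {z : I3V m n} (hz : z ≠ 0) : ∃ S, (gamBasis m n).repr z S ≠ 0 := by
  by_contra! hall
  exact hz ((gamBasis m n).repr.map_eq_zero_iff.1 (Finsupp.ext hall))

/-- If `eᵢ` maps a vector of weight `T` to something with a component on `S`, then `S` is smaller. -/
theorem size_lt_of_e {S T : Tableau21 m n} {z : I3V m n} (h : IsWt T z) {i : Fin (m + n - 1)}
    (hz : (gamBasis m n).repr (I3Rep m n (ug (.e i)) z) S ≠ 0) :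
    S.size + 1 = T.size ∧ IsWt S (I3Rep m n (ug (.e i)) z) := by
  have q0 := q_ne_zero
  have hK : ∀ j, wt j i * q ^ T.mult j = q ^ S.mult j := fun j =>
    eigenvalue_of_repr_ne_zero (K_e_apply (h j) i) hz
  -- Both indicators are added rather than subtracted, so that the comparison of exponents stays in
  -- the natural numbers. Summing it against positions gives the change of `size`.
  have hm : ∀ j, S.mult j + (if j = hi i then 1 else 0) =
      T.mult j + (if j = lo i then 1 else 0) := fun j => by
    have := hK j
    unfold wt at this
    apply q_pow_injective
    rw [pow_add, ← this]
    have hne := lo_ne_hi i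
    split_ifs <;> simp_all [pow_succ, mul_comm]
  refine ⟨?_, fun j => ?_⟩
  · have hs : ∑ j : Fin (m + n), j.val * (S.mult j + (if j = hi i then 1 else 0)) =
        ∑ j : Fin (m + n), j.val * (T.mult j + (if j = lo i then 1 else 0)) :=
      Finset.sum_congr rfl fun j _ => by rw [hm]
    simp only [mul_add, Finset.sum_add_distrib, mul_ite, mul_one, mul_zero, Finset.sum_ite_eq',
      Finset.mem_univ, if_true, ← Tableau21.size_eq_sum] at hs
    have : (hi i).val = (lo i).val + 1 := rfl
    omega
  · rw [K_e_apply (h j) i, hK]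

/-- The submodule generated by the vectors `eᵢ z`. -/
def loweredSpan (z : I3V m n) : Submodule (Uq m n) (I3V m n) :=
  Submodule.span (Uq m n) (Set.range fun i : Fin (m + n - 1) => (ug (.e i) : Uq m n) • z)

theorem f_e_mem_loweredSpan (i : Fin (m + n - 1)) (z : I3V m n) (u : Uq m n) :
    u • (ug (.e i) : Uq m n) • z ∈ loweredSpan z :=
  Submodule.smul_mem _ _ (Submodule.subset_span ⟨i, rfl⟩)

theorem Kq_smul_mem {N : Submodule (Uq m n) (I3V m n)} {z : I3V m n} (c : Kq) (h : z ∈ N) :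
    c • z ∈ N := by
  have : c • z = algebraMap Kq (Uq m n) c • z := by
    rw [smul_eq_I3Rep, AlgHom.commutes]; rfl
  rw [this]
  exact N.smul_mem _ h

theorem mem_of_Kq_smul_mem {N : Submodule (Uq m n) (I3V m n)} {z : I3V m n} {c : Kq} (hc : c ≠ 0)
    (h : c • z ∈ N) : z ∈ N := by
  have := Kq_smul_mem c⁻¹ h
  rwa [smul_smul, inv_mul_cancel₀ hc, one_smul] at this

/-- A submodule over `U_q(gl(m|n))`, as a subspace over `ℂ(q)`. -/
def toKq (N : Submodule (Uq m n) (I3V m n)) : Submodule Kq (I3V m n) where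
  carrier := N
  add_mem' := N.add_mem
  zero_mem' := N.zero_mem
  smul_mem' c _ h := Kq_smul_mem c h

/-- A vector whose components all lie in a subspace lies in it. -/
theorem mem_of_repr {P : Submodule Kq (I3V m n)} {z : I3V m n}
    (h : ∀ S, (gamBasis m n).repr z S ≠ 0 → gamBasis m n S ∈ P) : z ∈ P := by
  rw [← (gamBasis m n).linearCombination_repr z, Finsupp.linearCombination_apply]
  exact Submodule.sum_mem _ fun S hS =>
    Submodule.smul_mem _ _ (h S (Finsupp.mem_support_iff.1 hS))

theorem Tableau21.mult_ne_zero_of_eq {S T : Tableau21 m n} (h : S.mult = T.mult)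
    (j : Fin (m + n)) : (S.x = j ∨ S.y = j ∨ S.z = j) ↔ (T.x = j ∨ T.y = j ∨ T.z = j) := by
  rw [← mult_ne_zero, ← mult_ne_zero, h]

/-- The core of irreducibility, used in two directions. A nonzero vector as here is not killed by
all the eᵢ, so one can move towards the highest weight; and it can be recovered from the vectors eᵢ
z, so one can move back. -/
theorem mem_loweredSpan {T : Tableau21 m n} (hT : T.size ≠ 1) {z : I3V m n} (h : IsWt T z) :
    z ∈ loweredSpan z := by
  rcases T.cases_of_size_ne_one hT with ⟨i, h₀, h₁⟩ | ⟨i, hx, hy, hz, h0⟩ |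
    ⟨i, j, hij, h0, hx, hyz⟩
  · obtain ⟨c, hc, hcz⟩ := f_e_of_gap h h₀ h₁
    refine mem_of_Kq_smul_mem hc ?_
    rw [← hcz]
    exact f_e_mem_loweredSpan i z _
  · obtain ⟨c, hc, hcT⟩ := f_e_Gam_ijj i
    -- The identity is linear, so it need only hold for the Γ of the same weight as z.
    -- Semistandardness leaves a single tableau with letters i, i+1, i+1.
    have hcz : z ∈ LinearMap.ker (I3Rep m n (ug (.f i)) ∘ₗ I3Rep m n (ug (.e i)) -
        c • (LinearMap.id : I3V m n →ₗ[Kq] I3V m n)) := by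
      refine mem_of_repr fun S hS => ?_
      have hm := h.mult_eq hS
      have hsz := Tableau21.size_eq_of_mult_eq hm
      have e₁ := (Tableau21.mult_ne_zero_of_eq hm S.y).1 (.inr (.inl rfl))
      have e₂ := (Tableau21.mult_ne_zero_of_eq hm S.z).1 (.inr (.inr rfl))
      have e₃ := S.row
      have e₄ := S.col
      have e₅ : (hi i).val = (lo i).val + 1 := rfl
      simp only [hx, hy, hz, Tableau21.size, Fin.ext_iff, Fin.lt_def] at e₁ e₂ e₃ e₄ hsz
      obtain rfl : S = ⟨lo i, hi i, hi i, .inl (lo_lt_hi i), .inl (lo_lt_hi i)⟩ :=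
        Tableau21.ext (Fin.ext (by simp only; omega)) (Fin.ext (by simp only; omega))
          (Fin.ext (by simp only; omega))
      rw [LinearMap.mem_ker, LinearMap.sub_apply, sub_eq_zero]
      refine toTensor_I3V_injective ?_
      rw [LinearMap.comp_apply, toTensor_I3Rep, toTensor_I3Rep, toTensor_gamBasis, hcT,
        LinearMap.smul_apply, toTensor_smul, LinearMap.id_apply, toTensor_gamBasis]
    rw [LinearMap.mem_ker, LinearMap.sub_apply, sub_eq_zero] at hcz
    refine mem_of_Kq_smul_mem hc ?_
    have := f_e_mem_loweredSpan i z (ug (.f i))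
    rwa [show (ug (.f i) : Uq m n) • (ug (.e i) : Uq m n) • z = c • z from hcz] at this
  · obtain ⟨b, d, hd, hq⟩ := feSum_quadratic hij
    -- Only two semistandard tableaux have these three distinct letters: the smallest is in the
    -- corner, and the other two may be placed either way.
    have hz : z ∈ (Submodule.span Kq ({GamR (lo i) (hi i) (hi j), GamL (lo i) (hi i) (hi j)} :
        Set (V3 m n))).comap (toTensorLin m n idealI3) := by
      refine mem_of_repr fun S hS => ?_
      have hm := h.mult_eq hS
      have hsz := Tableau21.size_eq_of_mult_eq hm
      have e₀ := (Tableau21.mult_ne_zero_of_eq hm (lo i)).2 (.inl hx)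
      have e₁ := (Tableau21.mult_ne_zero_of_eq hm S.y).1 (.inr (.inl rfl))
      have e₂ := (Tableau21.mult_ne_zero_of_eq hm S.z).1 (.inr (.inr rfl))
      have e₃ := S.row
      have e₄ := S.col
      have e₅ : (hi i).val = (lo i).val + 1 := rfl
      have e₆ : (hi j).val = (lo j).val + 1 := rfl
      have e₇ := congrArg Fin.val hij
      have h₁ := lo_lt_hi i
      have h₂ : hi i < hi j := hij ▸ lo_lt_hi j
      show toTensor m n idealI3 (gamBasis m n S) ∈ Submodule.span Kq
        ({GamR (lo i) (hi i) (hi j), GamL (lo i) (hi i) (hi j)} : Set (V3 m n))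
      rw [toTensor_gamBasis]
      have hS' : (S.x.val = (lo i).val ∧ S.y.val = (hi i).val ∧ S.z.val = (hi j).val) ∨
          (S.x.val = (lo i).val ∧ S.y.val = (hi j).val ∧ S.z.val = (hi i).val) := by
        rcases hyz with ⟨hy, hz⟩ | ⟨hy, hz⟩ <;>
          simp only [hx, hy, hz, Tableau21.size, Fin.ext_iff, Fin.lt_def] at e₀ e₁ e₂ e₃ e₄ hsz <;>
          omega
      rcases hS' with ⟨a₁, a₂, a₃⟩ | ⟨a₁, a₂, a₃⟩
      · obtain rfl : S = ⟨lo i, hi i, hi j, .inl h₁, .inl (h₁.trans h₂)⟩ :=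
          Tableau21.ext (Fin.ext a₁) (Fin.ext a₂) (Fin.ext a₃)
        rw [Gam_eq_GamR h₁ h₂]
        exact Submodule.subset_span (Or.inl rfl)
      · obtain rfl : S = ⟨lo i, hi j, hi i, .inl (h₁.trans h₂), .inl h₁⟩ :=
          Tableau21.ext (Fin.ext a₁) (Fin.ext a₂) (Fin.ext a₃)
        rw [Gam_eq_GamL h₁ h₂]
        exact Submodule.subset_span (Or.inr rfl)
    have hq' := hq _ hz
    let S : I3V m n → I3V m n := fun y => (ug (.f i) : Uq m n) • (ug (.e i) : Uq m n) • y +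
      (ug (.f j) : Uq m n) • (ug (.e j) : Uq m n) • y
    have hS : ∀ y, toTensor m n idealI3 (S y) = feSum i j (toTensor m n idealI3 y) := fun y => by
      simp only [S, map_add, map_smul]
      rfl
    have h₁ : S z ∈ loweredSpan z :=
      Submodule.add_mem _ (f_e_mem_loweredSpan i z _) (f_e_mem_loweredSpan j z _)
    have h₂ : S (S z) ∈ loweredSpan z := Submodule.add_mem _
      (Submodule.smul_mem _ _ (Submodule.smul_mem _ _ h₁))
      (Submodule.smul_mem _ _ (Submodule.smul_mem _ _ h₁))
    -- The quadratic equation solved for its constant term; the right-hand side consists of elements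
    -- of the submodule generated by the eᵢ z.
    have h₃ : d • z = b • S z - S (S z) := toTensor_I3V_injective (by
      rw [map_sub, toTensor_smul, toTensor_smul, hS (S z), hS z]
      have : feSum i j (feSum i j (toTensor m n idealI3 z)) =
        b • feSum i j (toTensor m n idealI3 z) - d • toTensor m n idealI3 z := hq'
      rw [this, sub_sub_cancel])
    refine mem_of_Kq_smul_mem hd ?_
    rw [h₃]
    exact Submodule.sub_mem _ (Kq_smul_mem b h₁) h₂

/-- A nonzero submodule contains a nonzero weight vector. -/
theorem exists_isWt_mem {N : Submodule (Uq m n) (I3V m n)} (hN : N ≠ ⊥) :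
    ∃ (T : Tableau21 m n) (z : I3V m n), z ∈ N ∧ z ≠ 0 ∧ IsWt T z := by
  obtain ⟨z, hz, hz0⟩ := N.ne_bot_iff.1 hN
  generalize hk : ((gamBasis m n).repr z).support.card = k
  induction k using Nat.strong_induction_on generalizing z with
  | _ k ih =>
    obtain ⟨T, hT⟩ := exists_repr_ne_zero hz0
    by_cases hw : IsWt T z
    · exact ⟨T, z, hz, hz0, hw⟩
    · obtain ⟨j, hj⟩ := not_forall.1 hw
      have hr : ∀ S, (gamBasis m n).repr (I3Rep m n (ug (.K j)) z - q ^ T.mult j • z) S =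
          (q ^ S.mult j - q ^ T.mult j) * (gamBasis m n).repr z S := fun S => by
        rw [map_sub, map_smul, Finsupp.sub_apply, Finsupp.smul_apply, repr_K, smul_eq_mul, sub_mul]
      -- This difference is nonzero because z fails the weight condition at j. Its support is
      -- contained in that of z and loses T, where the factor vanishes.
      refine ih _ ?_ (I3Rep m n (ug (.K j)) z - q ^ T.mult j • z)
        (N.sub_mem (N.smul_mem (ug (.K j)) hz) (Kq_smul_mem _ hz)) (sub_ne_zero.2 hj) rfl
      rw [← hk]
      refine Finset.card_lt_card (Finset.ssubset_iff_subset_ne.2 ⟨fun S hS => ?_, fun he => ?_⟩)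
      · rw [Finsupp.mem_support_iff, hr] at hS
        exact Finsupp.mem_support_iff.2 (right_ne_zero_of_mul hS)
      · have := Finsupp.mem_support_iff.2 hT
        rw [← he, Finsupp.mem_support_iff, hr, sub_self, zero_mul] at this
        exact this rfl

/-- A nonzero submodule contains the highest weight vector. -/
theorem exists_highest_mem {N : Submodule (Uq m n) (I3V m n)} (hN : N ≠ ⊥) :
    ∃ T : Tableau21 m n, T.size = 1 ∧ gamBasis m n T ∈ N := by
  obtain ⟨T, z, hz, hz0, hw⟩ := exists_isWt_mem hN
  generalize hk : T.size = k
  induction k using Nat.strong_induction_on generalizing T z with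
  | _ k ih =>
    by_cases h1 : T.size = 1
    · refine ⟨T, h1, ?_⟩
      have hS : ∀ S, (gamBasis m n).repr z S ≠ 0 → S = T := fun S hS =>
        Tableau21.eq_of_size_eq_one
          ((Tableau21.size_eq_of_mult_eq (hw.mult_eq hS)).trans h1) h1
      have hzT : z = (gamBasis m n).repr z T • gamBasis m n T := by
        refine (gamBasis m n).ext_elem fun S => ?_
        rw [map_smul, Finsupp.smul_apply, Module.Basis.repr_self, smul_eq_mul]
        by_cases hST : S = T
        · rw [hST, Finsupp.single_eq_same, mul_one]
        · rw [Finsupp.single_eq_of_ne hST, mul_zero]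
          by_contra hne
          exact hST (hS S hne)
      obtain ⟨S, hS0⟩ := exists_repr_ne_zero hz0
      have hT0 : (gamBasis m n).repr z T ≠ 0 := hS S hS0 ▸ hS0
      rw [hzT] at hz
      exact mem_of_Kq_smul_mem hT0 hz
    · obtain ⟨i, hi₀⟩ : ∃ i, I3Rep m n (ug (.e i)) z ≠ 0 := by
        by_contra! hall
        have hle : loweredSpan z ≤ ⊥ := Submodule.span_le.2 (by
          rintro _ ⟨i, rfl⟩
          exact hall i)
        exact hz0 (hle (mem_loweredSpan h1 hw))
      obtain ⟨S, hS⟩ := exists_repr_ne_zero hi₀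
      obtain ⟨hlt, hwS⟩ := size_lt_of_e hw hS
      exact ih S.size (by omega) S _ (N.smul_mem (ug (.e i)) hz) hi₀ hwS rfl

/-- Induction from the highest weight downwards: the components of each eᵢ Γ belong to tableaux of
smaller sum, hence to N, and Γ is recovered from the eᵢ Γ by `mem_loweredSpan`. -/
theorem gamBasis_mem_of_ne_bot {N : Submodule (Uq m n) (I3V m n)} (hN : N ≠ ⊥)
    (T : Tableau21 m n) : gamBasis m n T ∈ N := by
  obtain ⟨T₀, h₀, hT₀⟩ := exists_highest_mem hN
  generalize hk : T.size = k
  induction k using Nat.strong_induction_on generalizing T with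
  | _ k ih =>
    by_cases h1 : T.size = 1
    · rwa [Tableau21.eq_of_size_eq_one h1 h₀]
    · have hle : loweredSpan (gamBasis m n T) ≤ N := Submodule.span_le.2 (by
        rintro _ ⟨i, rfl⟩
        have : I3Rep m n (ug (.e i)) (gamBasis m n T) ∈ toKq N := mem_of_repr fun S hS =>
          ih S.size (by have := (size_lt_of_e (gamBasis_isWt T) hS).1; omega) S rfl
        exact this)
      exact hle (mem_loweredSpan h1 (gamBasis_isWt T))

theorem isSimpleModule_I3V (h : 2 ≤ m + n) : IsSimpleModule (Uq m n) (I3V m n) := by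
  have hlt : (⟨0, by omega⟩ : Fin (m + n)) < ⟨1, by omega⟩ := Nat.zero_lt_one
  -- Two letters suffice for a nonzero module: the tableau with first row 0 1 and second row 1 is
  -- semistandard whatever the parities.
  have : Nonempty (Tableau21 m n) := ⟨⟨⟨0, by omega⟩, ⟨1, by omega⟩, ⟨1, by omega⟩,
    .inl hlt, .inl hlt⟩⟩
  have : Nontrivial (I3V m n) := (gamBasis m n).repr.toEquiv.nontrivial
  refine (isSimpleModule_iff _ _).2 { eq_bot_or_eq_top := fun N => ?_ }
  refine or_iff_not_imp_left.2 fun hN => eq_top_iff.2 fun z _ => ?_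
  have : z ∈ toKq N := mem_of_repr fun S _ => gamBasis_mem_of_ne_bot hN S
  exact this

end Irreducible

end Parastat

end

theorem mainTheorem6 (m n : ℕ) :
    (2 ≤ m + n → IsSimpleModule (Parastat.Uq m n) (Parastat.I3V m n)) ∧
    Nonempty (Parastat.I3V m n ≃ₗ[Parastat.Uq m n] Parastat.V21 m n) ∧
    Function.Injective (Parastat.toTensor m n Parastat.idealI3) ∧
    ∃ b : Module.Basis (Parastat.Tableau21 m n) Parastat.Kq (Parastat.I3V m n),
      ∀ T, Parastat.toTensor m n Parastat.idealI3 (b T) = Parastat.Gam T :=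
  ⟨Parastat.isSimpleModule_I3V, Parastat.I3V_equiv_V21 m n, Parastat.toTensor_I3V_injective,
    Parastat.gamBasis m n, Parastat.toTensor_gamBasis⟩
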